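/- \textbf{Trees.} A stream network is a finite planted binary tree with positive edge (link) lengths. Sources have order $1$; when two links of the same order $k$ merge, the link downstream of the junction has order $k+1$, and when links of different orders merge it has the larger order. The order $\mathsf{ord}(T)$ of a tree is the order of its root link; a stream of order $k$ is a maximal chain of links of order $k$, and the basin of a stream is the subtree that it drains. \textbf{Model.} Fix $c\ge 1$ and $\gamma>0$, and put $T_k=(c-1)c^{k-1}$ $(k\ge1)$ and $\lambda_j=\gamma c^{1-j}$ $(j\ge 1)$. In the critical Tokunaga model the order $K\ge 1$ of the random tree $T$ has probability $2^{-K}$. A tree of order $K$ consists of a main stream of exponential length with rate $\lambda_K$; if $K\ge2$, two trees of order $K-1$ are attached at its upstream end, and for each $i<K$ trees of order $i$ are attached to it at the points of a homogeneous Poisson process of intensity $\lambda_K T_{K-i}$; all attached trees are generated by the same procedure, and all these choices are independent. The local contributing area of a link of length $x$ is $a(x)$, where $a\ge 0$ is measurable and the mean of $a$ under the exponential law with rate $\gamma$ is positive and finite. \textbf{Attributes.} Let $N_i[K]$ be the mean number of streams of order $i$ in a tree conditioned to have order $K$. For an attribute $Z$ of streams, the mean of $Z$ over the streams of order $i$ is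 the ratio of the expected sum of $Z$ over the streams of order $i$ in a tree conditioned to have order $K\ge i$, to $N_i[K]$. Let $M_i$, $A_i$, $S_i$, $L_i$, $\Lambda_i$ be the means, over the streams of order $i$, of the number of sources in the basin, the total contributing area of the basin (the sum of the local areas of its links), the number of links in the stream, the length of the stream, and the height of the basin (length of the longest path from its outlet to a source). Say that $R>0$ is the Horton exponent of a sequence $(Z_k)$ if $\lim_{k\to\infty} Z_kR^{-k}$ exists and lies in $(0,\infty)$. \textbf{Statement.} All these means are finite, and $M_i,A_i,S_i,L_i,\Lambda_i$ do not depend on the choice of $K\ge i$. The sequences $(N_1[K])_{K}$, $(M_k)$, $(A_k)$, $(S_k)$, $(L_k)$ and, if $c>1$, $(\Lambda_k)$ have unique Horton exponents $R_B,R_M,R_A,R_S,R_L,R_\Lambda$, and $$2c=R_B=R_M=R_A\;>\;R_S=R_L=R_\Lambda=c$$ (with $R_\Lambda$ omitted if $c=1$). Moreover $\lim_{K\to\infty}N_i[K]/N_{i+1}[K]=R_B=2c$ for every $i\ge1$; the only real root in $(0,1/2]$ of $\hat t(z)=-1+2z+\sum_{k\ge1}T_kz^k$ (where the series converges) is $w_0=1/(2c)$;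 and $S_K=1+\sum_{i=1}^{K-1}T_i=c^{K-1}$ for all $K\ge1$. -/

import Mathlib

open MeasureTheory ProbabilityTheory Filter Topology Set

/-- A finite nonempty planted binary tree with real edge lengths (a stream network). The root edge
(the most downstream link) has length `ℓ`; its upstream end is either a source, `leaf ℓ`, or a
junction of two subtrees, `node ℓ l r`. The left-right order of subtrees plays no role. -/
inductive StreamTree : Type
  | leaf (ℓ : ℝ) : StreamTree
  | node (ℓ : ℝ) (l r : StreamTree) : StreamTree

namespace StreamTree

/-- The combinatorial shape of a tree, written in preorder (`false` for a source, `true` for a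
junction). -/
def shape : StreamTree → List Bool
  | leaf _ => [false]
  | node _ l r => true :: (l.shape ++ r.shape)

/-- The lengths of the links of a tree, in preorder. -/
def lengths : StreamTree → List ℝ
  | leaf ℓ => [ℓ]
  | node ℓ l r => ℓ :: (l.lengths ++ r.lengths)

/-- A tree is determined by its shape (one of countably many) and by the finite list of its link
lengths; the σ-algebra is the one generated by the shape and by the individual lengths. -/
instance : MeasurableSpace StreamTree :=
  MeasurableSpace.comap shape ⊤ ⊔
    ⨆ n : ℕ, MeasurableSpace.comap (fun t : StreamTree => t.lengths.getD n 0) inferInstance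

/-- The Horton-Strahler order of a tree, which is also the order of its root link. -/
def ord : StreamTree → ℕ
  | leaf _ => 1
  | node _ l r => if l.ord = r.ord then l.ord + 1 else max l.ord r.ord

/-- The streams other than the root stream, each represented by the subtree (basin) that it drains.
A stream is a maximal chain of links of equal order: a link with a child link of its own order
continues into it, and every other child link is the most downstream link of a new stream. -/
def tributaries : StreamTree → List StreamTree
  | leaf _ => []
  | node ℓ l r =>
      (if l.ord = (node ℓ l r).ord then l.tributaries else l :: l.tributaries) ++
      (if r.ord = (node ℓ l r).ord then r.tributaries else r :: r.tributaries)

/-- The streams of order `i`, each represented by the subtree (basin) that it drains, whose root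
stream it is. -/
def streams (i : ℕ) (t : StreamTree) : List StreamTree :=
  (t :: t.tributaries).filter (fun b => b.ord = i)

/-- The number of streams of order `i`. -/
def numStreams (i : ℕ) (t : StreamTree) : ℕ := (t.streams i).length

/-- Magnitude: the number of sources upstream. -/
def magnitude : StreamTree → ℕ
  | leaf _ => 1
  | node _ l r => l.magnitude + r.magnitude

/-- The number of links in the root stream. -/
def streamLinks : StreamTree → ℕ
  | leaf _ => 1
  | node ℓ l r =>
      1 + (if l.ord = (node ℓ l r).ord then l.streamLinks else 0) +
        (if r.ord = (node ℓ l r).ord then r.streamLinks else 0)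

/-- The length of the root stream. -/
def streamLength : StreamTree → ℝ
  | leaf ℓ => ℓ
  | node ℓ l r =>
      ℓ + (if l.ord = (node ℓ l r).ord then l.streamLength else 0) +
        (if r.ord = (node ℓ l r).ord then r.streamLength else 0)

/-- The height of a tree: the length of its longest path from the outlet to a source. -/
noncomputable def height : StreamTree → ℝ
  | leaf ℓ => ℓ
  | node ℓ l r => ℓ + max l.height r.height

/-- The total contributing area of a tree, when a link of length `x` has local area `a x`. -/
def area (a : ℝ → ℝ) : StreamTree → ℝ
  | leaf ℓ => a ℓ
  | node ℓ l r => a ℓ + l.area a + r.area a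

/-- `attachSorted top ℓ s sides`: the part of a stream of length `ℓ` that lies upstream of its
point at distance `s` from the downstream end, where `sides` lists the side trees still to be
attached, with the distances of their attachment points in increasing order. The last link, of
length `d`, is completed to the tree `top d`. -/
def attachSorted (top : ℝ → StreamTree) (ℓ : ℝ) : ℝ → List (ℝ × StreamTree) → StreamTree
  | s, [] => top (ℓ - s)
  | s, (x, t) :: sides => node (x - s) (attachSorted top ℓ x sides) t

/-- The tree made of a main stream of length `ℓ`, two trees `t₁`, `t₂` at its upstream end, and a
tree `t` attached at distance `x` from the downstream end for each entry `(x, t)` of `sides`. -/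
noncomputable def assemble (ℓ : ℝ) (t₁ t₂ : StreamTree) (sides : List (ℝ × StreamTree)) :
    StreamTree :=
  attachSorted (fun d => node d t₁ t₂) ℓ 0 (sides.insertionSort (fun p q => p.1 ≤ q.1))

end StreamTree

/-- The law of `F Φ`, where `Φ` is a Poisson point process with finite intensity measure `ν`: the
number of points has the Poisson law of mean `ν univ` and, given that there are `n` points, these
are independent with law `ν / ν univ`. (`F` should not depend on the enumeration of the points.) -/
noncomputable def poissonImage {X Y : Type*} [MeasurableSpace X] [MeasurableSpace Y]
    (ν : Measure X) (F : List X → Y) : Measure Y :=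
  Measure.sum fun n : ℕ =>
    ENNReal.ofReal (Real.exp (-(ν.real univ)) / (n.factorial : ℝ)) •
      Measure.map (fun v : Fin n → X => F (List.ofFn v)) (Measure.pi fun _ : Fin n => ν)

/-- The law of a tree of order `K` in the Random Attachment Model with Tokunaga sequence `T` and
stream length rates `lam`. The main stream has an exponential length `ℓ` of rate `lam K`. If
`K ≥ 2`, two independent trees of order `K - 1` grow from its upstream end and, for each `i < K`,
independent trees of order `i` are attached to it at the points of a Poisson process of intensity
`lam K * T (K - i)`, independently for different `i`; that is, the attached trees with their
positions form a Poisson process on `[0, ℓ] × StreamTree` with intensity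
`dx ⊗ ∑ i < K, lam K * T (K - i) • (law of a tree of order i)`. -/
noncomputable def ramOfOrder (T lam : ℕ → ℝ) : ℕ → Measure StreamTree
  | 0 => 0
  | 1 => (expMeasure (lam 1)).map StreamTree.leaf
  | K + 2 =>
      ((expMeasure (lam (K + 2))).prod
          ((ramOfOrder T lam (K + 1)).prod (ramOfOrder T lam (K + 1)))).bind
        fun p => poissonImage
          ((volume.restrict (Icc 0 p.1)).prod
            (∑ i : Fin (K + 1),
              ENNReal.ofReal (lam (K + 2) * T (K + 2 - (i + 1))) • ramOfOrder T lam (i + 1)))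
          (StreamTree.assemble p.1 p.2.1 p.2.2)
  termination_by K => K
  decreasing_by all_goals omega

/-- The Random Attachment Model: the order `K ≥ 1` is drawn with probabilities `π K`, then a tree
of order `K` is generated. -/
noncomputable def ram (T lam π : ℕ → ℝ) : Measure StreamTree :=
  Measure.sum fun K : ℕ => ENNReal.ofReal (π K) • ramOfOrder T lam K

/-- The Tokunaga sequence `T_k = (c - 1) c ^ (k - 1)`, `k ≥ 1`. -/
noncomputable def tokunaga (c : ℝ) (k : ℕ) : ℝ := (c - 1) * c ^ (k - 1)

/-- The critical Tokunaga model with parameters `c` and `γ`. -/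
noncomputable def criticalTokunaga (c γ : ℝ) : Measure StreamTree :=
  ram (tokunaga c) (fun j => γ * c ^ (1 - (j : ℤ))) (fun K => (2 : ℝ)⁻¹ ^ K)

/-- `X` has finite mean `m` in a tree of order `K`: `E[X(T) | ord T = K] = m`. -/
def HasOrderMean (μ : Measure StreamTree) (K : ℕ) (X : StreamTree → ℝ) (m : ℝ) : Prop :=
  Integrable X (μ[|{t | t.ord = K}]) ∧ ∫ t, X t ∂(μ[|{t | t.ord = K}]) = m

/-- `z i` is the mean of the attribute `Z` of a stream of order `i`, whatever the order `K ≥ i` of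
the basin: the expected sum of `Z` over the streams of order `i` in a basin of order `K` is `z i`
times the (nonzero, finite) expected number of these streams. -/
def IsStreamMean (μ : Measure StreamTree) (Z : StreamTree → ℝ) (z : ℕ → ℝ) : Prop :=
  ∀ i K : ℕ, 1 ≤ i → i ≤ K → ∃ n s : ℝ, n ≠ 0 ∧
    HasOrderMean μ K (fun t => (t.numStreams i : ℝ)) n ∧
    HasOrderMean μ K (fun t => ((t.streams i).map Z).sum) s ∧ z i = s / n

/-- The Horton law `lim z_k R ^ (-k) = C` with `0 < C < ∞`; `R` is the Horton exponent of `z`. -/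
def IsHortonExponent (z : ℕ → ℝ) (R : ℝ) : Prop :=
  0 < R ∧ ∃ C : ℝ, 0 < C ∧ Tendsto (fun k : ℕ => z k / R ^ k) atTop (𝓝 C)

/-- `z` is a root of `-1 + 2 z + ∑ k ≥ 1, T_k z ^ k` (where the series converges). -/
def IsTokunagaRoot (T : ℕ → ℝ) (z : ℝ) : Prop :=
  Summable (fun k : ℕ => T (k + 1) * z ^ (k + 1)) ∧
    -1 + 2 * z + ∑' k : ℕ, T (k + 1) * z ^ (k + 1) = 0

/-! Everything reduces to means under the law of a tree of one fixed order. Such a tree is a main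
stream with two top trees of the preceding order and Poisson side trees of all lower orders. The
intensity `lam K * T k` is multiplied by the mean stream length `1 / lam K`, so on average T_k side
trees whose order is lower by k are attached. Hence the mean x_n of an additive functional at order
n + 1 satisfies x_{n+1} = b_n + 2 x_n + ∑_{j ≤ n} T_{n+1-j} x_j, where b_n is the contribution of
the main stream (`lintegral_ramOfOrder_of_additive`). As T is geometric with ratio c, subtracting c
times one equation from the next removes the sum, and also the source when b_n = b c^{n+1}. What
remains is x_{n+2} = (2c + 1) x_{n+1} - 2c x_n, with characteristic roots 1 and 2c
(`tokunaga_recursion`). This is the origin of the exponent 2c.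

For the sum of any Z ≥ 0 over the streams of order i, the same recursion shows that its mean in a
tree of order K is N_i[K] times the mean of Z over trees of order i
(`lintegral_streamSum_tokunaga`). Stream means therefore do not depend on K. The number of links of
a stream is one plus the number of its side trees, and its mean telescopes to c^{K-1}. The length of
a stream is exponential with mean c^{K-1}/γ.

For the area, the events that end a link of a stream of order K (an attachment, or the end of the
stream) have total rate lam_K (1 + T_1 + ... + T_{K-1}) = γ, whatever K is
(`sideMeasure_real_univ`). The mean local areas of a stream thus add up to c^{K-1} times the mean of
a under the exponential law of rate γ (`lintegral_poissonExp_gapSum`), and the recursion applies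
with b = 1.

The height is not additive. For c > 1 its mean divided by c^K converges because it is nondecreasing
and bounded. It is nondecreasing because a tree of order K + 2 is stochastically at least c times as
high as one of order K + 1: stretching by c turns the stream length rates into those of the next
order, and the only difference left is additional side trees of order 1
(`ramOfOrder_height_le_mul`). It is bounded because the height is at most the main stream length
plus the largest height of an attached tree. The p-th power of a maximum is at most the sum of the
p-th powers, which costs a factor 2 + c per order, and c^p exceeds this for large p
(`exists_lintegral_height_pow_le`). -/

open scoped ENNReal

/-! ### Measurability of functions of a tree, from its shape and its lengths. -/

namespace StreamTree

theorem length_lengths (t : StreamTree) : t.lengths.length = t.shape.length := by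
  induction t with
  | leaf ℓ => rfl
  | node ℓ l r hl hr => simp [lengths, shape, hl, hr]

/-- Preorder codes of full binary trees are prefix-free, so the codes of the two subtrees can be
separated again. -/
theorem shape_append_inj {s t : StreamTree} {x y : List Bool}
    (h : s.shape ++ x = t.shape ++ y) : s.shape = t.shape ∧ x = y := by
  induction s generalizing t x y with
  | leaf ℓ => cases t <;> simp_all [shape]
  | node ℓ l r hl hr =>
    cases t with
    | leaf ℓ => simp [shape] at h
    | node ℓ' l' r' =>
      simp only [shape, List.cons_append, List.append_assoc, List.cons.injEq, true_and] at h ⊢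
      obtain ⟨h1, h2⟩ := hl h
      obtain ⟨h3, h4⟩ := hr h2
      exact ⟨by rw [h1, h3], h4⟩

/-- The tree with the shape of a given tree whose links have, in preorder, the lengths `w`. -/
def relabel : StreamTree → (ℕ → ℝ) → StreamTree
  | leaf _, w => leaf (w 0)
  | node _ l r, w =>
      node (w 0) (relabel l fun n => w (n + 1)) (relabel r fun n => w (l.lengths.length + n + 1))

theorem relabel_of_shape_eq {s t : StreamTree} (h : s.shape = t.shape) {w : ℕ → ℝ}
    (hw : ∀ n < t.lengths.length, w n = t.lengths.getD n 0) : s.relabel w = t := by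
  induction s generalizing t w with
  | leaf ℓ =>
    cases t with
    | leaf ℓ' => simpa [relabel, lengths] using hw 0 (by simp [lengths])
    | node ℓ' l' r' => simp [shape] at h
  | node ℓ l r hl hr =>
    cases t with
    | leaf ℓ' => simp [shape] at h
    | node ℓ' l' r' =>
      simp only [shape, List.cons.injEq, true_and] at h
      obtain ⟨h1, h2⟩ := shape_append_inj h
      have hlen : l.lengths.length = l'.lengths.length := by
        rw [length_lengths, length_lengths, h1]
      simp only [relabel, node.injEq]
      refine ⟨by simpa [lengths] using hw 0 (by simp [lengths]), hl h1 fun n hn => ?_,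
        hr h2 fun n hn => ?_⟩
      · rw [hw _ (by simp [lengths]; omega)]
        simp [lengths, List.getElem?_append_left hn]
      · rw [hw _ (by simp [lengths]; omega)]
        simp [lengths, hlen, List.getElem?_append_right]

theorem measurable_shape : @Measurable _ _ _ ⊤ shape :=
  measurable_iff_comap_le.2 le_sup_left

theorem measurable_lengths_getD (n : ℕ) : Measurable fun t : StreamTree => t.lengths.getD n 0 :=
  measurable_iff_comap_le.2
    ((le_iSup (fun n : ℕ => MeasurableSpace.comap (fun t : StreamTree => t.lengths.getD n 0)
      inferInstance) n).trans le_sup_right)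

theorem measurable_of_shape_of_lengths {Ω : Type*} [MeasurableSpace Ω] {f : Ω → StreamTree}
    (h1 : @Measurable _ _ _ ⊤ fun ω => (f ω).shape)
    (h2 : ∀ n, Measurable fun ω => (f ω).lengths.getD n 0) : Measurable f := by
  rw [measurable_iff_comap_le]
  refine (MeasurableSpace.comap_sup ..).le.trans (sup_le ?_ ?_)
  · rw [MeasurableSpace.comap_comp]
    exact measurable_iff_comap_le.1 h1
  · rw [MeasurableSpace.comap_iSup]
    refine iSup_le fun n => ?_
    rw [MeasurableSpace.comap_comp]
    exact measurable_iff_comap_le.1 (h2 n)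

/-- There are countably many shapes, and on the trees of one shape `f` is a function of the sequence
of lengths alone. So measurability can be tested on the parametrizations `s.relabel`. -/
theorem measurable_of_relabel {Y : Type*} [MeasurableSpace Y] {f : StreamTree → Y}
    (h : ∀ s : StreamTree, Measurable fun w => f (s.relabel w)) : Measurable f := by
  intro B hB
  have hL : Measurable fun (t : StreamTree) (n : ℕ) => t.lengths.getD n 0 :=
    measurable_pi_lambda _ measurable_lengths_getD
  have : f ⁻¹' B = ⋃ σ : List Bool, shape ⁻¹' {σ} ∩ f ⁻¹' B := by
    ext t; simp
  rw [this]
  refine MeasurableSet.iUnion fun σ => ?_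
  by_cases hσ : ∃ s : StreamTree, s.shape = σ
  · obtain ⟨s, rfl⟩ := hσ
    have : shape ⁻¹' {s.shape} ∩ f ⁻¹' B = shape ⁻¹' {s.shape} ∩
        (fun (t : StreamTree) (n : ℕ) => t.lengths.getD n 0) ⁻¹'
          ((fun w => f (s.relabel w)) ⁻¹' B) := by
      ext t
      simp only [mem_inter_iff, mem_preimage, mem_singleton_iff]
      refine and_congr_right fun ht => ?_
      rw [relabel_of_shape_eq ht.symm fun _ _ => rfl]
    rw [this]
    exact (measurable_shape (by trivial)).inter (hL (h s hB))
  · have : shape ⁻¹' {σ} ∩ f ⁻¹' B = ∅ := by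
      ext t
      simp only [mem_inter_iff, mem_preimage, mem_singleton_iff, mem_empty_iff_false, iff_false]
      exact fun ht => hσ ⟨t, ht.1⟩
    rw [this]
    exact MeasurableSet.empty

theorem measurable_leaf : Measurable leaf := by
  refine measurable_of_shape_of_lengths ?_ fun n => ?_
  · simp only [shape]
    exact @measurable_const _ _ ⊤ _ _
  · cases n with
    | zero => simpa [lengths] using measurable_id'
    | succ n => simp [lengths]

theorem measurable_node :
    Measurable fun p : ℝ × StreamTree × StreamTree => node p.1 p.2.1 p.2.2 := by
  let _ : MeasurableSpace (List Bool) := ⊤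
  have : DiscreteMeasurableSpace (List Bool) := ⟨fun _ => trivial⟩
  have hs : Measurable shape := measurable_shape
  refine measurable_of_shape_of_lengths ?_ fun n => ?_
  · have : Measurable fun q : List Bool × List Bool => true :: (q.1 ++ q.2) :=
      Measurable.of_discrete
    exact this.comp (((hs.comp (measurable_fst.comp measurable_snd))).prodMk
      (hs.comp (measurable_snd.comp measurable_snd)))
  · cases n with
    | zero => simpa [lengths] using measurable_fst
    | succ n =>
      have hlen : Measurable fun p : ℝ × StreamTree × StreamTree => p.2.1.lengths.length := by
        simp only [length_lengths]
        exact (Measurable.of_discrete (f := List.length)).comp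
          (hs.comp (measurable_fst.comp measurable_snd))
      have heq (p : ℝ × StreamTree × StreamTree) :
          (node p.1 p.2.1 p.2.2).lengths.getD (n + 1) 0 =
            if n < p.2.1.lengths.length then p.2.1.lengths.getD n 0
            else p.2.2.lengths.getD (n - p.2.1.lengths.length) 0 := by
        simp only [lengths, List.getD_cons_succ]
        split_ifs with h
        · exact List.getD_append _ _ _ _ h
        · exact List.getD_append_right _ _ _ _ (not_lt.1 h)
      simp only [heq]
      refine Measurable.ite (hlen (t := {k | n < k}) (by trivial))
        ((measurable_lengths_getD n).comp (measurable_fst.comp measurable_snd)) ?_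
      have : Measurable fun q : StreamTree × ℕ => q.1.lengths.getD (n - q.2) 0 :=
        measurable_from_prod_countable_left fun k => measurable_lengths_getD (n - k)
      exact this.comp ((measurable_snd.comp measurable_snd).prodMk hlen)

theorem measurable_relabel (s : StreamTree) : Measurable s.relabel := by
  induction s with
  | leaf ℓ => exact measurable_leaf.comp (measurable_pi_apply 0)
  | node ℓ l r hl hr =>
    exact measurable_node.comp (f := fun w : ℕ → ℝ => (w 0, l.relabel fun n => w (n + 1),
      r.relabel fun n => w (l.lengths.length + n + 1))) (by fun_prop)

/-- Functions defined by measurable structural recursion are measurable. -/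
theorem measurable_of_rec {Y : Type*} [MeasurableSpace Y] {f : StreamTree → Y} {φ : ℝ → Y}
    {ψ : ℝ × (StreamTree × Y) × (StreamTree × Y) → Y} (hφ : Measurable φ) (hψ : Measurable ψ)
    (hleaf : ∀ ℓ, f (leaf ℓ) = φ ℓ)
    (hnode : ∀ ℓ l r, f (node ℓ l r) = ψ (ℓ, (l, f l), (r, f r))) : Measurable f := by
  refine measurable_of_relabel fun s => ?_
  induction s with
  | leaf ℓ => simpa only [relabel, hleaf, Function.comp_def] using hφ.comp (measurable_pi_apply 0)
  | node ℓ l r hl hr =>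
    simp only [relabel, hnode]
    have h1 : Measurable fun (w : ℕ → ℝ) (n : ℕ) => w (n + 1) :=
      measurable_pi_lambda _ fun n => measurable_pi_apply _
    have h2 : Measurable fun (w : ℕ → ℝ) (n : ℕ) => w (l.lengths.length + n + 1) :=
      measurable_pi_lambda _ fun n => measurable_pi_apply _
    exact hψ.comp ((measurable_pi_apply 0).prodMk
      (((l.measurable_relabel.comp h1).prodMk (hl.comp h1)).prodMk
        ((r.measurable_relabel.comp h2).prodMk (hr.comp h2))))

theorem measurable_ord : Measurable ord := by
  refine measurable_of_rec (φ := fun _ => 1)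
    (ψ := fun p => if p.2.1.2 = p.2.2.2 then p.2.1.2 + 1 else max p.2.1.2 p.2.2.2)
    measurable_const ?_ (fun _ => rfl) (fun _ _ _ => rfl)
  have : Measurable fun q : ℕ × ℕ => if q.1 = q.2 then q.1 + 1 else max q.1 q.2 :=
    Measurable.of_discrete
  exact this.comp (by fun_prop : Measurable
    fun p : ℝ × (StreamTree × ℕ) × (StreamTree × ℕ) => (p.2.1.2, p.2.2.2))

theorem measurableSet_ord_eq (i : ℕ) : MeasurableSet {t : StreamTree | t.ord = i} :=
  measurable_ord (measurableSet_singleton i)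

theorem measurable_ord_node :
    Measurable fun p : ℝ × StreamTree × StreamTree => (node p.1 p.2.1 p.2.2).ord :=
  measurable_ord.comp measurable_node

/-! ### Sums over streams and the attributes of a tree as measurable functions. -/

/-- The sum of `Z` over the streams of order `i` of a tree. -/
def streamSum (i : ℕ) (Z : StreamTree → ℝ≥0∞) (t : StreamTree) : ℝ≥0∞ :=
  ((t.streams i).map Z).sum

/-- The sum of `Z` over the streams of order `i` of a tree other than its root stream. -/
def tributarySum (i : ℕ) (Z : StreamTree → ℝ≥0∞) (t : StreamTree) : ℝ≥0∞ :=
  ((t.tributaries.filter fun b => b.ord = i).map Z).sum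

theorem streamSum_eq (i : ℕ) (Z : StreamTree → ℝ≥0∞) (t : StreamTree) :
    t.streamSum i Z = (if t.ord = i then Z t else 0) + t.tributarySum i Z := by
  by_cases h : t.ord = i <;> simp [streamSum, tributarySum, streams, h]

theorem tributarySum_node (i : ℕ) (Z : StreamTree → ℝ≥0∞) (ℓ : ℝ) (l r : StreamTree) :
    (node ℓ l r).tributarySum i Z =
      (if l.ord = (node ℓ l r).ord then l.tributarySum i Z else l.streamSum i Z) +
      (if r.ord = (node ℓ l r).ord then r.tributarySum i Z else r.streamSum i Z) := by
  rw [tributarySum, tributaries, List.filter_append, List.map_append, List.sum_append]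
  congr 1 <;> split_ifs <;> rfl

theorem measurableSet_ord_eq_node {p : ℝ × StreamTree × StreamTree → StreamTree}
    (hp : Measurable p) : MeasurableSet {q | (p q).ord = (node q.1 q.2.1 q.2.2).ord} :=
  measurableSet_eq_fun (measurable_ord.comp hp) measurable_ord_node

theorem measurable_tributarySum (i : ℕ) {Z : StreamTree → ℝ≥0∞} (hZ : Measurable Z) :
    Measurable (tributarySum i Z) := by
  have hO := measurableSet_ord_eq i
  have hpr : Measurable fun p : ℝ × (StreamTree × ℝ≥0∞) × (StreamTree × ℝ≥0∞) =>
    (p.1, p.2.1.1, p.2.2.1) := by fun_prop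
  refine measurable_of_rec (φ := fun _ => 0) (ψ := fun p =>
      (if p.2.1.1.ord = (node p.1 p.2.1.1 p.2.2.1).ord then p.2.1.2
        else (if p.2.1.1.ord = i then Z p.2.1.1 else 0) + p.2.1.2) +
      (if p.2.2.1.ord = (node p.1 p.2.1.1 p.2.2.1).ord then p.2.2.2
        else (if p.2.2.1.ord = i then Z p.2.2.1 else 0) + p.2.2.2))
    measurable_const ?_ (fun _ => rfl) fun ℓ l r => ?_
  · refine Measurable.add (Measurable.ite (hpr (measurableSet_ord_eq_node
      (measurable_fst.comp measurable_snd))) (by fun_prop) (Measurable.add ?_ (by fun_prop)))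
      (Measurable.ite (hpr (measurableSet_ord_eq_node
      (measurable_snd.comp measurable_snd))) (by fun_prop) (Measurable.add ?_ (by fun_prop)))
    · exact (Measurable.ite hO hZ measurable_const).comp
        (measurable_fst.comp (measurable_fst.comp measurable_snd))
    · exact (Measurable.ite hO hZ measurable_const).comp
        (measurable_fst.comp (measurable_snd.comp measurable_snd))
  · rw [tributarySum_node, streamSum_eq, streamSum_eq]

theorem measurable_streamSum (i : ℕ) {Z : StreamTree → ℝ≥0∞} (hZ : Measurable Z) :
    Measurable (streamSum i Z) := by
  simp only [funext (streamSum_eq i Z)]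
  exact (Measurable.ite (measurableSet_ord_eq i) hZ measurable_const).add
    (measurable_tributarySum i hZ)

theorem measurable_magnitude : Measurable magnitude := by
  refine measurable_of_rec (φ := fun _ => 1) (ψ := fun p => p.2.1.2 + p.2.2.2)
    measurable_const (by fun_prop) (fun _ => rfl) (fun _ _ _ => rfl)

theorem measurable_height : Measurable height :=
  measurable_of_rec (φ := fun ℓ => ℓ) (ψ := fun p => p.1 + max p.2.1.2 p.2.2.2)
    measurable_id (by fun_prop) (fun _ => rfl) (fun _ _ _ => rfl)

theorem measurable_area {a : ℝ → ℝ} (ha : Measurable a) : Measurable (area a) :=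
  measurable_of_rec (φ := a) (ψ := fun p => a p.1 + p.2.1.2 + p.2.2.2)
    ha (by fun_prop) (fun _ => rfl) (fun _ _ _ => rfl)

theorem measurable_streamLinks : Measurable streamLinks := by
  have hpr : Measurable fun p : ℝ × (StreamTree × ℕ) × (StreamTree × ℕ) =>
    (p.1, p.2.1.1, p.2.2.1) := by fun_prop
  refine measurable_of_rec (φ := fun _ => 1) (ψ := fun p => 1 +
      (if p.2.1.1.ord = (node p.1 p.2.1.1 p.2.2.1).ord then p.2.1.2 else 0) +
      (if p.2.2.1.ord = (node p.1 p.2.1.1 p.2.2.1).ord then p.2.2.2 else 0))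
    measurable_const ?_ (fun _ => rfl) (fun _ _ _ => rfl)
  exact (measurable_const.add (Measurable.ite (hpr (measurableSet_ord_eq_node
      (measurable_fst.comp measurable_snd))) (by fun_prop) measurable_const)).add
      (Measurable.ite (hpr (measurableSet_ord_eq_node
      (measurable_snd.comp measurable_snd))) (by fun_prop) measurable_const)

theorem measurable_streamLength : Measurable streamLength := by
  have hpr : Measurable fun p : ℝ × (StreamTree × ℝ) × (StreamTree × ℝ) =>
    (p.1, p.2.1.1, p.2.2.1) := by fun_prop
  refine measurable_of_rec (φ := fun ℓ => ℓ) (ψ := fun p => p.1 +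
      (if p.2.1.1.ord = (node p.1 p.2.1.1 p.2.2.1).ord then p.2.1.2 else 0) +
      (if p.2.2.1.ord = (node p.1 p.2.1.1 p.2.2.1).ord then p.2.2.2 else 0))
    measurable_id ?_ (fun _ => rfl) (fun _ _ _ => rfl)
  exact (measurable_fst.add (Measurable.ite (hpr (measurableSet_ord_eq_node
      (measurable_fst.comp measurable_snd))) (by fun_prop) measurable_const)).add
      (Measurable.ite (hpr (measurableSet_ord_eq_node
      (measurable_snd.comp measurable_snd))) (by fun_prop) measurable_const)

/-! ### Joint measurability in a parameter and a list, and its stability under sorting. -/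

/-- `F`, a function of a parameter and of a list, is jointly measurable. -/
def ListMeasurable {Ω X Y : Type*} [MeasurableSpace Ω] [MeasurableSpace X] [MeasurableSpace Y]
    (F : Ω → List X → Y) : Prop :=
  ∀ n : ℕ, Measurable fun p : Ω × (Fin n → X) => F p.1 (List.ofFn p.2)

section ListMeasurable

universe u

variable {X : Type u} {Y : Type*} [MeasurableSpace X] [MeasurableSpace Y]

theorem measurable_vec_tail (n : ℕ) :
    Measurable fun (v : Fin (n + 1) → X) (i : Fin n) => v i.succ :=
  measurable_pi_lambda _ fun _ => measurable_pi_apply _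

theorem measurable_vec_cons (n : ℕ) :
    Measurable fun p : X × (Fin n → X) => (Fin.cons p.1 p.2 : Fin (n + 1) → X) := by
  refine measurable_pi_lambda _ fun i => ?_
  refine Fin.cases ?_ (fun j => ?_) i
  · simpa using measurable_fst
  · simpa [Function.comp_def] using (measurable_pi_apply j).comp measurable_snd

theorem ListMeasurable.cons {Ω : Type u} [MeasurableSpace Ω] {F : Ω → List X → Y}
    (hF : ListMeasurable F) : ListMeasurable fun (p : Ω × X) l => F p.1 (p.2 :: l) := by
  intro n
  have := (hF (n + 1)).comp ((measurable_fst.comp measurable_fst).prodMk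
    ((measurable_vec_cons n).comp ((measurable_snd.comp measurable_fst).prodMk measurable_snd)) :
    Measurable fun p : (Ω × X) × (Fin n → X) =>
      (p.1.1, (Fin.cons p.1.2 p.2 : Fin (n + 1) → X)))
  simpa [Function.comp_def, List.ofFn_succ] using this

theorem ListMeasurable.comp {Ω Ω' : Type u} [MeasurableSpace Ω] [MeasurableSpace Ω']
    {F : Ω → List X → Y} (hF : ListMeasurable F) {g : Ω' → Ω} (hg : Measurable g) :
    ListMeasurable fun p l => F (g p) l :=
  fun n => (hF n).comp ((hg.comp measurable_fst).prodMk measurable_snd)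

/-- Insertion either stops at the head of the list or passes it. In the second case the head becomes
a parameter, which is why the induction runs over all parameter spaces. -/
theorem ListMeasurable.orderedInsert {Ω : Type u} [MeasurableSpace Ω] {R : X → X → Prop}
    [DecidableRel R] (hR : MeasurableSet {p : X × X | R p.1 p.2}) {F : Ω → List X → Y}
    (hF : ListMeasurable F) : ListMeasurable fun (p : Ω × X) l => F p.1 (l.orderedInsert R p.2) := by
  intro n
  induction n generalizing Ω with
  | zero =>
    simpa [Function.comp_def] using hF.cons 0
  | succ n ih =>
    have h1 := (hF.cons (n + 1))
    have h2 : Measurable fun p : (Ω × X) × (Fin (n + 1) → X) =>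
        F p.1.1 (p.2 0 :: (List.ofFn fun i : Fin n => p.2 i.succ).orderedInsert R p.1.2) := by
      have h0 := ih hF.cons
      exact h0.comp (f := fun p : (Ω × X) × (Fin (n + 1) → X) =>
        (((p.1.1, p.2 0), p.1.2), fun i : Fin n => p.2 i.succ))
        (((measurable_fst.comp measurable_fst).prodMk
          ((measurable_pi_apply 0).comp measurable_snd)).prodMk
          (measurable_snd.comp measurable_fst) |>.prodMk
          ((measurable_vec_tail n).comp measurable_snd))
    have h3 : MeasurableSet {p : (Ω × X) × (Fin (n + 1) → X) | R p.1.2 (p.2 0)} :=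
      measurableSet_preimage (f := fun p : (Ω × X) × (Fin (n + 1) → X) => (p.1.2, p.2 0))
        (by fun_prop) hR
    have h4 : (fun p : (Ω × X) × (Fin (n + 1) → X) =>
        F p.1.1 ((List.ofFn p.2).orderedInsert R p.1.2)) = fun p => if R p.1.2 (p.2 0) then
          F p.1.1 (p.1.2 :: List.ofFn p.2) else
          F p.1.1 (p.2 0 :: (List.ofFn fun i : Fin n => p.2 i.succ).orderedInsert R p.1.2) := by
      funext p
      simp only [List.ofFn_succ, List.orderedInsert]
      split_ifs <;> rfl
    exact h4 ▸ Measurable.ite h3 h1 h2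

theorem ListMeasurable.insertionSort {Ω : Type u} [MeasurableSpace Ω] {R : X → X → Prop}
    [DecidableRel R] (hR : MeasurableSet {p : X × X | R p.1 p.2}) {F : Ω → List X → Y}
    (hF : ListMeasurable F) : ListMeasurable fun p l => F p (l.insertionSort R) := by
  intro n
  induction n generalizing Ω with
  | zero => simpa using hF 0
  | succ n ih =>
    have h0 := ih (hF.orderedInsert hR)
    have := h0.comp (f := fun p : Ω × (Fin (n + 1) → X) =>
        ((p.1, p.2 0), fun i : Fin n => p.2 i.succ))
      ((measurable_fst.prodMk ((measurable_pi_apply 0).comp measurable_snd)).prodMk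
        ((measurable_vec_tail n).comp measurable_snd))
    simpa [Function.comp_def, List.ofFn_succ] using this

end ListMeasurable

theorem listMeasurable_attachSorted :
    ListMeasurable fun (p : (ℝ × StreamTree × StreamTree) × ℝ) (sides : List (ℝ × StreamTree)) =>
      attachSorted (fun d => node d p.1.2.1 p.1.2.2) p.1.1 p.2 sides := by
  intro n
  induction n with
  | zero =>
    simp only [List.ofFn_zero, attachSorted]
    exact measurable_node.comp (f := fun p : ((ℝ × StreamTree × StreamTree) × ℝ) ×
      (Fin 0 → ℝ × StreamTree) => (p.1.1.1 - p.1.2, p.1.1.2.1, p.1.1.2.2)) (by fun_prop)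
  | succ n ih =>
    simp only [List.ofFn_succ, attachSorted]
    refine measurable_node.comp (f := fun p : ((ℝ × StreamTree × StreamTree) × ℝ) ×
      (Fin (n + 1) → ℝ × StreamTree) => ((p.2 0).1 - p.1.2, attachSorted
        (fun d => node d p.1.1.2.1 p.1.1.2.2) p.1.1.1 (p.2 0).1 (List.ofFn fun i => p.2 i.succ),
        (p.2 0).2)) ?_
    refine Measurable.prodMk (by fun_prop) (Measurable.prodMk ?_ (by fun_prop))
    exact ih.comp (f := fun p : ((ℝ × StreamTree × StreamTree) × ℝ) ×
      (Fin (n + 1) → ℝ × StreamTree) => ((p.1.1, (p.2 0).1), fun i : Fin n => p.2 i.succ))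
      (by fun_prop)

theorem listMeasurable_assemble :
    ListMeasurable fun (p : ℝ × StreamTree × StreamTree) sides =>
      assemble p.1 p.2.1 p.2.2 sides :=
  (listMeasurable_attachSorted.insertionSort (R := fun p q : ℝ × StreamTree => p.1 ≤ q.1)
    (measurableSet_le (by fun_prop) (by fun_prop))).comp
    (g := fun p : ℝ × StreamTree × StreamTree => (p, (0 : ℝ))) (by fun_prop)

end StreamTree

/-! ### Expectations over a Poisson process. -/

theorem prod_map_indicator_one {X : Type*} (S : Set X) [DecidablePred (· ∈ S)] (l : List X) :
    (l.map (S.indicator (1 : X → ℝ≥0∞))).prod = if ∀ x ∈ l, x ∈ S then 1 else 0 := by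
  induction l with
  | nil => simp
  | cons x l ih =>
    rw [List.map_cons, List.prod_cons, ih, indicator_apply]
    by_cases hx : x ∈ S <;> simp [hx]

section PoissonExp

variable {X Y : Type*} [MeasurableSpace X] [MeasurableSpace Y]

/-- The expectation of `H Φ` for a Poisson point process `Φ` with finite intensity `ν`. -/
noncomputable def poissonExp (ν : Measure X) (H : List X → ℝ≥0∞) : ℝ≥0∞ :=
  ∑' n : ℕ, ENNReal.ofReal (Real.exp (-(ν.real univ)) / (n.factorial : ℝ)) *
    ∫⁻ v : Fin n → X, H (List.ofFn v) ∂(Measure.pi fun _ : Fin n => ν)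

theorem lintegral_poissonImage (ν : Measure X) {F : List X → Y}
    (hF : ∀ n : ℕ, Measurable fun v : Fin n → X => F (List.ofFn v)) {f : Y → ℝ≥0∞}
    (hf : Measurable f) :
    ∫⁻ y, f y ∂(poissonImage ν F) = poissonExp ν fun l => f (F l) := by
  simp only [poissonImage, poissonExp, lintegral_sum_measure, lintegral_smul_measure, smul_eq_mul]
  refine tsum_congr fun n => ?_
  rw [lintegral_map hf (hF n)]

/-- The exponential series, from which the total mass, Campbell's formula and the void probability
all follow. -/
theorem tsum_poisson_mul_pow (m : ℝ) {r : ℝ} (hr : 0 ≤ r) :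
    ∑' n : ℕ, ENNReal.ofReal (Real.exp (-m) / (n.factorial : ℝ)) * ENNReal.ofReal r ^ n =
      ENNReal.ofReal (Real.exp (r - m)) := by
  have h := (NormedSpace.expSeries_div_hasSum_exp r).mul_left (Real.exp (-m))
  rw [← Real.exp_eq_exp_ℝ, ← Real.exp_add, neg_add_eq_sub] at h
  rw [← h.tsum_eq, ENNReal.ofReal_tsum_of_nonneg (fun n => by positivity) h.summable]
  refine tsum_congr fun n => ?_
  rw [← ENNReal.ofReal_pow hr, ← ENNReal.ofReal_mul (by positivity)]
  congr 1
  ring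

theorem poissonExp_add (ν : Measure X) {G H : List X → ℝ≥0∞}
    (hG : ∀ n : ℕ, Measurable fun v : Fin n → X => G (List.ofFn v)) :
    poissonExp ν (fun l => G l + H l) = poissonExp ν G + poissonExp ν H := by
  simp only [poissonExp, lintegral_add_left (hG _), mul_add, ENNReal.tsum_add]

variable (ν : Measure X) [IsFiniteMeasure ν]

theorem poissonExp_const (a : ℝ≥0∞) : poissonExp ν (fun _ => a) = a := by
  have h := tsum_poisson_mul_pow (ν.real univ) (measureReal_nonneg (μ := ν) (s := univ))
  rw [sub_self, Real.exp_zero, ENNReal.ofReal_one] at h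
  simp only [poissonExp, lintegral_const, Measure.pi_univ, Finset.prod_const, Finset.card_univ,
    Fintype.card_fin]
  refine Eq.trans ?_ (one_mul a)
  rw [← h, ← ENNReal.tsum_mul_right]
  refine tsum_congr fun n => ?_
  rw [ofReal_measureReal]
  ring

/-- A property of almost every point holds for all points of the process, as these are finitely
many. -/
theorem poissonExp_mono_ae {G H : List X → ℝ≥0∞} {P : X → Prop} (hP : ∀ᵐ x ∂ν, P x)
    (h : ∀ l : List X, (∀ x ∈ l, P x) → G l ≤ H l) : poissonExp ν G ≤ poissonExp ν H := by
  refine ENNReal.tsum_le_tsum fun n => mul_le_mul_right (lintegral_mono_ae ?_) _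
  have : ∀ᵐ v : Fin n → X ∂(Measure.pi fun _ : Fin n => ν), ∀ i, P (v i) :=
    ae_all_iff.2 fun i => Measure.tendsto_eval_ae_ae.eventually hP
  filter_upwards [this] with v hv
  refine h _ fun x hx => ?_
  obtain ⟨i, rfl⟩ := (List.mem_ofFn' v x).1 hx
  exact hv i

theorem poissonExp_congr_ae {G H : List X → ℝ≥0∞} {P : X → Prop} (hP : ∀ᵐ x ∂ν, P x)
    (h : ∀ l : List X, (∀ x ∈ l, P x) → G l = H l) : poissonExp ν G = poissonExp ν H :=
  le_antisymm (poissonExp_mono_ae ν hP fun l hl => (h l hl).le)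
    (poissonExp_mono_ae ν hP fun l hl => (h l hl).ge)

/-- Campbell's formula. Each of the n coordinates contributes the same integral, and the factor n
lowers the factorial in the Poisson weight. -/
theorem poissonExp_sum {h : X → ℝ≥0∞} (hh : Measurable h) :
    poissonExp ν (fun l => (l.map h).sum) = ∫⁻ x, h x ∂ν := by
  have key (n : ℕ) : ∫⁻ v : Fin n → X, ((List.ofFn v).map h).sum ∂(Measure.pi fun _ => ν) =
      n * (ν univ ^ (n - 1) * ∫⁻ x, h x ∂ν) := by
    simp only [List.map_ofFn, List.sum_ofFn, Function.comp_apply]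
    rw [lintegral_finsetSum (f := fun (i : Fin n) (v : Fin n → X) => h (v i)) _
      fun i _ => hh.comp (measurable_pi_apply i)]
    have (i : Fin n) : ∫⁻ v : Fin n → X, h (v i) ∂(Measure.pi fun _ => ν) =
        ν univ ^ (n - 1) * ∫⁻ x, h x ∂ν := by
      have h1 := lintegral_map hh (measurable_pi_apply i) (μ := Measure.pi fun _ : Fin n => ν)
      have h2 := Measure.pi_map_eval (fun _ : Fin n => ν) i
      rw [show Function.eval i = fun v : Fin n → X => v i from rfl] at h2
      rw [← h1, h2, lintegral_smul_measure]
      simp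
    simp [this]
  have h0 := tsum_poisson_mul_pow (ν.real univ) (measureReal_nonneg (μ := ν) (s := univ))
  rw [sub_self, Real.exp_zero, ENNReal.ofReal_one] at h0
  simp only [poissonExp, key]
  -- The term n = 0 vanishes, so the truncated exponent `n - 1` does no harm after the shift.
  rw [tsum_eq_zero_add' ENNReal.summable]
  simp only [Nat.cast_zero, zero_mul, mul_zero, zero_add, Nat.add_sub_cancel]
  refine Eq.trans ?_ (one_mul _)
  rw [← h0, ← ENNReal.tsum_mul_right]
  refine tsum_congr fun n => ?_
  rw [ofReal_measureReal, ← mul_assoc, ← mul_assoc, ← ENNReal.ofReal_natCast,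
    ← ENNReal.ofReal_mul (by positivity)]
  congr 3
  rw [Nat.factorial_succ]
  push_cast
  field_simp

/-- The void probability: the product is 1 exactly when no point falls outside `S`. -/
theorem poissonExp_prod_indicator {S : Set X} (hS : MeasurableSet S) :
    poissonExp ν (fun l => (l.map (S.indicator 1)).prod) =
      ENNReal.ofReal (Real.exp (-ν.real Sᶜ)) := by
  classical
  have h := tsum_poisson_mul_pow (ν.real univ) (measureReal_nonneg (μ := ν) (s := S))
  rw [measureReal_compl hS, neg_sub, ← h]
  refine tsum_congr fun n => ?_
  have h1 (v : Fin n → X) : ((List.ofFn v).map (S.indicator (1 : X → ℝ≥0∞))).prod =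
      (univ.pi fun _ => S).indicator 1 v := by
    rw [prod_map_indicator_one, indicator_apply]
    simp [List.mem_ofFn]
  simp only [h1]
  rw [lintegral_indicator_one (MeasurableSet.univ_pi fun _ => hS), Measure.pi_pi,
    ofReal_measureReal]
  simp

end PoissonExp

/-- The intensity varies with the parameter, but only through the interval `Icc 0 (ℓ ω)`.
Restriction to it becomes an indicator under a fixed measure, and the measurability part of
Tonelli's theorem applies. -/
theorem measurable_poissonExp {Ω Z : Type*} [MeasurableSpace Ω] [MeasurableSpace Z]
    (τ : Measure Z) [IsFiniteMeasure τ] {H : Ω → List (ℝ × Z) → ℝ≥0∞}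
    (hH : StreamTree.ListMeasurable H) {ℓ : Ω → ℝ} (hℓ : Measurable ℓ) :
    Measurable fun ω => poissonExp ((volume.restrict (Icc 0 (ℓ ω))).prod τ) (H ω) := by
  refine Measurable.tsum fun n => Measurable.mul ?_ ?_
  · refine ENNReal.measurable_ofReal.comp (Measurable.div_const (Real.measurable_exp.comp ?_) _)
    have (ω : Ω) : ((volume.restrict (Icc 0 (ℓ ω))).prod τ).real univ =
        max (ℓ ω) 0 * τ.real univ := by
      rw [← univ_prod_univ, measureReal_prod_prod]
      simp [Real.volume_real_Icc]
    simp only [this]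
    fun_prop
  · have h1 (ω : Ω) : (Measure.pi fun _ : Fin n => (volume.restrict (Icc 0 (ℓ ω))).prod τ) =
        (Measure.pi fun _ : Fin n => (volume : Measure ℝ).prod τ).restrict
          (univ.pi fun _ => Icc 0 (ℓ ω) ×ˢ univ) := by
      rw [Measure.restrict_pi_pi]
      congr
      funext i
      rw [← Measure.prod_restrict, Measure.restrict_univ]
    have h2 (ω : Ω) : MeasurableSet (univ.pi fun _ : Fin n => Icc 0 (ℓ ω) ×ˢ (univ : Set Z)) :=
      MeasurableSet.univ_pi fun _ => measurableSet_Icc.prod MeasurableSet.univ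
    simp only [h1, ← lintegral_indicator (h2 _)]
    have h3 : MeasurableSet {p : Ω × (Fin n → ℝ × Z) |
        p.2 ∈ univ.pi fun _ : Fin n => Icc 0 (ℓ p.1) ×ˢ (univ : Set Z)} := by
      simp only [mem_univ_pi, mem_prod, mem_univ, and_true, mem_Icc, ofPred_forall, ofPred_and]
      refine MeasurableSet.iInter fun i => (measurableSet_le ?_ ?_).inter (measurableSet_le ?_ ?_)
      all_goals fun_prop
    exact ((hH n).indicator h3).lintegral_prod_right'

/-! ### Attributes of an assembled tree. -/

namespace StreamTree

theorem ord_node_of_eq {l r : StreamTree} (ℓ : ℝ) (h : l.ord = r.ord) :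
    (node ℓ l r).ord = l.ord + 1 := by
  simp [ord, h]

theorem ord_node_of_lt {l r : StreamTree} (ℓ : ℝ) (h : r.ord < l.ord) :
    (node ℓ l r).ord = l.ord := by
  simp [ord, h.ne', h.le]

section AttachSorted

variable {top : ℝ → StreamTree} {k : ℕ}

/-- Side trees of lower order do not interrupt the main stream, so the order of its upstream end is
carried to the outlet. -/
theorem ord_attachSorted (htop : ∀ d, (top d).ord = k) (ℓ s : ℝ)
    {l : List (ℝ × StreamTree)} (hl : ∀ x ∈ l, x.2.ord < k) :
    (attachSorted top ℓ s l).ord = k := by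
  induction l generalizing s with
  | nil => exact htop _
  | cons x l ih =>
    have h := ih x.1 fun y hy => hl y (List.mem_cons_of_mem _ hy)
    rw [attachSorted, ord_node_of_lt, h]
    rw [h]
    exact hl x List.mem_cons_self

theorem tributarySum_attachSorted (htop : ∀ d, (top d).ord = k) {i : ℕ}
    {Z : StreamTree → ℝ≥0∞} {a : ℝ≥0∞} (hZ : ∀ d, (top d).tributarySum i Z = a) (ℓ s : ℝ)
    {l : List (ℝ × StreamTree)} (hl : ∀ x ∈ l, x.2.ord < k) :
    (attachSorted top ℓ s l).tributarySum i Z =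
      a + (l.map fun x => x.2.streamSum i Z).sum := by
  induction l generalizing s with
  | nil => simp [attachSorted, hZ]
  | cons x l ih =>
    have hl' : ∀ y ∈ l, y.2.ord < k := fun y hy => hl y (List.mem_cons_of_mem _ hy)
    have h1 := ord_attachSorted htop ℓ s hl
    have h2 := ord_attachSorted htop ℓ x.1 hl'
    rw [attachSorted] at h1 ⊢
    rw [tributarySum_node, h1, h2, if_pos rfl, if_neg (hl x List.mem_cons_self).ne, ih x.1 hl']
    simp only [List.map_cons, List.sum_cons]
    ring

theorem streamLinks_attachSorted (htop : ∀ d, (top d).ord = k)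
    (hZ : ∀ d, (top d).streamLinks = 1) (ℓ s : ℝ)
    {l : List (ℝ × StreamTree)} (hl : ∀ x ∈ l, x.2.ord < k) :
    (attachSorted top ℓ s l).streamLinks = 1 + l.length := by
  induction l generalizing s with
  | nil => simp [attachSorted, hZ]
  | cons x l ih =>
    have hl' : ∀ y ∈ l, y.2.ord < k := fun y hy => hl y (List.mem_cons_of_mem _ hy)
    have h1 := ord_attachSorted htop ℓ s hl
    have h2 := ord_attachSorted htop ℓ x.1 hl'
    rw [attachSorted] at h1 ⊢
    rw [streamLinks, h1, h2, if_pos rfl, if_neg (hl x List.mem_cons_self).ne, ih x.1 hl']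
    simp only [List.length_cons]
    ring

theorem streamLength_attachSorted (htop : ∀ d, (top d).ord = k)
    (hZ : ∀ d, (top d).streamLength = d) (ℓ s : ℝ)
    {l : List (ℝ × StreamTree)} (hl : ∀ x ∈ l, x.2.ord < k) :
    (attachSorted top ℓ s l).streamLength = ℓ - s := by
  induction l generalizing s with
  | nil => simp [attachSorted, hZ]
  | cons x l ih =>
    have hl' : ∀ y ∈ l, y.2.ord < k := fun y hy => hl y (List.mem_cons_of_mem _ hy)
    have h1 := ord_attachSorted htop ℓ s hl
    have h2 := ord_attachSorted htop ℓ x.1 hl'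
    rw [attachSorted] at h1 ⊢
    rw [streamLength, h1, h2, if_pos rfl, if_neg (hl x List.mem_cons_self).ne, ih x.1 hl']
    ring

theorem magnitude_attachSorted {m : ℕ} (hm : ∀ d, (top d).magnitude = m) (ℓ s : ℝ)
    (l : List (ℝ × StreamTree)) :
    (attachSorted top ℓ s l).magnitude = m + (l.map fun x => x.2.magnitude).sum := by
  induction l generalizing s with
  | nil => simp [attachSorted, hm]
  | cons x l ih =>
    rw [attachSorted, magnitude, ih x.1]
    simp only [List.map_cons, List.sum_cons]
    ring

/-- Stated as a bound by `y` because it then splits into one condition per side tree, which is the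
form needed for void probabilities. -/
theorem height_attachSorted_le_iff {h : ℝ} (hh : ∀ d, (top d).height = d + h) (ℓ s y : ℝ)
    (l : List (ℝ × StreamTree)) :
    (attachSorted top ℓ s l).height ≤ y ↔
      ℓ - s + h ≤ y ∧ ∀ x ∈ l, x.1 - s + x.2.height ≤ y := by
  induction l generalizing s y with
  | nil => simp [attachSorted, hh]
  | cons x l ih =>
    rw [attachSorted, height, ← le_sub_iff_add_le', max_le_iff, ih x.1, List.forall_mem_cons]
    constructor
    · rintro ⟨⟨h1, h2⟩, h3⟩
      exact ⟨by linarith, by linarith, fun z hz => by linarith [h2 z hz]⟩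
    · rintro ⟨h1, h2, h3⟩
      exact ⟨⟨by linarith, fun z hz => by linarith [h3 z hz]⟩, by linarith⟩

end AttachSorted

/-- The sum of `f` over the links of a tree. -/
noncomputable def linkSum (f : ℝ → ℝ≥0∞) : StreamTree → ℝ≥0∞
  | leaf ℓ => f ℓ
  | node ℓ l r => f ℓ + l.linkSum f + r.linkSum f

theorem measurable_linkSum {f : ℝ → ℝ≥0∞} (hf : Measurable f) : Measurable (linkSum f) :=
  measurable_of_rec (φ := f) (ψ := fun p => f p.1 + p.2.1.2 + p.2.2.2)
    hf (by fun_prop) (fun _ => rfl) (fun _ _ _ => rfl)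

/-- The sum of `f` over the gaps between consecutive elements of `s :: x ++ [ℓ]`. -/
noncomputable def gapSum (f : ℝ → ℝ≥0∞) (ℓ : ℝ) : ℝ → List ℝ → ℝ≥0∞
  | s, [] => f (ℓ - s)
  | s, x :: l => f (x - s) + gapSum f ℓ x l

/-- The links of the main stream are the gaps between attachment points, so their part of the sum
depends on the positions alone. -/
theorem linkSum_attachSorted {top : ℝ → StreamTree} {f : ℝ → ℝ≥0∞} {a : ℝ≥0∞}
    (ha : ∀ d, (top d).linkSum f = f d + a) (ℓ s : ℝ) (l : List (ℝ × StreamTree)) :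
    (attachSorted top ℓ s l).linkSum f =
      gapSum f ℓ s (l.map Prod.fst) + (a + (l.map fun x => x.2.linkSum f).sum) := by
  induction l generalizing s with
  | nil => simp [attachSorted, gapSum, ha]
  | cons x l ih =>
    rw [attachSorted, linkSum, ih x.1]
    simp only [List.map_cons, List.sum_cons, gapSum]
    ring

section Assemble

variable {ℓ : ℝ} {t₁ t₂ : StreamTree} {l : List (ℝ × StreamTree)} {k : ℕ}

theorem perm_sort (l : List (ℝ × StreamTree)) :
    (l.insertionSort fun p q => p.1 ≤ q.1).Perm l :=
  List.perm_insertionSort _ l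

theorem ord_assemble (h₁ : t₁.ord = k) (h₂ : t₂.ord = k) (hl : ∀ x ∈ l, x.2.ord < k + 1) :
    (assemble ℓ t₁ t₂ l).ord = k + 1 := by
  refine ord_attachSorted (fun d => ?_) _ _ fun x hx => hl x ((perm_sort l).mem_iff.1 hx)
  rw [ord_node_of_eq d (h₁.trans h₂.symm), h₁]

theorem tributarySum_assemble (h₁ : t₁.ord = k) (h₂ : t₂.ord = k)
    (hl : ∀ x ∈ l, x.2.ord < k + 1) (i : ℕ) (Z : StreamTree → ℝ≥0∞) :
    (assemble ℓ t₁ t₂ l).tributarySum i Z =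
      t₁.streamSum i Z + t₂.streamSum i Z + (l.map fun x => x.2.streamSum i Z).sum := by
  have ho (d : ℝ) : (node d t₁ t₂).ord = k + 1 := by
    rw [ord_node_of_eq d (h₁.trans h₂.symm), h₁]
  rw [assemble, tributarySum_attachSorted (a := t₁.streamSum i Z + t₂.streamSum i Z) ho ?_ _ _
    fun x hx => hl x ((perm_sort l).mem_iff.1 hx), ((perm_sort l).map _).sum_eq]
  intro d
  rw [tributarySum_node, ho, if_neg (by omega), if_neg (by omega)]

theorem streamLinks_assemble (h₁ : t₁.ord = k) (h₂ : t₂.ord = k)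
    (hl : ∀ x ∈ l, x.2.ord < k + 1) : (assemble ℓ t₁ t₂ l).streamLinks = 1 + l.length := by
  have ho (d : ℝ) : (node d t₁ t₂).ord = k + 1 := by
    rw [ord_node_of_eq d (h₁.trans h₂.symm), h₁]
  rw [assemble, streamLinks_attachSorted ho ?_ _ _
    fun x hx => hl x ((perm_sort l).mem_iff.1 hx), (perm_sort l).length_eq]
  intro d
  rw [streamLinks, ho, if_neg (by omega), if_neg (by omega)]

theorem streamLength_assemble (h₁ : t₁.ord = k) (h₂ : t₂.ord = k)
    (hl : ∀ x ∈ l, x.2.ord < k + 1) : (assemble ℓ t₁ t₂ l).streamLength = ℓ := by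
  have ho (d : ℝ) : (node d t₁ t₂).ord = k + 1 := by
    rw [ord_node_of_eq d (h₁.trans h₂.symm), h₁]
  rw [assemble, streamLength_attachSorted ho ?_ _ _
    fun x hx => hl x ((perm_sort l).mem_iff.1 hx), sub_zero]
  intro d
  rw [streamLength, ho, if_neg (by omega), if_neg (by omega), add_zero, add_zero]

theorem magnitude_assemble (ℓ : ℝ) (t₁ t₂ : StreamTree) (l : List (ℝ × StreamTree)) :
    (assemble ℓ t₁ t₂ l).magnitude =
      t₁.magnitude + t₂.magnitude + (l.map fun x => x.2.magnitude).sum := by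
  rw [assemble, magnitude_attachSorted (top := fun d => node d t₁ t₂)
    (m := t₁.magnitude + t₂.magnitude) (fun _ => rfl), ((perm_sort l).map _).sum_eq]

theorem height_assemble_le_iff (ℓ : ℝ) (t₁ t₂ : StreamTree) (l : List (ℝ × StreamTree)) (y : ℝ) :
    (assemble ℓ t₁ t₂ l).height ≤ y ↔
      ℓ + t₁.height ≤ y ∧ ℓ + t₂.height ≤ y ∧ ∀ x ∈ l, x.1 + x.2.height ≤ y := by
  rw [assemble, height_attachSorted_le_iff (fun _ => rfl)]
  simp only [sub_zero, (perm_sort l).mem_iff, ← max_add_add_left, max_le_iff, and_assoc]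

theorem linkSum_assemble (f : ℝ → ℝ≥0∞) (ℓ : ℝ) (t₁ t₂ : StreamTree)
    (l : List (ℝ × StreamTree)) :
    (assemble ℓ t₁ t₂ l).linkSum f =
      gapSum f ℓ 0 ((l.map Prod.fst).insertionSort (· ≤ ·)) +
        (t₁.linkSum f + t₂.linkSum f + (l.map fun x => x.2.linkSum f).sum) := by
  rw [assemble, linkSum_attachSorted (a := t₁.linkSum f + t₂.linkSum f)
    (fun d => by rw [linkSum, add_assoc]), ((perm_sort l).map _).sum_eq,
    List.map_insertionSort (fun p q : ℝ × StreamTree => p.1 ≤ q.1) (· ≤ ·) Prod.fst l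
      fun _ _ _ _ => Iff.rfl]

end Assemble

theorem listMeasurable_gapSum {f : ℝ → ℝ≥0∞} (hf : Measurable f) :
    ListMeasurable fun (p : ℝ × ℝ) l => gapSum f p.1 p.2 l := by
  intro n
  induction n with
  | zero =>
    simp only [List.ofFn_zero, gapSum]
    fun_prop
  | succ n ih =>
    simp only [List.ofFn_succ, gapSum]
    refine Measurable.add (by fun_prop) ?_
    exact ih.comp (f := fun p : (ℝ × ℝ) × (Fin (n + 1) → ℝ) =>
      ((p.1.1, p.2 0), fun i : Fin n => p.2 i.succ)) (by fun_prop)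

theorem listMeasurable_gapSum_sort {f : ℝ → ℝ≥0∞} (hf : Measurable f) :
    ListMeasurable fun (p : ℝ × ℝ) l => gapSum f p.1 p.2 (l.insertionSort (· ≤ ·)) :=
  (listMeasurable_gapSum hf).insertionSort (measurableSet_le measurable_fst measurable_snd)

end StreamTree

/-! ### The law of a random tree and the means of additive functionals. -/

section RandomAttachment

open StreamTree

/-- The law of a tree attached to the main stream of a tree of order `K + 2`, times the intensity
of the attachment process. -/
noncomputable def sideMeasure (T lam : ℕ → ℝ) (K : ℕ) : Measure StreamTree :=
  ∑ i : Fin (K + 1),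
    ENNReal.ofReal (lam (K + 2) * T (K + 2 - (i + 1))) • ramOfOrder T lam (i + 1)

/-- The intensity of the attachment process on a main stream of length `ℓ`. -/
noncomputable def sideIntensity (T lam : ℕ → ℝ) (K : ℕ) (ℓ : ℝ) : Measure (ℝ × StreamTree) :=
  (volume.restrict (Icc 0 ℓ)).prod (sideMeasure T lam K)

/-- The law of the main stream length and of the two trees at its upstream end. -/
noncomputable def trunkMeasure (T lam : ℕ → ℝ) (K : ℕ) : Measure (ℝ × StreamTree × StreamTree) :=
  (expMeasure (lam (K + 2))).prod ((ramOfOrder T lam (K + 1)).prod (ramOfOrder T lam (K + 1)))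

theorem ramOfOrder_add_two (T lam : ℕ → ℝ) (K : ℕ) :
    ramOfOrder T lam (K + 2) = (trunkMeasure T lam K).bind fun p =>
      poissonImage (sideIntensity T lam K p.1) (assemble p.1 p.2.1 p.2.2) := by
  rw [ramOfOrder]
  rfl

theorem measurable_poissonExp_of_assemble (τ : Measure StreamTree) [IsFiniteMeasure τ]
    {f : StreamTree → ℝ≥0∞} (hf : Measurable f) :
    Measurable fun p : ℝ × StreamTree × StreamTree =>
      poissonExp ((volume.restrict (Icc 0 p.1)).prod τ) fun l =>
        f (assemble p.1 p.2.1 p.2.2 l) :=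
  measurable_poissonExp τ (fun n => hf.comp (listMeasurable_assemble n)) measurable_fst

theorem measurable_assemble (p : ℝ × StreamTree × StreamTree) (n : ℕ) :
    Measurable fun v : Fin n → ℝ × StreamTree => assemble p.1 p.2.1 p.2.2 (List.ofFn v) :=
  (listMeasurable_assemble n).comp measurable_prodMk_left

theorem lintegral_bind_poissonImage (m : Measure (ℝ × StreamTree × StreamTree))
    (τ : Measure StreamTree) [IsFiniteMeasure τ] {f : StreamTree → ℝ≥0∞} (hf : Measurable f) :
    ∫⁻ t, f t ∂(m.bind fun p =>
      poissonImage ((volume.restrict (Icc 0 p.1)).prod τ) (assemble p.1 p.2.1 p.2.2)) =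
    ∫⁻ p, poissonExp ((volume.restrict (Icc 0 p.1)).prod τ)
      (fun l => f (assemble p.1 p.2.1 p.2.2 l)) ∂m := by
  rw [Measure.lintegral_bind _ hf.aemeasurable]
  · exact lintegral_congr fun p => lintegral_poissonImage _ (measurable_assemble p) hf
  · refine (Measure.measurable_of_measurable_coe _ fun s hs => ?_).aemeasurable
    have h1 : Measurable (s.indicator (1 : StreamTree → ℝ≥0∞)) := measurable_one.indicator hs
    convert measurable_poissonExp_of_assemble τ h1 using 2 with p
    rw [← lintegral_indicator_one hs, lintegral_poissonImage _ (measurable_assemble p) h1]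

variable {T lam : ℕ → ℝ}

theorem isFiniteMeasure_sideMeasure_of {K : ℕ}
    (h : ∀ i ≤ K, IsProbabilityMeasure (ramOfOrder T lam (i + 1))) :
    IsFiniteMeasure (sideMeasure T lam K) := by
  refine ⟨?_⟩
  simp only [sideMeasure, Measure.coe_finsetSum, Finset.sum_apply, Measure.smul_apply,
    smul_eq_mul]
  refine ENNReal.sum_lt_top.2 fun i _ => ?_
  have := h i (by omega)
  rw [measure_univ, mul_one]
  exact ENNReal.ofReal_lt_top

theorem ae_sideMeasure {K : ℕ} {P : StreamTree → Prop}
    (h : ∀ i ≤ K, ∀ᵐ t ∂ramOfOrder T lam (i + 1), P t) : ∀ᵐ t ∂sideMeasure T lam K, P t := by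
  rw [sideMeasure, ← Measure.sum_fintype, Measure.ae_sum_iff]
  exact fun i => Measure.ae_smul_measure (h i (by omega)) _

theorem ae_sideIntensity {K : ℕ} {P : StreamTree → Prop}
    (h : ∀ᵐ t ∂sideMeasure T lam K, P t) [SFinite (sideMeasure T lam K)] (ℓ : ℝ) :
    ∀ᵐ x ∂sideIntensity T lam K ℓ, x.1 ∈ Icc 0 ℓ ∧ P x.2 := by
  refine Eventually.and ?_ ?_
  · exact Measure.quasiMeasurePreserving_fst.ae (ae_restrict_mem measurableSet_Icc)
  · exact Measure.quasiMeasurePreserving_snd.ae h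

theorem measurable_gammaPDF (a r : ℝ) : Measurable (gammaPDF a r) :=
  (measurable_gammaPDFReal a r).ennreal_ofReal

theorem ae_expMeasure_pos {r : ℝ} : ∀ᵐ x ∂expMeasure r, 0 < x := by
  rw [expMeasure, gammaMeasure, ae_withDensity_iff (measurable_gammaPDF _ _)]
  have : ∀ᵐ x : ℝ, x ≠ 0 := by simp [ae_iff]
  filter_upwards [this] with x hx h
  by_contra hlt
  exact h (gammaPDF_of_neg (lt_of_le_of_ne (not_lt.1 hlt) hx))

/-- The two claims share one strong induction: total mass 1 at lower orders makes the side measure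
finite, and the orders of the attached trees fix the order of the new tree. -/
theorem isProbabilityMeasure_and_ae_ord (hlam : ∀ k, 0 < lam k) (K : ℕ) :
    IsProbabilityMeasure (ramOfOrder T lam (K + 1)) ∧
      ∀ᵐ t ∂ramOfOrder T lam (K + 1), t.ord = K + 1 := by
  induction K using Nat.strong_induction_on with
  | _ K ih =>
  cases K with
  | zero =>
    have := isProbabilityMeasure_expMeasure (hlam 1)
    rw [zero_add, ramOfOrder]
    refine ⟨Measure.isProbabilityMeasure_map measurable_leaf.aemeasurable, ?_⟩
    rw [ae_map_iff measurable_leaf.aemeasurable (measurableSet_ord_eq 1)]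
    exact Eventually.of_forall fun _ => rfl
  | succ K =>
    have := isProbabilityMeasure_expMeasure (hlam (K + 2))
    have := (ih K (by omega)).1
    have := isFiniteMeasure_sideMeasure_of (T := T) (lam := lam) (K := K)
      fun i hi => (ih i (by omega)).1
    have htr : IsProbabilityMeasure (trunkMeasure T lam K) := by
      unfold trunkMeasure; infer_instance
    have hlt : ∀ᵐ t ∂sideMeasure T lam K, t.ord < K + 2 :=
      ae_sideMeasure fun i hi => by
        filter_upwards [(ih i (by omega)).2] with t ht
        omega
    have hfin (ℓ : ℝ) : IsFiniteMeasure (sideIntensity T lam K ℓ) := by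
      unfold sideIntensity; infer_instance
    refine ⟨⟨?_⟩, ?_⟩
    · rw [← lintegral_one, ramOfOrder_add_two]
      simp only [sideIntensity]
      rw [lintegral_bind_poissonImage _ _ measurable_const]
      simp [poissonExp_const]
    · have hm : MeasurableSet {t : StreamTree | t.ord = K + 2}ᶜ := (measurableSet_ord_eq _).compl
      change ramOfOrder T lam (K + 2) {t : StreamTree | t.ord = K + 2}ᶜ = 0
      rw [← lintegral_indicator_one hm, ramOfOrder_add_two]
      simp only [sideIntensity]
      rw [lintegral_bind_poissonImage _ _ (measurable_one.indicator hm)]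
      refine (lintegral_congr_ae ?_).trans lintegral_zero
      have h1 : ∀ᵐ p ∂trunkMeasure T lam K, p.2.1.ord = K + 1 :=
        Measure.quasiMeasurePreserving_snd.ae
          (Measure.quasiMeasurePreserving_fst.ae (ih K (by omega)).2)
      have h2 : ∀ᵐ p ∂trunkMeasure T lam K, p.2.2.ord = K + 1 :=
        Measure.quasiMeasurePreserving_snd.ae
          (Measure.quasiMeasurePreserving_snd.ae (ih K (by omega)).2)
      filter_upwards [h1, h2] with p hp1 hp2
      rw [← poissonExp_const (sideIntensity T lam K p.1) 0]
      refine poissonExp_congr_ae _ (ae_sideIntensity hlt p.1) fun l hl => ?_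
      rw [indicator_of_notMem]
      simpa using ord_assemble hp1 hp2 fun x hx => (hl x hx).2

theorem isProbabilityMeasure_ramOfOrder (hlam : ∀ k, 0 < lam k) (K : ℕ) :
    IsProbabilityMeasure (ramOfOrder T lam (K + 1)) :=
  (isProbabilityMeasure_and_ae_ord hlam K).1

theorem ae_ord_ramOfOrder (hlam : ∀ k, 0 < lam k) (K : ℕ) :
    ∀ᵐ t ∂ramOfOrder T lam (K + 1), t.ord = K + 1 :=
  (isProbabilityMeasure_and_ae_ord hlam K).2

theorem isFiniteMeasure_sideMeasure (hlam : ∀ k, 0 < lam k) (K : ℕ) :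
    IsFiniteMeasure (sideMeasure T lam K) :=
  isFiniteMeasure_sideMeasure_of fun i _ => isProbabilityMeasure_ramOfOrder hlam i

theorem isFiniteMeasure_sideIntensity (hlam : ∀ k, 0 < lam k) (K : ℕ) (ℓ : ℝ) :
    IsFiniteMeasure (sideIntensity T lam K ℓ) := by
  have := isFiniteMeasure_sideMeasure (T := T) hlam K
  unfold sideIntensity
  infer_instance

theorem lintegral_ramOfOrder_add_two (hlam : ∀ k, 0 < lam k) (K : ℕ) {f : StreamTree → ℝ≥0∞}
    (hf : Measurable f) :
    ∫⁻ t, f t ∂ramOfOrder T lam (K + 2) = ∫⁻ p, poissonExp (sideIntensity T lam K p.1)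
      (fun l => f (assemble p.1 p.2.1 p.2.2 l)) ∂trunkMeasure T lam K := by
  have := isFiniteMeasure_sideMeasure (T := T) hlam K
  rw [ramOfOrder_add_two]
  exact lintegral_bind_poissonImage _ _ hf

/-- The configurations that occur almost surely in the construction of a tree of order `K + 2`. -/
structure IsAdmissible (K : ℕ) (p : ℝ × StreamTree × StreamTree) (l : List (ℝ × StreamTree)) :
    Prop where
  length_pos : 0 < p.1
  ord_left : p.2.1.ord = K + 1
  ord_right : p.2.2.ord = K + 1
  ord_side : ∀ x ∈ l, x.2.ord < K + 1 + 1
  mem_Icc : ∀ x ∈ l, x.1 ∈ Icc 0 p.1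

/-- Reduces comparisons of means to deterministic comparisons on admissible configurations. -/
theorem lintegral_poissonExp_mono (hlam : ∀ k, 0 < lam k) (K : ℕ)
    {F G : ℝ × StreamTree × StreamTree → List (ℝ × StreamTree) → ℝ≥0∞}
    (h : ∀ p l, IsAdmissible K p l → F p l ≤ G p l) :
    ∫⁻ p, poissonExp (sideIntensity T lam K p.1) (F p) ∂trunkMeasure T lam K ≤
      ∫⁻ p, poissonExp (sideIntensity T lam K p.1) (G p) ∂trunkMeasure T lam K := by
  have := isFiniteMeasure_sideMeasure (T := T) hlam K
  have := isProbabilityMeasure_ramOfOrder (T := T) hlam K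
  have := isProbabilityMeasure_expMeasure (hlam (K + 2))
  have hlt : ∀ᵐ t ∂sideMeasure T lam K, t.ord < K + 2 :=
    ae_sideMeasure fun i hi => by
      filter_upwards [ae_ord_ramOfOrder hlam i] with t ht
      omega
  refine lintegral_mono_ae ?_
  have h0 : ∀ᵐ p ∂trunkMeasure T lam K, 0 < p.1 :=
    Measure.quasiMeasurePreserving_fst.ae ae_expMeasure_pos
  have h1 : ∀ᵐ p ∂trunkMeasure T lam K, p.2.1.ord = K + 1 :=
    Measure.quasiMeasurePreserving_snd.ae
      (Measure.quasiMeasurePreserving_fst.ae (ae_ord_ramOfOrder hlam K))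
  have h2 : ∀ᵐ p ∂trunkMeasure T lam K, p.2.2.ord = K + 1 :=
    Measure.quasiMeasurePreserving_snd.ae
      (Measure.quasiMeasurePreserving_snd.ae (ae_ord_ramOfOrder hlam K))
  filter_upwards [h0, h1, h2] with p hp0 hp1 hp2
  have := isFiniteMeasure_sideIntensity (T := T) hlam K p.1
  exact poissonExp_mono_ae _ (ae_sideIntensity hlt p.1) fun l hl =>
    h p l ⟨hp0, hp1, hp2, fun x hx => (hl x hx).2, fun x hx => (hl x hx).1⟩

theorem lintegral_poissonExp_congr (hlam : ∀ k, 0 < lam k) (K : ℕ)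
    {F G : ℝ × StreamTree × StreamTree → List (ℝ × StreamTree) → ℝ≥0∞}
    (h : ∀ p l, IsAdmissible K p l → F p l = G p l) :
    ∫⁻ p, poissonExp (sideIntensity T lam K p.1) (F p) ∂trunkMeasure T lam K =
      ∫⁻ p, poissonExp (sideIntensity T lam K p.1) (G p) ∂trunkMeasure T lam K :=
  le_antisymm (lintegral_poissonExp_mono hlam K fun p l hl => (h p l hl).le)
    (lintegral_poissonExp_mono hlam K fun p l hl => (h p l hl).ge)

theorem lintegral_sideMeasure (K : ℕ) (h : StreamTree → ℝ≥0∞) :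
    ∫⁻ t, h t ∂sideMeasure T lam K = ∑ i : Fin (K + 1),
      ENNReal.ofReal (lam (K + 2) * T (K + 2 - (i + 1))) *
        ∫⁻ t, h t ∂ramOfOrder T lam (i + 1) := by
  simp [sideMeasure]

theorem lintegral_expMeasure (r : ℝ) (f : ℝ → ℝ≥0∞) (hf : Measurable f) :
    ∫⁻ x, f x ∂expMeasure r =
      ∫⁻ x in Ici 0, ENNReal.ofReal (r * Real.exp (-(r * x))) * f x := by
  rw [expMeasure, gammaMeasure, lintegral_withDensity_eq_lintegral_mul _ (measurable_gammaPDF _ _) hf,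
    ← lintegral_indicator measurableSet_Ici]
  refine lintegral_congr fun x => ?_
  by_cases hx : 0 ≤ x
  · rw [indicator_of_mem (mem_Ici.2 hx), Pi.mul_apply]
    exact congrArg (· * f x) (exponentialPDF_of_nonneg hx)
  · rw [indicator_of_notMem (by simpa using hx), Pi.mul_apply, gammaPDF_of_neg (not_le.1 hx),
      zero_mul]

/-- Up to the constant n!/r^n, the integrand is the Gamma density of shape n + 1, which has integral
1. -/
theorem lintegral_pow_expMeasure {r : ℝ} (hr : 0 < r) (n : ℕ) :
    ∫⁻ x, ENNReal.ofReal x ^ n ∂expMeasure r = ENNReal.ofReal (n.factorial / r ^ n) := by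
  have hn : (0 : ℝ) < n + 1 := by positivity
  rw [lintegral_expMeasure _ _ (by fun_prop)]
  rw [← mul_one (ENNReal.ofReal (n.factorial / r ^ n)), ← lintegral_gammaPDF_eq_one hn hr,
    ← lintegral_const_mul _ (measurable_gammaPDF _ _), ← lintegral_indicator measurableSet_Ici]
  refine lintegral_congr fun x => ?_
  by_cases hx : 0 ≤ x
  · rw [indicator_of_mem (mem_Ici.2 hx), gammaPDF_of_nonneg hx, ← ENNReal.ofReal_pow hx,
      ← ENNReal.ofReal_mul (by positivity), ← ENNReal.ofReal_mul (by positivity),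
      Real.Gamma_nat_eq_factorial, add_sub_cancel_right, Real.rpow_natCast]
    congr 1
    have : r ^ ((n : ℝ) + 1) = r ^ n * r := by
      rw [Real.rpow_add_one hr.ne', Real.rpow_natCast]
    rw [this]
    field_simp
  · rw [indicator_of_notMem (by simpa using hx), gammaPDF_of_neg (not_le.1 hx), mul_zero]

theorem lintegral_ofReal_expMeasure {r : ℝ} (hr : 0 < r) :
    ∫⁻ x, ENNReal.ofReal x ∂expMeasure r = ENNReal.ofReal (1 / r) := by
  simpa using lintegral_pow_expMeasure hr 1

/-- The mean of an additive functional of a random tree of order `K + 2`. -/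
theorem lintegral_poissonExp_additive (hlam : ∀ k, 0 < lam k) (K : ℕ)
    {G : ℝ → List (ℝ × StreamTree) → ℝ≥0∞} (hG : ListMeasurable G)
    {h h' : StreamTree → ℝ≥0∞} (hh : Measurable h) (hh' : Measurable h') :
    ∫⁻ p, poissonExp (sideIntensity T lam K p.1)
        (fun l => G p.1 l + (h p.2.1 + h p.2.2 + (l.map fun x => h' x.2).sum))
        ∂trunkMeasure T lam K =
      ∫⁻ ℓ, poissonExp (sideIntensity T lam K ℓ) (G ℓ) ∂expMeasure (lam (K + 2)) +
        (2 * ∫⁻ t, h t ∂ramOfOrder T lam (K + 1) +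
          ∑ i : Fin (K + 1), ENNReal.ofReal (T (K + 2 - (i + 1))) *
            ∫⁻ t, h' t ∂ramOfOrder T lam (i + 1)) := by
  have := isFiniteMeasure_sideMeasure (T := T) hlam K
  have := isProbabilityMeasure_ramOfOrder (T := T) hlam K
  have := isProbabilityMeasure_expMeasure (hlam (K + 2))
  have h1 (p : ℝ × StreamTree × StreamTree) : poissonExp (sideIntensity T lam K p.1)
      (fun l => G p.1 l + (h p.2.1 + h p.2.2 + (l.map fun x => h' x.2).sum)) =
      poissonExp (sideIntensity T lam K p.1) (G p.1) + (h p.2.1 + h p.2.2 +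
        ENNReal.ofReal p.1 * ∫⁻ t, h' t ∂sideMeasure T lam K) := by
    have := isFiniteMeasure_sideIntensity (T := T) hlam K p.1
    rw [poissonExp_add _ fun n => (hG n).comp measurable_prodMk_left,
      poissonExp_add _ fun n => measurable_const, poissonExp_const,
      poissonExp_sum (h := fun x : ℝ × StreamTree => h' x.2) _ (by fun_prop), sideIntensity,
      lintegral_prod _ (by fun_prop)]
    simp [mul_comm]
  have hm : Measurable fun ℓ => poissonExp (sideIntensity T lam K ℓ) (G ℓ) :=
    measurable_poissonExp _ hG measurable_id
  simp only [h1]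
  have hm' : Measurable fun p : ℝ × StreamTree × StreamTree =>
      poissonExp (sideIntensity T lam K p.1) (G p.1) := hm.comp measurable_fst
  rw [lintegral_add_left hm', lintegral_add_left (by fun_prop),
    lintegral_add_left (by fun_prop), lintegral_mul_const _ (by fun_prop), trunkMeasure]
  have e1 {φ : ℝ → ℝ≥0∞} (hφ : Measurable φ) : ∫⁻ p, φ p.1 ∂((expMeasure (lam (K + 2))).prod
      ((ramOfOrder T lam (K + 1)).prod (ramOfOrder T lam (K + 1)))) =
      ∫⁻ x, φ x ∂(expMeasure (lam (K + 2))) := by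
    rw [lintegral_prod _ (by fun_prop)]
    simp
  have e2 : ∫⁻ p, h p.2.1 ∂((expMeasure (lam (K + 2))).prod
      ((ramOfOrder T lam (K + 1)).prod (ramOfOrder T lam (K + 1)))) =
      ∫⁻ t, h t ∂ramOfOrder T lam (K + 1) := by
    rw [lintegral_prod _ (by fun_prop)]
    simp only [lintegral_const, measure_univ, mul_one]
    rw [lintegral_prod _ (by fun_prop)]
    simp
  have e3 : ∫⁻ p, h p.2.2 ∂((expMeasure (lam (K + 2))).prod
      ((ramOfOrder T lam (K + 1)).prod (ramOfOrder T lam (K + 1)))) =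
      ∫⁻ t, h t ∂ramOfOrder T lam (K + 1) := by
    rw [lintegral_prod _ (by fun_prop)]
    simp only [lintegral_const, measure_univ, mul_one]
    rw [lintegral_prod _ (by fun_prop)]
    simp
  rw [e1 hm, e1 ENNReal.measurable_ofReal, e2, e3, two_mul,
    lintegral_ofReal_expMeasure (hlam _), lintegral_sideMeasure, Finset.mul_sum]
  congr 2
  refine Finset.sum_congr rfl fun i _ => ?_
  -- The mean length of the main stream cancels the rate in the intensity, so `T` alone remains.
  rw [← mul_assoc, ← ENNReal.ofReal_mul (one_div_pos.2 (hlam _)).le, ← mul_assoc,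
    one_div_mul_cancel (hlam _).ne', one_mul]

end RandomAttachment

/-! ### Recursions for the means of the attributes. -/

section Recursion

open StreamTree

variable {T lam : ℕ → ℝ}

/-- The common source of all exact recursions: `G` is the share of the main stream, `h` that of a
top tree and `h'` that of a side tree. -/
theorem lintegral_ramOfOrder_of_additive (hlam : ∀ k, 0 < lam k) (K : ℕ)
    {f h h' : StreamTree → ℝ≥0∞} (hf : Measurable f) (hh : Measurable h) (hh' : Measurable h')
    {G : ℝ → List (ℝ × StreamTree) → ℝ≥0∞} (hG : ListMeasurable G)
    (hadd : ∀ p l, IsAdmissible K p l → f (assemble p.1 p.2.1 p.2.2 l) =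
      G p.1 l + (h p.2.1 + h p.2.2 + (l.map fun x => h' x.2).sum)) :
    ∫⁻ t, f t ∂ramOfOrder T lam (K + 2) =
      ∫⁻ ℓ, poissonExp (sideIntensity T lam K ℓ) (G ℓ) ∂expMeasure (lam (K + 2)) +
        (2 * ∫⁻ t, h t ∂ramOfOrder T lam (K + 1) +
          ∑ i : Fin (K + 1), ENNReal.ofReal (T (K + 2 - (i + 1))) *
            ∫⁻ t, h' t ∂ramOfOrder T lam (i + 1)) := by
  rw [lintegral_ramOfOrder_add_two hlam K hf, lintegral_poissonExp_congr hlam K hadd,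
    lintegral_poissonExp_additive hlam K hG hh hh']

theorem lintegral_poissonExp_sideIntensity_const (hlam : ∀ k, 0 < lam k) (K : ℕ)
    {g : ℝ → ℝ≥0∞} :
    ∫⁻ ℓ, poissonExp (sideIntensity T lam K ℓ) (fun _ => g ℓ) ∂expMeasure (lam (K + 2)) =
      ∫⁻ ℓ, g ℓ ∂expMeasure (lam (K + 2)) := by
  refine lintegral_congr fun ℓ => ?_
  have := isFiniteMeasure_sideIntensity (T := T) hlam K ℓ
  exact poissonExp_const _ _

theorem listMeasurable_const {X : Type*} [MeasurableSpace X] {g : ℝ → ℝ≥0∞} (hg : Measurable g) :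
    ListMeasurable fun (ℓ : ℝ) (_ : List X) => g ℓ :=
  fun _ => hg.comp measurable_fst

theorem lintegral_streamSum_one (i : ℕ) {Z : StreamTree → ℝ≥0∞}
    (hZ : Measurable Z) :
    ∫⁻ t, t.streamSum i Z ∂ramOfOrder T lam 1 =
      (if 1 = i then 1 else 0) * ∫⁻ t, Z t ∂ramOfOrder T lam i := by
  rw [ramOfOrder, lintegral_map (measurable_streamSum i hZ) measurable_leaf]
  by_cases hi : 1 = i
  · subst hi
    rw [ramOfOrder, lintegral_map hZ measurable_leaf, if_pos rfl, one_mul]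
    simp [streamSum_eq, ord, tributarySum, tributaries]
  · simp [streamSum_eq, ord, hi, tributarySum, tributaries]

/-- The root stream counts only if its order is `i`; every other stream is a stream of a top tree or
of a side tree. -/
theorem lintegral_streamSum_add_two (hlam : ∀ k, 0 < lam k) (K i : ℕ) {Z : StreamTree → ℝ≥0∞}
    (hZ : Measurable Z) :
    ∫⁻ t, t.streamSum i Z ∂ramOfOrder T lam (K + 2) =
      (if K + 2 = i then 1 else 0) * ∫⁻ t, Z t ∂ramOfOrder T lam i +
        (2 * ∫⁻ t, t.streamSum i Z ∂ramOfOrder T lam (K + 1) +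
          ∑ j : Fin (K + 1), ENNReal.ofReal (T (K + 2 - (j + 1))) *
            ∫⁻ t, t.streamSum i Z ∂ramOfOrder T lam (j + 1)) := by
  simp only [streamSum_eq (t := _) (i := i) (Z := Z)]
  have h0 : Measurable fun t : StreamTree => if t.ord = i then Z t else 0 :=
    Measurable.ite (measurableSet_ord_eq i) hZ measurable_const
  rw [lintegral_add_left h0]
  simp only [← streamSum_eq]
  congr 1
  · have : ∀ᵐ t ∂ramOfOrder T lam (K + 2), (if t.ord = i then Z t else 0) =
        if K + 2 = i then Z t else 0 := by
      filter_upwards [ae_ord_ramOfOrder hlam (K + 1)] with t ht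
      rw [ht]
    rw [lintegral_congr_ae this]
    by_cases hi : K + 2 = i
    · subst hi; simp
    · simp [hi]
  · rw [lintegral_ramOfOrder_of_additive hlam K (measurable_tributarySum i hZ)
      (measurable_streamSum i hZ) (measurable_streamSum i hZ)
      (listMeasurable_const (g := fun _ => 0) measurable_const) fun p l hpl => ?_,
      lintegral_poissonExp_sideIntensity_const hlam]
    · simp
    · rw [zero_add]
      exact tributarySum_assemble hpl.ord_left hpl.ord_right hpl.ord_side i Z

theorem lintegral_magnitude_add_two (hlam : ∀ k, 0 < lam k) (K : ℕ) :
    ∫⁻ t, (t.magnitude : ℝ≥0∞) ∂ramOfOrder T lam (K + 2) =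
      2 * ∫⁻ t, (t.magnitude : ℝ≥0∞) ∂ramOfOrder T lam (K + 1) +
        ∑ j : Fin (K + 1), ENNReal.ofReal (T (K + 2 - (j + 1))) *
          ∫⁻ t, (t.magnitude : ℝ≥0∞) ∂ramOfOrder T lam (j + 1) := by
  have hm : Measurable fun t : StreamTree => (t.magnitude : ℝ≥0∞) :=
    (measurable_from_top (f := fun n : ℕ => (n : ℝ≥0∞))).comp measurable_magnitude
  rw [lintegral_ramOfOrder_of_additive hlam K hm hm hm
      (listMeasurable_const (g := fun _ => 0) measurable_const) fun p l hpl => ?_,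
      lintegral_poissonExp_sideIntensity_const hlam]
  · simp
  · rw [magnitude_assemble]
    push_cast
    simp [List.map_map, Function.comp_def]

/-- Each attached tree cuts the main stream once more, hence `h' = 1`; the top trees contribute
nothing. -/
theorem lintegral_streamLinks_add_two (hlam : ∀ k, 0 < lam k) (K : ℕ) :
    ∫⁻ t, (t.streamLinks : ℝ≥0∞) ∂ramOfOrder T lam (K + 2) =
      1 + ∑ j : Fin (K + 1), ENNReal.ofReal (T (K + 2 - (j + 1))) := by
  have hm : Measurable fun t : StreamTree => (t.streamLinks : ℝ≥0∞) :=
    (measurable_from_top (f := fun n : ℕ => (n : ℝ≥0∞))).comp measurable_streamLinks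
  have hp (j : ℕ) := isProbabilityMeasure_ramOfOrder (T := T) hlam j
  have := isProbabilityMeasure_expMeasure (hlam (K + 2))
  rw [lintegral_ramOfOrder_of_additive hlam K hm (measurable_const (a := 0))
      (measurable_const (a := 1))
      (listMeasurable_const (g := fun _ => 1) measurable_const) fun p l hpl => ?_,
      lintegral_poissonExp_sideIntensity_const hlam]
  · simp
  · rw [streamLinks_assemble hpl.ord_left hpl.ord_right hpl.ord_side]
    simp

theorem lintegral_streamLength_add_two (hlam : ∀ k, 0 < lam k) (K : ℕ) {f : ℝ → ℝ≥0∞}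
    (hf : Measurable f) :
    ∫⁻ t, f t.streamLength ∂ramOfOrder T lam (K + 2) = ∫⁻ ℓ, f ℓ ∂expMeasure (lam (K + 2)) := by
  rw [lintegral_ramOfOrder_of_additive hlam K (f := fun t => f t.streamLength)
      (hf.comp measurable_streamLength)
      (measurable_const (a := 0)) (measurable_const (a := 0))
      (listMeasurable_const hf) fun p l hpl => ?_,
      lintegral_poissonExp_sideIntensity_const hlam]
  · simp
  · rw [streamLength_assemble hpl.ord_left hpl.ord_right hpl.ord_side]
    simp

theorem lintegral_linkSum_add_two (hlam : ∀ k, 0 < lam k) (K : ℕ) {f : ℝ → ℝ≥0∞}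
    (hf : Measurable f) :
    ∫⁻ t, t.linkSum f ∂ramOfOrder T lam (K + 2) =
      ∫⁻ ℓ, poissonExp (sideIntensity T lam K ℓ)
          (fun l => gapSum f ℓ 0 ((l.map Prod.fst).insertionSort (· ≤ ·)))
          ∂expMeasure (lam (K + 2)) +
        (2 * ∫⁻ t, t.linkSum f ∂ramOfOrder T lam (K + 1) +
          ∑ j : Fin (K + 1), ENNReal.ofReal (T (K + 2 - (j + 1))) *
            ∫⁻ t, t.linkSum f ∂ramOfOrder T lam (j + 1)) := by
  refine lintegral_ramOfOrder_of_additive hlam K (measurable_linkSum hf)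
    (measurable_linkSum hf) (measurable_linkSum hf) (fun n => ?_) fun p l hpl => ?_
  · have := (listMeasurable_gapSum_sort hf n).comp
      (f := fun p : ℝ × (Fin n → ℝ × StreamTree) => ((p.1, (0 : ℝ)), fun i => (p.2 i).1))
      (by fun_prop)
    simpa only [List.map_ofFn, Function.comp_def] using this
  · exact linkSum_assemble f p.1 p.2.1 p.2.2 l

/-- The recursion determines its solution and is linear in the source, so a real solution `x` with
source `b` gives the means up to the factor `F`, which may be infinite. -/
theorem eq_of_tokunaga_recursion {e : ℕ → ℝ≥0∞} {F : ℝ≥0∞} {b x : ℕ → ℝ}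
    (hb : ∀ n, 0 ≤ b n) (hx : ∀ n, 0 ≤ x n) (hT : ∀ n, 0 ≤ T n)
    (hrec : ∀ n, x (n + 1) = b n + 2 * x n + ∑ j ∈ Finset.range (n + 1), T (n + 1 - j) * x j)
    (h0 : e 0 = ENNReal.ofReal (x 0) * F)
    (he : ∀ n, e (n + 1) = ENNReal.ofReal (b n) * F +
      (2 * e n + ∑ j : Fin (n + 1), ENNReal.ofReal (T (n + 2 - (j + 1))) * e j)) (n : ℕ) :
    e n = ENNReal.ofReal (x n) * F := by
  induction n using Nat.strong_induction_on with
  | _ n ih =>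
  cases n with
  | zero => exact h0
  | succ n =>
    rw [he, hrec, ih n (by omega), add_assoc,
      ENNReal.ofReal_add (hb n) (add_nonneg (mul_nonneg two_pos.le (hx n))
        (Finset.sum_nonneg fun j _ => mul_nonneg (hT _) (hx j))),
      ENNReal.ofReal_add (mul_nonneg two_pos.le (hx n))
        (Finset.sum_nonneg fun j _ => mul_nonneg (hT _) (hx j)),
      ENNReal.ofReal_mul two_pos.le, ENNReal.ofReal_ofNat,
      ENNReal.ofReal_sum_of_nonneg (fun j _ => mul_nonneg (hT _) (hx j)), add_mul, add_mul,
      ← mul_assoc, Finset.sum_mul, Finset.sum_range]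
    congr 2
    refine Finset.sum_congr rfl fun j _ => ?_
    rw [ih j (by omega), ENNReal.ofReal_mul (hT _), mul_assoc,
      show n + 2 - ((j : ℕ) + 1) = n + 1 - j by omega]

end Recursion

/-! ### Explicit solutions for the Tokunaga sequence. -/

section Tokunaga

variable {c : ℝ}

theorem tokunaga_nonneg (hc : 1 ≤ c) (k : ℕ) : 0 ≤ tokunaga c k :=
  mul_nonneg (by linarith) (pow_nonneg (by linarith) _)

/-- Telescopes, since T_k = c^k - c^{k-1}. -/
theorem one_add_sum_tokunaga (n : ℕ) :
    1 + ∑ j ∈ Finset.range n, tokunaga c (n - j) = c ^ n := by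
  rw [← Finset.sum_range_reflect]
  induction n with
  | zero => simp
  | succ n ih =>
    rw [Finset.sum_range_succ, ← add_assoc]
    have : ∑ x ∈ Finset.range n, tokunaga c (n + 1 - (n + 1 - 1 - x)) =
        ∑ x ∈ Finset.range n, tokunaga c (n - (n - 1 - x)) :=
      Finset.sum_congr rfl fun x hx => by
        have := Finset.mem_range.1 hx
        congr 1; omega
    rw [this, ih]
    simp only [tokunaga, add_tsub_cancel_right, tsub_self, tsub_zero]
    ring

/-- T and the source are both geometric with ratio c, so the full recursion at n + 1 is c times that
at n plus terms in `x (n + 1)` and `x n`. A two-term recursion with roots 1 and 2c is therefore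
enough. -/
theorem tokunaga_recursion {x : ℕ → ℝ} {b : ℝ} (h1 : x 1 = b * c + 2 * x 0 + (c - 1) * x 0)
    (h2 : ∀ n, x (n + 2) = (2 * c + 1) * x (n + 1) - 2 * c * x n) (n : ℕ) :
    x (n + 1) = b * c ^ (n + 1) + 2 * x n +
      ∑ j ∈ Finset.range (n + 1), tokunaga c (n + 1 - j) * x j := by
  induction n with
  | zero => simp [tokunaga, h1]
  | succ n ih =>
    -- Raising the order by one multiplies every old weight by c; the one new weight is T_1 = c - 1.
    have h3 : ∑ j ∈ Finset.range (n + 1), tokunaga c (n + 1 + 1 - j) * x j =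
        c * ∑ j ∈ Finset.range (n + 1), tokunaga c (n + 1 - j) * x j := by
      rw [Finset.mul_sum]
      refine Finset.sum_congr rfl fun j hj => ?_
      have hj' := Finset.mem_range.1 hj
      rw [tokunaga, tokunaga, show n + 1 + 1 - j - 1 = n + 1 - j - 1 + 1 by omega]
      ring
    have h4 : tokunaga c (n + 1 + 1 - (n + 1)) = c - 1 := by
      simp [tokunaga, show n + 1 + 1 - (n + 1) = 1 by omega]
    rw [Finset.sum_range_succ, h3, h4, h2]
    linear_combination c * ih

/-- The mean number of streams of order `i` in a tree of order `i + n`. -/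
noncomputable def branchMean (c : ℝ) (n : ℕ) : ℝ :=
  1 + c * ∑ i ∈ Finset.range n, (2 * c) ^ i

theorem branchMean_zero (c : ℝ) : branchMean c 0 = 1 := by simp [branchMean]

theorem one_le_branchMean (hc : 1 ≤ c) (n : ℕ) : 1 ≤ branchMean c n := by
  have : 0 ≤ c * ∑ i ∈ Finset.range n, (2 * c) ^ i :=
    mul_nonneg (by linarith) (Finset.sum_nonneg fun i _ => pow_nonneg (by linarith) i)
  rw [branchMean]
  linarith

theorem branchMean_succ (n : ℕ) :
    branchMean c (n + 1) = 2 * branchMean c n +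
      ∑ j ∈ Finset.range (n + 1), tokunaga c (n + 1 - j) * branchMean c j := by
  have := tokunaga_recursion (c := c) (x := branchMean c) (b := 0)
    (by simp [branchMean]; ring)
    (fun n => by simp only [branchMean, Finset.sum_range_succ]; ring) n
  simpa using this

/-- Index `n` stands for trees of order n + 1, and `a` for streams of order a + 1. There are none
below `a`, the indicator creates the root stream at `a`, and from there on this is `branchMean_succ`
shifted by `a`. -/
theorem shifted_branchMean_succ (a n : ℕ) :
    (if a ≤ n + 1 then branchMean c (n + 1 - a) else 0) =
      (if n + 1 = a then 1 else 0) + 2 * (if a ≤ n then branchMean c (n - a) else 0) +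
      ∑ j ∈ Finset.range (n + 1),
        tokunaga c (n + 1 - j) * (if a ≤ j then branchMean c (j - a) else 0) := by
  by_cases ha : a ≤ n
  · obtain ⟨m, rfl⟩ := Nat.exists_eq_add_of_le ha
    rw [if_pos (by omega), if_neg (by omega), if_pos ha, add_assoc a m 1, add_assoc, Finset.sum_range_add,
      Finset.sum_eq_zero (s := Finset.range a), show a + (m + 1) - a = m + 1 by omega,
      show a + m - a = m by omega, branchMean_succ, zero_add, zero_add]
    · congr 1
      refine Finset.sum_congr rfl fun j _ => ?_
      rw [if_pos (by omega), show a + (m + 1) - (a + j) = m + 1 - j by omega,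
        show a + j - a = j by omega]
    · intro j hj
      have := Finset.mem_range.1 hj
      rw [if_neg (by omega), mul_zero]
  · rw [if_neg ha, Finset.sum_eq_zero]
    · by_cases h : n + 1 = a
      · rw [if_pos h.ge, if_pos h, h]
        simp [branchMean_zero]
      · rw [if_neg (by omega), if_neg h]
        simp
    · intro j hj
      have := Finset.mem_range.1 hj
      rw [if_neg (by omega), mul_zero]

/-- The mean number of links in a tree of order `n + 1`. -/
noncomputable def linkMean (c : ℝ) (n : ℕ) : ℝ := ∑ i ∈ Finset.range (n + 1), (2 * c) ^ i

theorem linkMean_succ (n : ℕ) :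
    linkMean c (n + 1) = c ^ (n + 1) + 2 * linkMean c n +
      ∑ j ∈ Finset.range (n + 1), tokunaga c (n + 1 - j) * linkMean c j := by
  have := tokunaga_recursion (c := c) (x := linkMean c) (b := 1)
    (by simp [linkMean, Finset.sum_range_succ]; ring)
    (fun n => by simp only [linkMean, Finset.sum_range_succ]; ring) n
  simpa using this

/-- The rate of the lengths of the streams of order `j` in the critical Tokunaga model. -/
noncomputable def tokunagaRate (c γ : ℝ) (j : ℕ) : ℝ := γ * c ^ (1 - (j : ℤ))

theorem tokunagaRate_pos {γ : ℝ} (hc : 1 ≤ c) (hγ : 0 < γ) (j : ℕ) : 0 < tokunagaRate c γ j :=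
  mul_pos hγ (zpow_pos (by linarith) _)

theorem tokunagaRate_succ (c γ : ℝ) (n : ℕ) :
    tokunagaRate c γ (n + 1) = γ / c ^ n := by
  rw [tokunagaRate, div_eq_mul_inv]
  congr 1
  rw [← zpow_natCast, ← zpow_neg]
  congr 1
  push_cast
  ring

variable {γ : ℝ}

/-- The mean of `Z` enters the recursion only as a factor of the source. It therefore factors out,
and what is left is the mean number of streams. -/
theorem lintegral_streamSum_tokunaga (hc : 1 ≤ c) (hγ : 0 < γ) (a n : ℕ)
    {Z : StreamTree → ℝ≥0∞} (hZ : Measurable Z) :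
    ∫⁻ t, t.streamSum (a + 1) Z ∂ramOfOrder (tokunaga c) (tokunagaRate c γ) (n + 1) =
      ENNReal.ofReal (if a ≤ n then branchMean c (n - a) else 0) *
        ∫⁻ t, Z t ∂ramOfOrder (tokunaga c) (tokunagaRate c γ) (a + 1) := by
  have hlam := tokunagaRate_pos hc hγ
  refine eq_of_tokunaga_recursion (T := tokunaga c) (b := fun n => if n + 1 = a then 1 else 0)
    (x := fun n => if a ≤ n then branchMean c (n - a) else 0)
    (e := fun n => ∫⁻ t, t.streamSum (a + 1) Z
      ∂ramOfOrder (tokunaga c) (tokunagaRate c γ) (n + 1))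
    (fun n => by positivity) (fun n => ?_) (tokunaga_nonneg hc) (shifted_branchMean_succ a)
    ?_ (fun n => ?_) n
  · split_ifs
    · linarith [one_le_branchMean hc (n - a)]
    · rfl
  · rw [lintegral_streamSum_one _ hZ]
    cases a <;> simp [branchMean_zero]
  · rw [lintegral_streamSum_add_two hlam n (a + 1) hZ]
    by_cases h : n + 1 = a <;> simp [h]

theorem lintegral_magnitude_tokunaga (hc : 1 ≤ c) (hγ : 0 < γ) (n : ℕ) :
    ∫⁻ t, (t.magnitude : ℝ≥0∞) ∂ramOfOrder (tokunaga c) (tokunagaRate c γ) (n + 1) =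
      ENNReal.ofReal (branchMean c n) := by
  have hlam := tokunagaRate_pos hc hγ
  have := isProbabilityMeasure_expMeasure (hlam 1)
  have hm : Measurable fun t : StreamTree => (t.magnitude : ℝ≥0∞) :=
    (measurable_from_top (f := fun n : ℕ => (n : ℝ≥0∞))).comp StreamTree.measurable_magnitude
  have := eq_of_tokunaga_recursion (T := tokunaga c) (b := fun n => 0) (F := 1)
    (x := branchMean c) (e := fun n => ∫⁻ t, (t.magnitude : ℝ≥0∞)
      ∂ramOfOrder (tokunaga c) (tokunagaRate c γ) (n + 1))
    (fun n => le_rfl) (fun n => by linarith [one_le_branchMean hc n]) (tokunaga_nonneg hc)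
    (fun n => by rw [zero_add]; exact branchMean_succ n) ?_ (fun n => ?_) n
  · simpa using this
  · rw [zero_add, ramOfOrder, lintegral_map hm StreamTree.measurable_leaf]
    simp [StreamTree.magnitude, branchMean_zero]
  · rw [lintegral_magnitude_add_two hlam n]
    simp

theorem lintegral_streamLinks_tokunaga (hc : 1 ≤ c) (hγ : 0 < γ) (n : ℕ) :
    ∫⁻ t, (t.streamLinks : ℝ≥0∞) ∂ramOfOrder (tokunaga c) (tokunagaRate c γ) (n + 1) =
      ENNReal.ofReal (c ^ n) := by
  have hlam := tokunagaRate_pos hc hγ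
  cases n with
  | zero =>
    have := isProbabilityMeasure_expMeasure (hlam 1)
    have hm : Measurable fun t : StreamTree => (t.streamLinks : ℝ≥0∞) :=
      (measurable_from_top (f := fun n : ℕ => (n : ℝ≥0∞))).comp StreamTree.measurable_streamLinks
    rw [zero_add, ramOfOrder, lintegral_map hm StreamTree.measurable_leaf]
    simp [StreamTree.streamLinks]
  | succ n =>
    rw [lintegral_streamLinks_add_two hlam, ← one_add_sum_tokunaga (c := c) (n + 1),
      ENNReal.ofReal_add zero_le_one (Finset.sum_nonneg fun j _ => tokunaga_nonneg hc _),
      ENNReal.ofReal_one, ENNReal.ofReal_sum_of_nonneg fun j _ => tokunaga_nonneg hc _,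
      Finset.sum_range]
    congr 1
    refine Finset.sum_congr rfl fun j _ => ?_
    rw [show n + 2 - ((j : ℕ) + 1) = n + 1 - j by omega]

theorem lintegral_streamLength_tokunaga (hc : 1 ≤ c) (hγ : 0 < γ) (n : ℕ) {f : ℝ → ℝ≥0∞}
    (hf : Measurable f) :
    ∫⁻ t, f t.streamLength ∂ramOfOrder (tokunaga c) (tokunagaRate c γ) (n + 1) =
      ∫⁻ x, f x ∂expMeasure (tokunagaRate c γ (n + 1)) := by
  cases n with
  | zero =>
    have hm : Measurable fun t : StreamTree => f t.streamLength :=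
      hf.comp StreamTree.measurable_streamLength
    rw [zero_add, ramOfOrder, lintegral_map hm StreamTree.measurable_leaf]
    simp [StreamTree.streamLength]
  | succ n => exact lintegral_streamLength_add_two (tokunagaRate_pos hc hγ) n hf

end Tokunaga

/-! ### Symmetric integrals over a cube, decomposed by the smallest coordinate. -/

section OrderStatistics

/-- Integration over an `n`-tuple of points of the interval `[s, ℓ]`. -/
noncomputable def cubeIntegral (n : ℕ) (s ℓ : ℝ) (F : List ℝ → ℝ≥0∞) : ℝ≥0∞ :=
  ∫⁻ v : Fin n → ℝ, F (List.ofFn v) ∂(Measure.pi fun _ => volume.restrict (Icc s ℓ))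

theorem measurable_cubeIntegral {Ω : Type} [MeasurableSpace Ω] {H : Ω → List ℝ → ℝ≥0∞}
    (hH : StreamTree.ListMeasurable H) (n : ℕ) {s ℓ : Ω → ℝ} (hs : Measurable s)
    (hℓ : Measurable ℓ) : Measurable fun ω => cubeIntegral n (s ω) (ℓ ω) (H ω) := by
  have h2 (ω : Ω) : MeasurableSet (univ.pi fun _ : Fin n => Icc (s ω) (ℓ ω)) :=
    MeasurableSet.univ_pi fun _ => measurableSet_Icc
  simp only [cubeIntegral, ← Measure.restrict_pi_pi, ← lintegral_indicator (h2 _)]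
  have h3 : MeasurableSet {p : Ω × (Fin n → ℝ) |
      p.2 ∈ univ.pi fun _ : Fin n => Icc (s p.1) (ℓ p.1)} := by
    simp only [mem_univ_pi, mem_Icc, ofPred_forall, ofPred_and]
    refine MeasurableSet.iInter fun i => (measurableSet_le ?_ ?_).inter (measurableSet_le ?_ ?_)
    all_goals fun_prop
  exact ((hH n).indicator h3).lintegral_prod_right'

theorem volume_eval_eq_eval {n : ℕ} {i j : Fin n} (hij : i ≠ j) :
    volume {v : Fin n → ℝ | v i = v j} = 0 := by
  let S : Submodule ℝ (Fin n → ℝ) :=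
    LinearMap.ker ((LinearMap.proj i : (Fin n → ℝ) →ₗ[ℝ] ℝ) - LinearMap.proj j)
  have h : ({v : Fin n → ℝ | v i = v j} : Set (Fin n → ℝ)) = S := by
    ext v
    simp [S, sub_eq_zero]
  rw [h]
  refine Measure.addHaar_submodule _ _ fun htop => ?_
  have : Pi.single i (1 : ℝ) ∈ S := htop ▸ Submodule.mem_top
  simp [S, Pi.single_eq_of_ne hij.symm] at this

theorem ae_injective_pi_restrict (n : ℕ) (s ℓ : ℝ) :
    ∀ᵐ v : Fin n → ℝ ∂(Measure.pi fun _ => volume.restrict (Icc s ℓ)), Function.Injective v := by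
  rw [← Measure.restrict_pi_pi]
  refine ae_restrict_of_ae ?_
  have : ∀ᵐ v : Fin n → ℝ, ∀ i j, i ≠ j → v i ≠ v j := by
    refine ae_all_iff.2 fun i => ae_all_iff.2 fun j => ?_
    by_cases hij : i = j
    · simp [hij]
    · have := volume_eval_eq_eval hij
      rw [ae_iff]
      simpa [hij] using this
  filter_upwards [this] with v hv i j hij
  by_contra hne
  exact hv i j hne hij

theorem sum_indicator_min {n : ℕ} {v : Fin (n + 1) → ℝ} (hv : Function.Injective v) (a : ℝ≥0∞) :
    ∑ j, {w : Fin (n + 1) → ℝ | ∀ i, w j ≤ w i}.indicator (fun _ => a) v = a := by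
  obtain ⟨j, hj⟩ := Finite.exists_min v
  rw [Finset.sum_eq_single j]
  · exact indicator_of_mem (s := {w : Fin (n + 1) → ℝ | ∀ i, w j ≤ w i}) hj _
  · intro k _ hk
    refine indicator_of_notMem (fun hk' => hk ?_) _
    exact hv (le_antisymm (hk' j) (hj k))
  · simp

theorem ofFn_insertNth_perm {X : Type*} {n : ℕ} (j : Fin (n + 1)) (x : X) (w : Fin n → X) :
    (List.ofFn (j.insertNth x w : Fin (n + 1) → X)).Perm (x :: List.ofFn w) := by
  rw [← Multiset.coe_eq_coe, ← Multiset.cons_coe, ← Fin.univ_val_map, ← Fin.univ_val_map,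
    Fin.univ_succAbove n j]
  simp [Function.comp_def]

/-- A symmetric integral over the cube, decomposed according to the smallest coordinate. -/
theorem cubeIntegral_succ {n : ℕ} {s ℓ : ℝ} {F : List ℝ → ℝ≥0∞}
    (hF : ∀ n : ℕ, Measurable fun v : Fin n → ℝ => F (List.ofFn v))
    (hperm : ∀ l l', List.Perm l l' → F l = F l') :
    cubeIntegral (n + 1) s ℓ F =
      (n + 1) * ∫⁻ x in Icc s ℓ, cubeIntegral n x ℓ fun l => F (x :: l) := by
  set μ : Measure ℝ := volume.restrict (Icc s ℓ) with hμ
  set A : Fin (n + 1) → Set (Fin (n + 1) → ℝ) := fun j => {w | ∀ i, w j ≤ w i} with hA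
  have hAm (j : Fin (n + 1)) : MeasurableSet (A j) := by
    simp only [hA, ofPred_forall]
    exact MeasurableSet.iInter fun i => measurableSet_le (by fun_prop) (by fun_prop)
  -- Coordinates are almost surely distinct, so exactly one of them is minimal. By symmetry all n +
  -- 1 cases have the same integral.
  have h1 : cubeIntegral (n + 1) s ℓ F = ∑ j, ∫⁻ v : Fin (n + 1) → ℝ,
      (A j).indicator (fun v => F (List.ofFn v)) v ∂(Measure.pi fun _ => μ) := by
    rw [← lintegral_finsetSum _ fun j _ => (hF _).indicator (hAm j), cubeIntegral]
    refine lintegral_congr_ae ?_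
    filter_upwards [ae_injective_pi_restrict (n + 1) s ℓ] with v hv
    exact (sum_indicator_min hv (F (List.ofFn v))).symm
  have h2 (j : Fin (n + 1)) : ∫⁻ v : Fin (n + 1) → ℝ,
      (A j).indicator (fun v => F (List.ofFn v)) v ∂(Measure.pi fun _ => μ) =
      ∫⁻ x in Icc s ℓ, cubeIntegral n x ℓ fun l => F (x :: l) := by
    have h3 := (measurePreserving_piFinSuccAbove (fun _ : Fin (n + 1) => μ) j).symm
    have h7 : Measurable fun p => (A j).indicator (fun v => F (List.ofFn v))
        ((MeasurableEquiv.piFinSuccAbove (fun _ => ℝ) j).symm p) :=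
      ((hF _).indicator (hAm j)).comp h3.measurable
    rw [← h3.lintegral_comp ((hF _).indicator (hAm j)), lintegral_prod _ h7.aemeasurable]
    refine setLIntegral_congr_fun measurableSet_Icc fun x hx => ?_
    -- With coordinate `j` fixed at `x`, minimality confines the others to `Ici x`, hence to `Icc x
    -- ℓ`.
    have h4 (w : Fin n → ℝ) : (A j).indicator (fun v => F (List.ofFn v))
        ((MeasurableEquiv.piFinSuccAbove (fun _ => ℝ) j).symm (x, w)) =
        (univ.pi fun _ : Fin n => Ici x).indicator (fun w => F (x :: List.ofFn w)) w := by
      have h5 : (MeasurableEquiv.piFinSuccAbove (fun _ => ℝ) j).symm (x, w) =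
        (j.insertNth x w : Fin (n + 1) → ℝ) := rfl
      have h6 : (j.insertNth x w : Fin (n + 1) → ℝ) ∈ A j ↔
          w ∈ univ.pi fun _ : Fin n => Ici x := by
        simp [hA, Fin.forall_iff_succAbove j, Pi.le_def]
      rw [h5]
      by_cases hw : w ∈ univ.pi fun _ : Fin n => Ici x
      · rw [indicator_of_mem (h6.2 hw), indicator_of_mem hw]
        exact hperm _ _ (ofFn_insertNth_perm j x w)
      · rw [indicator_of_notMem (fun h => hw (h6.1 h)), indicator_of_notMem hw]
    simp only [h4]
    rw [lintegral_indicator (MeasurableSet.univ_pi fun _ => measurableSet_Ici),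
      Measure.restrict_pi_pi, cubeIntegral]
    congr 2
    funext _
    rw [hμ, Measure.restrict_restrict measurableSet_Ici]
    congr 1
    ext y
    simp only [mem_inter_iff, mem_Ici, mem_Icc]
    constructor
    · rintro ⟨h, _, h'⟩; exact ⟨h, h'⟩
    · rintro ⟨h, h'⟩; exact ⟨h, hx.1.trans h, h'⟩
  rw [h1, Finset.sum_congr rfl fun j _ => h2 j]
  simp [hμ]

end OrderStatistics

/-! ### Integrals of a sum over the gaps between random points. -/

section GapSum

open StreamTree

theorem cubeIntegral_const (n : ℕ) (s ℓ : ℝ) (a : ℝ≥0∞) :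
    cubeIntegral n s ℓ (fun _ => a) = a * ENNReal.ofReal (ℓ - s) ^ n := by
  simp [cubeIntegral, Measure.pi_univ]

variable {f : ℝ → ℝ≥0∞}

/-- The sum of `f` over the gaps left in `[s, ℓ]` by `n` points, integrated over these points. -/
noncomputable def gapIntegral (f : ℝ → ℝ≥0∞) (n : ℕ) (s ℓ : ℝ) : ℝ≥0∞ :=
  cubeIntegral n s ℓ fun l => gapSum f ℓ s (l.insertionSort (· ≤ ·))

theorem measurable_gapIntegral (hf : Measurable f) (n : ℕ) :
    Measurable fun p : ℝ × ℝ => gapIntegral f n p.1 p.2 :=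
  measurable_cubeIntegral ((listMeasurable_gapSum_sort hf).comp measurable_swap) n
    measurable_fst measurable_snd

theorem gapIntegral_zero (s ℓ : ℝ) : gapIntegral f 0 s ℓ = f (ℓ - s) := by
  simp [gapIntegral, cubeIntegral, gapSum]

/-- If `x` is the smallest point, the first gap is x - s and the other n points form a configuration
of the same kind in `[x, ℓ]`. -/
theorem gapIntegral_succ (hf : Measurable f) (n : ℕ) (s ℓ : ℝ) :
    gapIntegral f (n + 1) s ℓ = (n + 1) * ∫⁻ x in Icc s ℓ,
      (f (x - s) * ENNReal.ofReal (ℓ - x) ^ n + gapIntegral f n x ℓ) := by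
  have hm (n : ℕ) : Measurable fun v : Fin n → ℝ =>
      gapSum f ℓ s ((List.ofFn v).insertionSort (· ≤ ·)) :=
    (listMeasurable_gapSum_sort hf n).comp (measurable_prodMk_left (x := (ℓ, s)))
  rw [gapIntegral, cubeIntegral_succ hm]
  · congr 1
    refine lintegral_congr fun x => ?_
    rw [← cubeIntegral_const, gapIntegral, cubeIntegral, cubeIntegral, cubeIntegral,
      ← lintegral_add_left measurable_const]
    refine lintegral_congr_ae ?_
    have : ∀ᵐ v : Fin n → ℝ ∂(Measure.pi fun _ => volume.restrict (Icc x ℓ)),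
        ∀ i, v i ∈ Icc x ℓ :=
      ae_all_iff.2 fun i => Measure.tendsto_eval_ae_ae.eventually
        (ae_restrict_mem measurableSet_Icc)
    filter_upwards [this] with v hv
    rw [List.insertionSort_cons_of_forall_rel, gapSum]
    intro y hy
    obtain ⟨i, rfl⟩ := (List.mem_ofFn' v y).1 hy
    exact (hv i).1
  · intro l l' hl
    congr 1
    exact ((List.perm_insertionSort _ l).trans (hl.trans (List.perm_insertionSort _ l').symm)).eq_of_pairwise'
      (List.pairwise_insertionSort _ l) (List.pairwise_insertionSort _ l')

theorem setLIntegral_Ici_sub (s : ℝ) (g : ℝ → ℝ≥0∞) :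
    ∫⁻ x in Ici s, g (x - s) = ∫⁻ x in Ici 0, g x := by
  rw [← lintegral_indicator measurableSet_Ici, ← lintegral_indicator measurableSet_Ici,
    ← lintegral_sub_right_eq_self ((Ici 0).indicator g) s]
  refine lintegral_congr fun x => ?_
  by_cases hx : s ≤ x <;> simp [indicator, hx]

/-- Tonelli's theorem on the region s ≤ x ≤ ℓ. -/
theorem lintegral_Ici_lintegral_Icc (s : ℝ) {g : ℝ → ℝ → ℝ≥0∞}
    (hg : Measurable (Function.uncurry g)) :
    ∫⁻ ℓ in Ici s, ∫⁻ x in Icc s ℓ, g x ℓ = ∫⁻ x in Ici s, ∫⁻ ℓ in Ici x, g x ℓ := by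
  have hS : MeasurableSet {p : ℝ × ℝ | s ≤ p.1 ∧ p.1 ≤ p.2} := by
    rw [ofPred_and]
    exact (measurableSet_le (by fun_prop) (by fun_prop)).inter
      (measurableSet_le (by fun_prop) (by fun_prop))
  have hm : Measurable ({p : ℝ × ℝ | s ≤ p.1 ∧ p.1 ≤ p.2}.indicator (Function.uncurry g)) :=
    hg.indicator hS
  have e1 : ∫⁻ ℓ in Ici s, ∫⁻ x in Icc s ℓ, g x ℓ = ∫⁻ ℓ, ∫⁻ x,
      {p : ℝ × ℝ | s ≤ p.1 ∧ p.1 ≤ p.2}.indicator (Function.uncurry g) (x, ℓ) := by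
    rw [← lintegral_indicator measurableSet_Ici]
    refine lintegral_congr fun ℓ => ?_
    by_cases hℓ : s ≤ ℓ
    · rw [indicator_of_mem (mem_Ici.2 hℓ), ← lintegral_indicator measurableSet_Icc]
      exact lintegral_congr fun x => rfl
    · rw [indicator_of_notMem (by simpa using hℓ)]
      refine (lintegral_zero.symm.trans (lintegral_congr fun x => ?_))
      rw [indicator_of_notMem]
      exact fun h => hℓ (h.1.trans h.2)
  have e2 : ∫⁻ x in Ici s, ∫⁻ ℓ in Ici x, g x ℓ = ∫⁻ x, ∫⁻ ℓ,
      {p : ℝ × ℝ | s ≤ p.1 ∧ p.1 ≤ p.2}.indicator (Function.uncurry g) (x, ℓ) := by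
    rw [← lintegral_indicator measurableSet_Ici]
    refine lintegral_congr fun x => ?_
    by_cases hx : s ≤ x
    · rw [indicator_of_mem (mem_Ici.2 hx), ← lintegral_indicator measurableSet_Ici]
      refine lintegral_congr fun ℓ => ?_
      by_cases hℓ : x ≤ ℓ <;> simp [indicator, hx, hℓ]
    · rw [indicator_of_notMem (by simpa using hx)]
      refine (lintegral_zero.symm.trans (lintegral_congr fun ℓ => ?_))
      rw [indicator_of_notMem]
      exact fun h => hx h.1
  rw [e1, e2, lintegral_lintegral_swap]
  exact (hm.comp measurable_swap).aemeasurable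

theorem lintegral_exp_mul_pow {κ : ℝ} (hκ : 0 < κ) (n : ℕ) :
    ∫⁻ x in Ici 0, ENNReal.ofReal (Real.exp (-(κ * x))) * ENNReal.ofReal x ^ n =
      ENNReal.ofReal (n.factorial / κ ^ (n + 1)) := by
  have h := lintegral_pow_expMeasure hκ n
  rw [lintegral_expMeasure _ _ (by fun_prop)] at h
  simp only [ENNReal.ofReal_mul hκ.le, mul_assoc] at h
  rw [lintegral_const_mul _ (by fun_prop)] at h
  rw [pow_succ, ← div_div, ENNReal.ofReal_div_of_pos hκ, ← h,
    ENNReal.mul_div_right_comm, ENNReal.div_self (by simpa using hκ) ENNReal.ofReal_ne_top, one_mul]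

/-- In gap coordinates the exponential weight is a product over the n + 1 gaps. There are n!
orderings and n + 1 choices of the gap that carries `f`, and each other gap integrates to 1/κ. -/
theorem lintegral_exp_mul_gapIntegral (hf : Measurable f) {κ : ℝ} (hκ : 0 < κ) (n : ℕ) (s : ℝ) :
    ∫⁻ ℓ in Ici s, ENNReal.ofReal (Real.exp (-(κ * (ℓ - s)))) * gapIntegral f n s ℓ =
      ENNReal.ofReal ((n + 1).factorial / κ ^ n) *
        ∫⁻ x in Ici 0, ENNReal.ofReal (Real.exp (-(κ * x))) * f x := by
  induction n generalizing s with
  | zero =>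
    simp only [gapIntegral_zero]
    rw [setLIntegral_Ici_sub s fun x => ENNReal.ofReal (Real.exp (-(κ * x))) * f x]
    simp
  | succ n ih =>
    set a := ∫⁻ x in Ici 0, ENNReal.ofReal (Real.exp (-(κ * x))) * f x with ha
    have hJ := measurable_gapIntegral hf n
    -- The weight splits at the smallest point, so the inductive hypothesis applies with starting
    -- point `x`.
    have hexp (x ℓ : ℝ) : ENNReal.ofReal (Real.exp (-(κ * (ℓ - s)))) =
        ENNReal.ofReal (Real.exp (-(κ * (x - s)))) *
          ENNReal.ofReal (Real.exp (-(κ * (ℓ - x)))) := by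
      rw [← ENNReal.ofReal_mul (Real.exp_nonneg _), ← Real.exp_add]
      congr 2
      ring
    have h1 : ∀ ℓ, ENNReal.ofReal (Real.exp (-(κ * (ℓ - s)))) * gapIntegral f (n + 1) s ℓ =
        (n + 1) * ∫⁻ x in Icc s ℓ, ENNReal.ofReal (Real.exp (-(κ * (x - s)))) *
          (ENNReal.ofReal (Real.exp (-(κ * (ℓ - x)))) *
            (f (x - s) * ENNReal.ofReal (ℓ - x) ^ n + gapIntegral f n x ℓ)) := by
      intro ℓ
      have hJ' : Measurable fun x => gapIntegral f n x ℓ := hJ.comp measurable_prodMk_right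
      rw [gapIntegral_succ hf, mul_left_comm, ← lintegral_const_mul _ (by fun_prop)]
      congr 1
      refine lintegral_congr fun x => ?_
      rw [hexp x ℓ, mul_assoc]
    have h2 (x : ℝ) : ∫⁻ ℓ in Ici x, ENNReal.ofReal (Real.exp (-(κ * (x - s)))) *
          (ENNReal.ofReal (Real.exp (-(κ * (ℓ - x)))) *
            (f (x - s) * ENNReal.ofReal (ℓ - x) ^ n + gapIntegral f n x ℓ)) =
        ENNReal.ofReal (Real.exp (-(κ * (x - s)))) *
          (f (x - s) * ENNReal.ofReal (n.factorial / κ ^ (n + 1)) +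
            ENNReal.ofReal ((n + 1).factorial / κ ^ n) * a) := by
      have hJ' : Measurable fun ℓ => gapIntegral f n x ℓ := hJ.comp measurable_prodMk_left
      rw [lintegral_const_mul _ (by fun_prop)]
      simp only [mul_add]
      rw [lintegral_add_left (by fun_prop), ih x]
      simp only [mul_left_comm _ (f (x - s))]
      rw [lintegral_const_mul _ (by fun_prop), setLIntegral_Ici_sub x
        fun y => ENNReal.ofReal (Real.exp (-(κ * y))) * ENNReal.ofReal y ^ n,
        lintegral_exp_mul_pow hκ]
      ring
    simp only [h1]
    rw [lintegral_const_mul' _ _ (by finiteness), lintegral_Ici_lintegral_Icc s (by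
      refine Measurable.mul (by fun_prop) (Measurable.mul (by fun_prop)
        (Measurable.add (by fun_prop) hJ)))]
    simp only [h2]
    rw [setLIntegral_Ici_sub s fun x => ENNReal.ofReal (Real.exp (-(κ * x))) *
          (f x * ENNReal.ofReal (n.factorial / κ ^ (n + 1)) +
            ENNReal.ofReal ((n + 1).factorial / κ ^ n) * a)]
    simp only [mul_add, ← mul_assoc]
    have h3 := lintegral_exp_mul_pow hκ 0
    simp only [pow_zero, mul_one] at h3
    rw [lintegral_add_left (by fun_prop), lintegral_mul_const _ (by fun_prop),
      lintegral_mul_const _ (by fun_prop), lintegral_mul_const _ (by fun_prop), h3, ← ha,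
      mul_comm a, ← ENNReal.ofReal_mul (by positivity), ← add_mul, ← mul_assoc,
      ← Nat.cast_succ, ← ENNReal.ofReal_natCast,
      ← ENNReal.ofReal_add (by positivity) (by positivity), ← ENNReal.ofReal_mul (by positivity)]
    congr 2
    rw [Nat.factorial_succ (n + 1), Nat.factorial_succ n]
    push_cast
    field_simp
    simp
    ring

end GapSum

/-! ### The links of a stream and the mean of a sum over all links. -/

section LinkSum

open StreamTree

theorem pi_smul_const {X : Type*} [MeasurableSpace X] (μ : Measure X) [IsFiniteMeasure μ]
    {M : ℝ≥0∞} (hM : M ≠ ∞) (n : ℕ) :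
    Measure.pi (fun _ : Fin n => M • μ) = M ^ n • Measure.pi fun _ : Fin n => μ := by
  have : IsFiniteMeasure (M • μ) := Measure.smul_finite μ hM
  refine Measure.pi_eq fun s _ => ?_
  simp [Measure.pi_pi, Finset.prod_mul_distrib]

theorem listMeasurable_gapSum_positions {f : ℝ → ℝ≥0∞} (hf : Measurable f) :
    ListMeasurable fun (ℓ : ℝ) (l : List (ℝ × StreamTree)) =>
      gapSum f ℓ 0 ((l.map Prod.fst).insertionSort (· ≤ ·)) := by
  intro n
  have := (listMeasurable_gapSum_sort hf n).comp
    (f := fun p : ℝ × (Fin n → ℝ × StreamTree) => ((p.1, (0 : ℝ)), fun i => (p.2 i).1))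
    (by fun_prop)
  simpa only [List.map_ofFn, Function.comp_def] using this

variable (τ : Measure StreamTree) [IsFiniteMeasure τ] {f : ℝ → ℝ≥0∞}

/-- The gaps ignore the attached trees, so each tree coordinate integrates to the total mass of `τ`.
-/
theorem poissonExp_gapSum (hf : Measurable f) {ℓ : ℝ} (hℓ : 0 ≤ ℓ) :
    poissonExp ((volume.restrict (Icc 0 ℓ)).prod τ)
        (fun l => gapSum f ℓ 0 ((l.map Prod.fst).insertionSort (· ≤ ·))) =
      ∑' n : ℕ, ENNReal.ofReal (Real.exp (-(ℓ * τ.real univ)) / n.factorial) *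
        (ENNReal.ofReal (τ.real univ) ^ n * gapIntegral f n 0 ℓ) := by
  refine tsum_congr fun n => ?_
  have h1 : ((volume.restrict (Icc 0 ℓ)).prod τ).real univ = ℓ * τ.real univ := by
    rw [← univ_prod_univ, measureReal_prod_prod]
    simp [Real.volume_real_Icc, hℓ]
  rw [h1]
  congr 1
  have h2 : (Measure.pi fun _ : Fin n => (volume.restrict (Icc 0 ℓ)).prod τ).map
      (fun v i => (v i).1) =
      ENNReal.ofReal (τ.real univ) ^ n • Measure.pi fun _ => volume.restrict (Icc 0 ℓ) := by
    rw [ofReal_measureReal, ← pi_smul_const _ (measure_ne_top τ univ),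
      Measure.pi_map_pi (f := fun _ => Prod.fst) fun i => measurable_fst.aemeasurable]
    simp only [Measure.map_fst_prod]
  have h3 : Measurable fun v : Fin n → ℝ =>
      gapSum f ℓ 0 ((List.ofFn v).insertionSort (· ≤ ·)) :=
    (listMeasurable_gapSum_sort hf n).comp (measurable_prodMk_left (x := (ℓ, (0 : ℝ))))
  have h4 := lintegral_map h3
    (by fun_prop : Measurable fun (v : Fin n → ℝ × StreamTree) (i : Fin n) => (v i).1)
    (μ := Measure.pi fun _ : Fin n => (volume.restrict (Icc 0 ℓ)).prod τ)
  rw [h2, lintegral_smul_measure] at h4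
  simp only [List.map_ofFn, Function.comp_def]
  exact h4.symm

theorem tsum_succ_mul_pow {r : ℝ} (hr0 : 0 ≤ r) (hr1 : r < 1) :
    ∑' n : ℕ, ENNReal.ofReal ((n + 1) * r ^ n) = ENNReal.ofReal (1 / (1 - r) ^ 2) := by
  have h := hasSum_choose_mul_geometric_of_norm_lt_one 1
    (by rwa [Real.norm_of_nonneg hr0] : ‖r‖ < 1)
  simp only [Nat.choose_one_right, Nat.reduceAdd, Nat.cast_add, Nat.cast_one] at h
  rw [← h.tsum_eq, ENNReal.ofReal_tsum_of_nonneg (fun n => by positivity) h.summable]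

/-- The sum of `f` over the links of a stream: the links have the exponential law with rate
`r + τ univ`, and their mean number is `(r + τ univ) / r`. -/
theorem lintegral_poissonExp_gapSum (hf : Measurable f) {r : ℝ} (hr : 0 < r) :
    ∫⁻ ℓ, poissonExp ((volume.restrict (Icc 0 ℓ)).prod τ)
        (fun l => gapSum f ℓ 0 ((l.map Prod.fst).insertionSort (· ≤ ·))) ∂expMeasure r =
      ENNReal.ofReal ((r + τ.real univ) / r) * ∫⁻ x, f x ∂expMeasure (r + τ.real univ) := by
  set ρ := τ.real univ with hρ
  have hρ0 : 0 ≤ ρ := measureReal_nonneg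
  set κ := r + ρ with hκ
  have hκ0 : 0 < κ := by linarith
  have hm : Measurable fun ℓ : ℝ => poissonExp ((volume.restrict (Icc 0 ℓ)).prod τ)
        (fun l => gapSum f ℓ 0 ((l.map Prod.fst).insertionSort (· ≤ ·))) :=
    measurable_poissonExp τ (listMeasurable_gapSum_positions hf) measurable_id
  have hJ (n : ℕ) : Measurable fun ℓ => gapIntegral f n 0 ℓ :=
    (measurable_gapIntegral hf n).comp measurable_prodMk_left
  -- The exponential density and the normalization of the Poisson weights combine to the rate κ = r
  -- + ρ.
  have h1 : ∫⁻ ℓ, poissonExp ((volume.restrict (Icc 0 ℓ)).prod τ)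
        (fun l => gapSum f ℓ 0 ((l.map Prod.fst).insertionSort (· ≤ ·))) ∂expMeasure r =
      ∫⁻ ℓ in Ici 0, ∑' n : ℕ, ENNReal.ofReal (r * ρ ^ n / n.factorial) *
        (ENNReal.ofReal (Real.exp (-(κ * (ℓ - 0)))) * gapIntegral f n 0 ℓ) := by
    rw [lintegral_expMeasure _ _ hm]
    refine setLIntegral_congr_fun measurableSet_Ici fun ℓ hℓ => ?_
    rw [poissonExp_gapSum τ hf hℓ, ← ENNReal.tsum_mul_left]
    refine tsum_congr fun n => ?_
    rw [← mul_assoc, ← mul_assoc, ← mul_assoc, ← ENNReal.ofReal_mul (by positivity),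
      ← ENNReal.ofReal_pow hρ0, ← ENNReal.ofReal_mul (by positivity),
      ← ENNReal.ofReal_mul (by positivity)]
    congr 2
    rw [sub_zero, hκ, show -((r + ρ) * ℓ) = -(r * ℓ) + -(ℓ * ρ) by ring, Real.exp_add]
    ring
  rw [h1, lintegral_tsum fun n => by fun_prop]
  -- The n-th term is the case of n + 1 links; ρ/κ is the probability that a link ends at an
  -- attachment.
  have h2 (n : ℕ) : ∫⁻ ℓ in Ici 0, ENNReal.ofReal (r * ρ ^ n / n.factorial) *
        (ENNReal.ofReal (Real.exp (-(κ * (ℓ - 0)))) * gapIntegral f n 0 ℓ) =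
      ENNReal.ofReal ((n + 1) * (ρ / κ) ^ n) *
        (ENNReal.ofReal r * ∫⁻ x in Ici 0, ENNReal.ofReal (Real.exp (-(κ * x))) * f x) := by
    rw [lintegral_const_mul _ (by fun_prop), lintegral_exp_mul_gapIntegral hf hκ0, ← mul_assoc,
      ← mul_assoc, ← ENNReal.ofReal_mul (by positivity), ← ENNReal.ofReal_mul (by positivity)]
    congr 2
    rw [Nat.factorial_succ, div_pow]
    push_cast
    field_simp
  have h3 : 1 - ρ / κ = r / κ := by
    rw [hκ]
    field_simp
    ring
  simp only [h2]
  rw [ENNReal.tsum_mul_right, tsum_succ_mul_pow (by positivity) ((div_lt_one hκ0).2 (by linarith)),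
    lintegral_expMeasure _ _ hf]
  simp only [ENNReal.ofReal_mul hκ0.le, mul_assoc]
  rw [lintegral_const_mul _ (by fun_prop), ← mul_assoc, ← mul_assoc,
    ← ENNReal.ofReal_mul (by positivity), ← ENNReal.ofReal_mul (by positivity), h3]
  congr 2
  field_simp

variable {c γ : ℝ}

/-- The rate of a stream decays as fast as 1 + ∑ T_i grows, so links have rate γ at every order. -/
theorem sideMeasure_real_univ (hc : 1 ≤ c) (hγ : 0 < γ) (K : ℕ) :
    tokunagaRate c γ (K + 2) +
      (sideMeasure (tokunaga c) (tokunagaRate c γ) K).real univ = γ := by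
  have hlam := tokunagaRate_pos hc hγ
  have hp (j : ℕ) := isProbabilityMeasure_ramOfOrder (T := tokunaga c) hlam j
  have hT (j : ℕ) := mul_nonneg (hlam (K + 2)).le (tokunaga_nonneg hc j)
  have h1 : (sideMeasure (tokunaga c) (tokunagaRate c γ) K).real univ =
      tokunagaRate c γ (K + 2) * ∑ j ∈ Finset.range (K + 1), tokunaga c (K + 1 - j) := by
    rw [measureReal_def, ← lintegral_one, lintegral_sideMeasure]
    simp only [lintegral_one, measure_univ, mul_one]
    rw [← ENNReal.ofReal_sum_of_nonneg fun j _ => hT _,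
      ENNReal.toReal_ofReal (Finset.sum_nonneg fun j _ => hT _), Finset.mul_sum, Finset.sum_range]
    refine Finset.sum_congr rfl fun j _ => ?_
    rw [show K + 2 - ((j : ℕ) + 1) = K + 1 - j by omega]
  have h2 := one_add_sum_tokunaga (c := c) (K + 1)
  rw [h1, ← mul_one_add, h2, tokunagaRate_succ, div_mul_cancel₀]
  positivity

theorem lintegral_linkSum_tokunaga (hc : 1 ≤ c) (hγ : 0 < γ) (n : ℕ) (hf : Measurable f) :
    ∫⁻ t, t.linkSum f ∂ramOfOrder (tokunaga c) (tokunagaRate c γ) (n + 1) =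
      ENNReal.ofReal (linkMean c n) * ∫⁻ x, f x ∂expMeasure γ := by
  have hlam := tokunagaRate_pos hc hγ
  have hc0 : 0 < c := by linarith
  refine eq_of_tokunaga_recursion (T := tokunaga c) (b := fun n => c ^ (n + 1)) (x := linkMean c)
    (e := fun n => ∫⁻ t, t.linkSum f ∂ramOfOrder (tokunaga c) (tokunagaRate c γ) (n + 1))
    (fun n => by positivity) (fun n => Finset.sum_nonneg fun i _ => by positivity)
    (tokunaga_nonneg hc) linkMean_succ ?_ (fun n => ?_) n
  · rw [zero_add, ramOfOrder, lintegral_map (measurable_linkSum hf) measurable_leaf]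
    simp [linkSum, linkMean, tokunagaRate]
  · have := isFiniteMeasure_sideMeasure (T := tokunaga c) hlam n
    rw [lintegral_linkSum_add_two hlam n hf]
    simp only [sideIntensity]
    rw [lintegral_poissonExp_gapSum _ hf (hlam _), sideMeasure_real_univ hc hγ]
    congr 3
    rw [tokunagaRate_succ]
    field_simp

end LinkSum

/-! ### Upper bounds for the moments of the height. -/

section Height

open StreamTree

variable {T lam : ℕ → ℝ}

theorem lintegral_ramOfOrder_le_of_additive (hlam : ∀ k, 0 < lam k) (K : ℕ)
    {f h h' : StreamTree → ℝ≥0∞} (hf : Measurable f) (hh : Measurable h) (hh' : Measurable h')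
    {g : ℝ → ℝ≥0∞} (hg : Measurable g)
    (hadd : ∀ p l, IsAdmissible K p l → f (assemble p.1 p.2.1 p.2.2 l) ≤
      g p.1 + (h p.2.1 + h p.2.2 + (l.map fun x => h' x.2).sum)) :
    ∫⁻ t, f t ∂ramOfOrder T lam (K + 2) ≤
      ∫⁻ ℓ, g ℓ ∂expMeasure (lam (K + 2)) +
        (2 * ∫⁻ t, h t ∂ramOfOrder T lam (K + 1) +
          ∑ i : Fin (K + 1), ENNReal.ofReal (T (K + 2 - (i + 1))) *
            ∫⁻ t, h' t ∂ramOfOrder T lam (i + 1)) := by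
  rw [lintegral_ramOfOrder_add_two hlam K hf]
  refine (lintegral_poissonExp_mono hlam K hadd).trans ?_
  rw [lintegral_poissonExp_additive hlam K (listMeasurable_const hg) hh hh',
    lintegral_poissonExp_sideIntensity_const hlam]

/-- As the main stream has positive length, a negative height would force one in the left top tree,
so the null set persists by induction. -/
theorem ae_height_nonneg (hlam : ∀ k, 0 < lam k) (K : ℕ) :
    ∀ᵐ t ∂ramOfOrder T lam (K + 1), 0 ≤ t.height := by
  have hm : MeasurableSet {t : StreamTree | 0 ≤ t.height} :=
    measurableSet_le measurable_const measurable_height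
  induction K with
  | zero =>
    rw [zero_add, ramOfOrder, ae_map_iff measurable_leaf.aemeasurable hm]
    filter_upwards [ae_expMeasure_pos] with x hx
    exact hx.le
  | succ K ih =>
    have hi := measurable_one.indicator hm.compl (m := inferInstance) (β := ℝ≥0∞)
    have h0 : ∫⁻ t, {t : StreamTree | 0 ≤ t.height}ᶜ.indicator 1 t ∂ramOfOrder T lam (K + 1) =
        0 := by
      rw [lintegral_indicator_one hm.compl]
      exact ih
    have h1 := lintegral_ramOfOrder_le_of_additive (T := T) hlam K hi hi
      (measurable_const (a := 0)) (measurable_const (a := 0)) fun p l hpl => ?_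
    · rw [h0, lintegral_indicator_one hm.compl] at h1
      simp only [lintegral_zero, mul_zero, Finset.sum_const_zero, add_zero] at h1
      exact le_antisymm h1 bot_le
    · have h2 := ((height_assemble_le_iff p.1 p.2.1 p.2.2 l _).1 le_rfl).1
      by_cases h3 : assemble p.1 p.2.1 p.2.2 l ∈ {t : StreamTree | 0 ≤ t.height}
      · rw [indicator_of_notMem (by simpa using h3)]
        exact bot_le
      · have h4 : p.2.1 ∈ {t : StreamTree | 0 ≤ t.height}ᶜ := by
          simp only [mem_compl_iff, mem_ofPred_eq, not_le] at h3 ⊢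
          linarith [hpl.length_pos]
        rw [indicator_of_mem h4, indicator_of_mem (by exact h3), zero_add, add_assoc]
        exact le_self_add

/-- One of the two terms is enough, according to whether x ≤ εy. The coefficient of y^p can be made
close to 1, at the expense of that of x^p. -/
theorem add_pow_le_mul_pow_add_mul_pow {x y ε : ℝ} (hx : 0 ≤ x) (hy : 0 ≤ y) (hε : 0 < ε)
    (p : ℕ) : (x + y) ^ p ≤ (1 + 1 / ε) ^ p * x ^ p + (1 + ε) ^ p * y ^ p := by
  rw [← mul_pow, ← mul_pow]
  have h1 : 0 ≤ ((1 + 1 / ε) * x) ^ p := by positivity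
  have h2 : 0 ≤ ((1 + ε) * y) ^ p := by positivity
  rcases le_total x (ε * y) with h | h
  · have : (x + y) ^ p ≤ ((1 + ε) * y) ^ p :=
      pow_le_pow_left₀ (by positivity) (by linarith) p
    linarith
  · have hy' : y ≤ 1 / ε * x := by
      rw [one_div, inv_mul_eq_div, le_div_iff₀ hε]
      linarith
    have : (x + y) ^ p ≤ ((1 + 1 / ε) * x) ^ p :=
      pow_le_pow_left₀ (by positivity) (by linarith) p
    linarith

theorem exists_max_height (p : ℕ) (m : ℝ) (l : List (ℝ × StreamTree)) :
    ∃ y, m ≤ y ∧ (∀ x ∈ l, x.2.height ≤ y) ∧ ENNReal.ofReal y ^ p ≤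
      ENNReal.ofReal m ^ p + (l.map fun x => ENNReal.ofReal x.2.height ^ p).sum := by
  induction l with
  | nil => exact ⟨m, le_rfl, by simp, by simp⟩
  | cons x l ih =>
    obtain ⟨y, h1, h2, h3⟩ := ih
    refine ⟨max x.2.height y, h1.trans (le_max_right _ _), ?_, ?_⟩
    · rw [List.forall_mem_cons]
      exact ⟨le_max_left _ _, fun z hz => (h2 z hz).trans (le_max_right _ _)⟩
    · rw [List.map_cons, List.sum_cons, add_left_comm]
      rcases le_total x.2.height y with h | h
      · rw [max_eq_right h]
        exact h3.trans le_add_self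
      · rw [max_eq_left h]
        exact le_self_add

theorem height_pow_assemble_le {K : ℕ} {q : ℝ × StreamTree × StreamTree}
    {l : List (ℝ × StreamTree)} (hq : IsAdmissible K q l) {ε : ℝ} (hε : 0 < ε) (p : ℕ) :
    ENNReal.ofReal (assemble q.1 q.2.1 q.2.2 l).height ^ p ≤
      ENNReal.ofReal ((1 + 1 / ε) ^ p) * ENNReal.ofReal q.1 ^ p +
      (ENNReal.ofReal ((1 + ε) ^ p) * ENNReal.ofReal q.2.1.height ^ p +
        ENNReal.ofReal ((1 + ε) ^ p) * ENNReal.ofReal q.2.2.height ^ p +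
        (l.map fun x => ENNReal.ofReal ((1 + ε) ^ p) * ENNReal.ofReal x.2.height ^ p).sum) := by
  obtain ⟨y, h1, h2, h3⟩ := exists_max_height p (max q.2.1.height q.2.2.height) l
  have h4 : (assemble q.1 q.2.1 q.2.2 l).height ≤ q.1 + max y 0 := by
    rw [height_assemble_le_iff]
    refine ⟨?_, ?_, fun x hx => ?_⟩
    · linarith [le_max_left q.2.1.height q.2.2.height, le_max_left y 0]
    · linarith [le_max_right q.2.1.height q.2.2.height, le_max_left y 0]
    · linarith [h2 x hx, (hq.mem_Icc x hx).2, le_max_left y 0]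
  have h5 : ENNReal.ofReal (max q.2.1.height q.2.2.height) ^ p ≤
      ENNReal.ofReal q.2.1.height ^ p + ENNReal.ofReal q.2.2.height ^ p := by
    rcases le_total q.2.1.height q.2.2.height with h | h
    · rw [max_eq_right h]
      exact le_add_self
    · rw [max_eq_left h]
      exact le_self_add
  have h6 : ENNReal.ofReal (max y 0) = ENNReal.ofReal y := by
    rw [ENNReal.ofReal_max, ENNReal.ofReal_zero, max_eq_left zero_le]
  have h7 : (l.map fun x => ENNReal.ofReal ((1 + ε) ^ p) * ENNReal.ofReal x.2.height ^ p).sum =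
      ENNReal.ofReal ((1 + ε) ^ p) * (l.map fun x => ENNReal.ofReal x.2.height ^ p).sum :=
    List.sum_map_mul_left _ _ _
  rw [h7, ← mul_add, ← mul_add]
  have hℓ := hq.length_pos.le
  calc ENNReal.ofReal (assemble q.1 q.2.1 q.2.2 l).height ^ p
      ≤ ENNReal.ofReal (q.1 + max y 0) ^ p := by gcongr
    _ = ENNReal.ofReal ((q.1 + max y 0) ^ p) := (ENNReal.ofReal_pow (by positivity) p).symm
    _ ≤ ENNReal.ofReal ((1 + 1 / ε) ^ p * q.1 ^ p + (1 + ε) ^ p * max y 0 ^ p) := by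
        gcongr
        exact add_pow_le_mul_pow_add_mul_pow hℓ (le_max_right _ _) hε p
    _ = ENNReal.ofReal ((1 + 1 / ε) ^ p) * ENNReal.ofReal q.1 ^ p +
        ENNReal.ofReal ((1 + ε) ^ p) * ENNReal.ofReal y ^ p := by
        rw [ENNReal.ofReal_add (by positivity) (by positivity),
          ENNReal.ofReal_mul (by positivity), ENNReal.ofReal_mul (by positivity),
          ENNReal.ofReal_pow hℓ, ENNReal.ofReal_pow (le_max_right _ _), h6]
    _ ≤ _ := by
        gcongr
        exact h3.trans (by gcongr)

theorem lintegral_height_pow_add_two_le (hlam : ∀ k, 0 < lam k) (K : ℕ) {ε : ℝ} (hε : 0 < ε)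
    (p : ℕ) :
    ∫⁻ t, ENNReal.ofReal t.height ^ p ∂ramOfOrder T lam (K + 2) ≤
      ENNReal.ofReal ((1 + 1 / ε) ^ p * (p.factorial / lam (K + 2) ^ p)) +
      ENNReal.ofReal ((1 + ε) ^ p) *
        (2 * ∫⁻ t, ENNReal.ofReal t.height ^ p ∂ramOfOrder T lam (K + 1) +
          ∑ j : Fin (K + 1), ENNReal.ofReal (T (K + 2 - (j + 1))) *
            ∫⁻ t, ENNReal.ofReal t.height ^ p ∂ramOfOrder T lam (j + 1)) := by
  have hm : Measurable fun t : StreamTree => ENNReal.ofReal t.height ^ p :=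
    (measurable_height.ennreal_ofReal).pow_const p
  refine (lintegral_ramOfOrder_le_of_additive hlam K hm (hm.const_mul _) (hm.const_mul _)
    (g := fun x => ENNReal.ofReal ((1 + 1 / ε) ^ p) * ENNReal.ofReal x ^ p) (by fun_prop) fun q l hq => height_pow_assemble_le hq hε p).trans_eq ?_
  have h1 := lintegral_pow_expMeasure (hlam (K + 2)) p
  simp only [lintegral_const_mul _ hm]
  rw [lintegral_const_mul _ (by fun_prop), h1, ← ENNReal.ofReal_mul (by positivity), mul_add,
    Finset.mul_sum]
  simp only [mul_left_comm]

theorem lintegral_height_pow_one (p : ℕ) (hlam : ∀ k, 0 < lam k) :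
    ∫⁻ t, ENNReal.ofReal t.height ^ p ∂ramOfOrder T lam 1 =
      ENNReal.ofReal (p.factorial / lam 1 ^ p) := by
  have hm : Measurable fun t : StreamTree => ENNReal.ofReal t.height ^ p :=
    (measurable_height.ennreal_ofReal).pow_const p
  rw [ramOfOrder, lintegral_map hm measurable_leaf]
  exact lintegral_pow_expMeasure (hlam 1) p

/-- Finiteness alone, from the moment bound with p = 1 and ε = 1. It covers c = 1, where the uniform
bound is not available. -/
theorem lintegral_height_lt_top (hlam : ∀ k, 0 < lam k) (K : ℕ) :
    ∫⁻ t, ENNReal.ofReal t.height ∂ramOfOrder T lam (K + 1) < ∞ := by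
  induction K using Nat.strong_induction_on with
  | _ K ih =>
  cases K with
  | zero =>
    have := lintegral_height_pow_one (T := T) 1 hlam
    simp only [pow_one] at this
    rw [zero_add, this]
    exact ENNReal.ofReal_lt_top
  | succ K =>
    have := lintegral_height_pow_add_two_le (T := T) hlam K one_pos 1
    simp only [pow_one] at this
    refine this.trans_lt (ENNReal.add_lt_top.2 ⟨ENNReal.ofReal_lt_top,
      ENNReal.mul_lt_top ENNReal.ofReal_lt_top (ENNReal.add_lt_top.2
        ⟨ENNReal.mul_lt_top (by simp) (ih K (by omega)), ENNReal.sum_lt_top.2 fun j _ =>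
          ENNReal.mul_lt_top ENNReal.ofReal_lt_top (ih j (by omega))⟩)⟩)

variable {c γ : ℝ}

/-- Raising K multiplies the old sum by c and adds (c - 1) c^{(K+1)p}. Since c^2 ≤ c^p, the old part
is at most c^{(K+1)p}. -/
theorem sum_tokunaga_mul_pow_le (hc : 1 ≤ c) {p : ℕ} (hp : 2 ≤ p) (K : ℕ) :
    ∑ j ∈ Finset.range (K + 1), tokunaga c (K + 1 - j) * c ^ (j * p) ≤ c * c ^ (K * p) := by
  have hc0 : 0 < c := by linarith
  induction K with
  | zero => simp [tokunaga]
  | succ K ih =>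
    have h3 : ∑ j ∈ Finset.range (K + 1), tokunaga c (K + 1 + 1 - j) * c ^ (j * p) =
        c * ∑ j ∈ Finset.range (K + 1), tokunaga c (K + 1 - j) * c ^ (j * p) := by
      rw [Finset.mul_sum]
      refine Finset.sum_congr rfl fun j hj => ?_
      have hj' := Finset.mem_range.1 hj
      rw [tokunaga, tokunaga, show K + 1 + 1 - j - 1 = K + 1 - j - 1 + 1 by omega]
      ring
    have h4 : tokunaga c (K + 1 + 1 - (K + 1)) = c - 1 := by
      simp [tokunaga, show K + 1 + 1 - (K + 1) = 1 by omega]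
    rw [Finset.sum_range_succ, h3, h4]
    have h5 : c ^ 2 ≤ c ^ p := pow_le_pow_right₀ hc hp
    have h6 : c * (c * c ^ (K * p)) ≤ c ^ ((K + 1) * p) := by
      rw [show (K + 1) * p = p + K * p by ring, pow_add, ← mul_assoc, ← sq]
      gcongr
    nlinarith [mul_le_mul_of_nonneg_left ih hc0.le]

theorem exists_lintegral_height_pow_le (hc : 1 < c) (hγ : 0 < γ) :
    ∃ p : ℕ, ∃ D : ℝ, p ≠ 0 ∧ 0 ≤ D ∧ ∀ K : ℕ,
      ∫⁻ t, ENNReal.ofReal t.height ^ p ∂ramOfOrder (tokunaga c) (tokunagaRate c γ) (K + 1) ≤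
        ENNReal.ofReal (D * c ^ (K * p)) := by
  have hc0 : 0 < c := by linarith
  have hlam := tokunagaRate_pos hc.le hγ
  -- The two top trees and the side trees cost at most the factor 2 + c per order, while the target
  -- grows by c^p. The room left is used for ε.
  obtain ⟨p, hp⟩ : ∃ p : ℕ, 2 ≤ p ∧ 2 + c < c ^ p := by
    obtain ⟨n, hn⟩ := pow_unbounded_of_one_lt (2 + c) hc
    exact ⟨n + 2, by omega, hn.trans_le (pow_le_pow_right₀ hc.le (by omega))⟩
  obtain ⟨ε, hε, hε'⟩ : ∃ ε : ℝ, 0 < ε ∧ (1 + ε) ^ p * (2 + c) < c ^ p := by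
    have h1 : Tendsto (fun ε : ℝ => (1 + ε) ^ p * (2 + c)) (𝓝[>] 0) (𝓝 ((1 + 0) ^ p * (2 + c))) :=
      Continuous.tendsto (by fun_prop) 0 |>.mono_left nhdsWithin_le_nhds
    rw [add_zero, one_pow, one_mul] at h1
    obtain ⟨ε, h2, h3⟩ := ((h1.eventually_lt_const hp.2).and self_mem_nhdsWithin).exists
    exact ⟨ε, h3, h2⟩
  set q := (1 + ε) ^ p * (2 + c) / c ^ p with hq
  have hq1 : q < 1 := (div_lt_one (by positivity)).2 hε'
  have hq0 : 0 ≤ q := by positivity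
  set A := (1 + 1 / ε) ^ p * (p.factorial / γ ^ p) with hA
  have hA0 : 0 ≤ A := by positivity
  -- The constant is the fixed point of D ↦ A + qD, so the induction reproduces it exactly.
  have hD : A + q * (A / (1 - q)) = A / (1 - q) := by
    have : 1 - q ≠ 0 := by linarith
    field_simp
    ring
  have hD0 : 0 ≤ A / (1 - q) := div_nonneg hA0 (by linarith)
  set D := A / (1 - q)
  refine ⟨p, D, by omega, hD0, fun K => ?_⟩
  induction K using Nat.strong_induction_on with
  | _ K ih =>
  cases K with
  | zero =>
    rw [zero_add, lintegral_height_pow_one p hlam]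
    refine ENNReal.ofReal_le_ofReal ?_
    have h1 : (1 : ℝ) ≤ (1 + 1 / ε) ^ p := one_le_pow₀ (by simp [hε.le])
    have h2 : tokunagaRate c γ 1 = γ := by simp [tokunagaRate]
    rw [h2, zero_mul, pow_zero, mul_one]
    have h3 : (p.factorial : ℝ) / γ ^ p ≤ A := le_mul_of_one_le_left (by positivity) h1
    nlinarith [mul_nonneg hq0 hD0]
  | succ K =>
    refine (lintegral_height_pow_add_two_le hlam K hε p).trans ?_
    have h1 : 2 * ∫⁻ t, ENNReal.ofReal t.height ^ p
          ∂ramOfOrder (tokunaga c) (tokunagaRate c γ) (K + 1) +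
        ∑ j : Fin (K + 1), ENNReal.ofReal (tokunaga c (K + 2 - (j + 1))) *
          ∫⁻ t, ENNReal.ofReal t.height ^ p
            ∂ramOfOrder (tokunaga c) (tokunagaRate c γ) (j + 1) ≤
        ENNReal.ofReal (D * ((2 + c) * c ^ (K * p))) := by
      calc _ ≤ 2 * ENNReal.ofReal (D * c ^ (K * p)) +
            ∑ j : Fin (K + 1), ENNReal.ofReal (tokunaga c (K + 2 - (j + 1))) *
              ENNReal.ofReal (D * c ^ ((j : ℕ) * p)) := by
            gcongr with j
            · exact ih K (by omega)
            · exact ih j (by omega)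
        _ = ENNReal.ofReal (2 * (D * c ^ (K * p)) +
            ∑ j ∈ Finset.range (K + 1), D * (tokunaga c (K + 1 - j) * c ^ (j * p))) := by
            have h (j : ℕ) : 0 ≤ D * (tokunaga c (K + 1 - j) * c ^ (j * p)) :=
              mul_nonneg hD0 (mul_nonneg (tokunaga_nonneg hc.le _) (by positivity))
            rw [ENNReal.ofReal_add (by positivity) (Finset.sum_nonneg fun j _ => h j),
              ENNReal.ofReal_mul two_pos.le, ENNReal.ofReal_ofNat,
              ENNReal.ofReal_sum_of_nonneg fun j _ => h j, Finset.sum_range]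
            congr 1
            refine Finset.sum_congr rfl fun j _ => ?_
            rw [← ENNReal.ofReal_mul (tokunaga_nonneg hc.le _), mul_left_comm,
              show K + 2 - ((j : ℕ) + 1) = K + 1 - j by omega]
        _ ≤ _ := by
            rw [← Finset.mul_sum]
            refine ENNReal.ofReal_le_ofReal ?_
            nlinarith [mul_le_mul_of_nonneg_left (sum_tokunaga_mul_pow_le hc.le hp.1 K) hD0]
    refine (add_le_add le_rfl (mul_le_mul_right h1 _)).trans ?_
    have h2 : 0 ≤ (1 + 1 / ε) ^ p * (p.factorial / tokunagaRate c γ (K + 2) ^ p) :=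
      mul_nonneg (by positivity) (div_nonneg (by positivity) (pow_nonneg (hlam _).le _))
    rw [← ENNReal.ofReal_mul (by positivity), ← ENNReal.ofReal_add h2 (by positivity)]
    refine ENNReal.ofReal_le_ofReal (le_of_eq ?_)
    have h3 : c ^ ((K + 1) * p) = c ^ (K * p) * c ^ p := by rw [← pow_add]; ring_nf
    have h4 : (1 + 1 / ε) ^ p * (p.factorial / tokunagaRate c γ (K + 2) ^ p) =
        A * c ^ ((K + 1) * p) := by
      rw [tokunagaRate_succ, div_pow, ← pow_mul, hA]
      field_simp
    have h5 : (1 + ε) ^ p * (D * ((2 + c) * c ^ (K * p))) = q * D * c ^ ((K + 1) * p) := by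
      rw [h3, hq]
      field_simp
    rw [h4, h5, ← add_mul, hD]

theorem exists_lintegral_height_le (hc : 1 < c) (hγ : 0 < γ) :
    ∃ D : ℝ, 0 ≤ D ∧ ∀ K : ℕ,
      ∫⁻ t, ENNReal.ofReal t.height ∂ramOfOrder (tokunaga c) (tokunagaRate c γ) (K + 1) ≤
        ENNReal.ofReal (D * c ^ K) := by
  obtain ⟨p, D, hp, hD0, hD⟩ := exists_lintegral_height_pow_le hc hγ
  obtain ⟨p, rfl⟩ := Nat.exists_eq_succ_of_ne_zero hp
  have hc0 : 0 < c := by linarith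
  refine ⟨1 + D, by linarith, fun K => ?_⟩
  have hprob := isProbabilityMeasure_ramOfOrder (T := tokunaga c) (tokunagaRate_pos hc.le hγ) K
  have hs : (0 : ℝ) < c ^ K := by positivity
  -- With s = c^K, either h ≤ s or h ≤ h^{p+1}/s^p. Thus the bound for the moment of order p + 1
  -- gives the right scale for the mean.
  have h1 (h : ℝ) : ENNReal.ofReal h ≤ ENNReal.ofReal (c ^ K) +
      ENNReal.ofReal (1 / (c ^ K) ^ p) * ENNReal.ofReal h ^ (p + 1) := by
    rcases le_total h (c ^ K) with hh | hh
    · exact (ENNReal.ofReal_le_ofReal hh).trans le_self_add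
    · refine le_trans ?_ le_add_self
      have h0 : 0 ≤ h := hs.le.trans hh
      rw [← ENNReal.ofReal_pow h0, ← ENNReal.ofReal_mul (by positivity)]
      refine ENNReal.ofReal_le_ofReal ?_
      rw [one_div_mul_eq_div, le_div_iff₀ (by positivity), pow_succ, mul_comm]
      gcongr
  refine (lintegral_mono fun t : StreamTree => h1 t.height).trans ?_
  have hm : Measurable fun t : StreamTree => ENNReal.ofReal t.height ^ (p + 1) :=
    (measurable_height.ennreal_ofReal).pow_const _
  rw [lintegral_add_left measurable_const, lintegral_const_mul _ hm]
  simp only [lintegral_const, measure_univ, mul_one]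
  refine (add_le_add le_rfl (mul_le_mul_right (hD K) _)).trans ?_
  rw [← ENNReal.ofReal_mul (by positivity), ← ENNReal.ofReal_add (by positivity) (by positivity)]
  refine ENNReal.ofReal_le_ofReal (le_of_eq ?_)
  rw [Nat.succ_eq_add_one, mul_add_one K p, pow_add, pow_mul]
  field_simp

end Height

/-! ### Distribution of the height and its stochastic growth by the factor c. -/

section HeightLaw

open StreamTree

variable {T lam : ℕ → ℝ}

theorem measurableSet_height_le (y : ℝ) : MeasurableSet {t : StreamTree | t.height ≤ y} :=
  measurableSet_le measurable_height measurable_const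

theorem measurableSet_lt_height (y : ℝ) : MeasurableSet {t : StreamTree | y < t.height} :=
  measurableSet_lt measurable_const measurable_height

theorem poissonExp_const_mul {X : Type*} [MeasurableSpace X] (ν : Measure X) {a : ℝ≥0∞}
    (ha : a ≠ ∞) (H : List X → ℝ≥0∞) :
    poissonExp ν (fun l => a * H l) = a * poissonExp ν H := by
  simp only [poissonExp, lintegral_const_mul' _ _ ha, mul_left_comm _ a, ENNReal.tsum_mul_left]

theorem measurableSet_add_height_le (y : ℝ) :
    MeasurableSet {x : ℝ × StreamTree | x.1 + x.2.height ≤ y} :=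
  measurableSet_le (measurable_fst.add (measurable_height.comp measurable_snd)) measurable_const

/-- The distribution function of the height of a random tree. -/
theorem ramOfOrder_height_le (hlam : ∀ k, 0 < lam k) (K : ℕ) (y : ℝ) :
    ramOfOrder T lam (K + 2) {t | t.height ≤ y} =
      ∫⁻ ℓ, ramOfOrder T lam (K + 1) {t | t.height ≤ y - ℓ} ^ 2 *
        ENNReal.ofReal (Real.exp
          (-(sideIntensity T lam K ℓ).real {x | x.1 + x.2.height ≤ y}ᶜ))
        ∂expMeasure (lam (K + 2)) := by
  have := isFiniteMeasure_sideMeasure (T := T) hlam K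
  have hprob := isProbabilityMeasure_ramOfOrder (T := T) hlam K
  have := isProbabilityMeasure_expMeasure (hlam (K + 2))
  set S : Set (ℝ × StreamTree) := {x | x.1 + x.2.height ≤ y} with hS
  have hSm : MeasurableSet S := measurableSet_add_height_le y
  have hB := measurableSet_height_le y
  -- The event factors into one condition for each top tree and one for each side tree; the latter
  -- give a void probability.
  have h1 (p : ℝ × StreamTree × StreamTree) (l : List (ℝ × StreamTree)) :
      {t : StreamTree | t.height ≤ y}.indicator (1 : StreamTree → ℝ≥0∞)
        (assemble p.1 p.2.1 p.2.2 l) =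
      ({t : StreamTree | t.height ≤ y - p.1}.indicator 1 p.2.1 *
        {t : StreamTree | t.height ≤ y - p.1}.indicator 1 p.2.2) *
          (l.map (S.indicator 1)).prod := by
    classical
    rw [prod_map_indicator_one]
    simp only [indicator_apply, mem_ofPred_eq, height_assemble_le_iff, hS, Pi.one_apply,
      le_sub_iff_add_le']
    by_cases h2 : p.1 + p.2.1.height ≤ y <;> by_cases h3 : p.1 + p.2.2.height ≤ y <;>
      simp [h2, h3]
  have hind (z : ℝ) (t : StreamTree) :
      {t : StreamTree | t.height ≤ z}.indicator (1 : StreamTree → ℝ≥0∞) t ≠ ∞ := by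
    classical
    rw [indicator_apply]
    split_ifs <;> simp
  have h2 (p : ℝ × StreamTree × StreamTree) : poissonExp (sideIntensity T lam K p.1)
      (fun l => {t : StreamTree | t.height ≤ y}.indicator (1 : StreamTree → ℝ≥0∞)
        (assemble p.1 p.2.1 p.2.2 l)) =
      ({t : StreamTree | t.height ≤ y - p.1}.indicator 1 p.2.1 *
        {t : StreamTree | t.height ≤ y - p.1}.indicator 1 p.2.2) *
      ENNReal.ofReal (Real.exp (-(sideIntensity T lam K p.1).real Sᶜ)) := by
    have := isFiniteMeasure_sideIntensity (T := T) hlam K p.1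
    simp only [h1]
    rw [poissonExp_const_mul _ (ENNReal.mul_ne_top (hind _ _) (hind _ _)),
      poissonExp_prod_indicator _ hSm]
  have hm : Measurable fun p : ℝ × StreamTree × StreamTree =>
      poissonExp (sideIntensity T lam K p.1)
      (fun l => {t : StreamTree | t.height ≤ y}.indicator (1 : StreamTree → ℝ≥0∞)
        (assemble p.1 p.2.1 p.2.2 l)) :=
    measurable_poissonExp_of_assemble _ (measurable_one.indicator hB)
  rw [← lintegral_indicator_one hB,
    lintegral_ramOfOrder_add_two hlam K (measurable_one.indicator hB), trunkMeasure,
    lintegral_prod _ hm.aemeasurable]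
  refine lintegral_congr fun ℓ => ?_
  have hBℓ : Measurable ({t : StreamTree | t.height ≤ y - ℓ}.indicator (1 : StreamTree → ℝ≥0∞)) :=
    measurable_one.indicator (measurableSet_height_le _)
  rw [lintegral_congr fun q : StreamTree × StreamTree => h2 (ℓ, q)]
  dsimp only
  rw [lintegral_mul_const _ (by fun_prop),
    lintegral_prod_mul hBℓ.aemeasurable hBℓ.aemeasurable,
    lintegral_indicator_one (measurableSet_height_le _), sq]

theorem lintegral_comp_mul_left {c : ℝ} (hc : 0 < c) {g : ℝ → ℝ≥0∞} (hg : Measurable g) :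
    ∫⁻ x, g x = ENNReal.ofReal c * ∫⁻ x, g (c * x) := by
  rw [← lintegral_map hg (measurable_const_mul c), Real.map_volume_mul_left hc.ne',
    lintegral_smul_measure, abs_of_pos (inv_pos.2 hc), smul_eq_mul, ← mul_assoc,
    ← ENNReal.ofReal_mul hc.le, mul_inv_cancel₀ hc.ne', ENNReal.ofReal_one, one_mul]

theorem lintegral_expMeasure_div {r c : ℝ} (hr : 0 < r) (hc : 0 < c) {f : ℝ → ℝ≥0∞}
    (hf : Measurable f) :
    ∫⁻ x, f x ∂expMeasure (r / c) = ∫⁻ x, f (c * x) ∂expMeasure r := by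
  rw [lintegral_expMeasure _ _ hf, lintegral_expMeasure _ _ (by fun_prop),
    ← lintegral_indicator measurableSet_Ici, ← lintegral_indicator measurableSet_Ici,
    lintegral_comp_mul_left hc (Measurable.indicator (by fun_prop) measurableSet_Ici),
    ← lintegral_const_mul' _ _ ENNReal.ofReal_ne_top]
  refine lintegral_congr fun x => ?_
  by_cases hx : 0 ≤ x
  · rw [indicator_of_mem (mem_Ici.2 (mul_nonneg hc.le hx)), indicator_of_mem (mem_Ici.2 hx),
      ← mul_assoc, ← ENNReal.ofReal_mul hc.le]
    congr 2
    field_simp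
  · rw [indicator_of_notMem (by simpa [hc] using hx), indicator_of_notMem (by simpa using hx),
      mul_zero]

theorem sideIntensity_height (hlam : ∀ k, 0 < lam k) (K : ℕ) (ℓ y : ℝ) :
    sideIntensity T lam K ℓ {x | x.1 + x.2.height ≤ y}ᶜ =
      ∫⁻ x in Icc 0 ℓ, sideMeasure T lam K {t | y - x < t.height} := by
  have := isFiniteMeasure_sideMeasure (T := T) hlam K
  rw [sideIntensity, Measure.prod_apply (measurableSet_add_height_le y).compl]
  refine lintegral_congr fun x => ?_
  congr 1
  ext t
  simp [sub_lt_iff_lt_add']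

theorem measurable_sideMeasure_height (hlam : ∀ k, 0 < lam k) (K : ℕ) (y : ℝ) :
    Measurable fun x : ℝ => sideMeasure T lam K {t | y - x < t.height} := by
  have := isFiniteMeasure_sideMeasure (T := T) hlam K
  have h := measurable_measure_prodMk_left (ν := sideMeasure T lam K)
    (measurableSet_add_height_le y).compl
  convert h using 3 with x
  ext t
  simp [sub_lt_iff_lt_add']

variable {c γ : ℝ}

/-- Random trees of order `K + 2` are stochastically higher than `c` times random trees of
order `K + 1`. -/
theorem ramOfOrder_height_le_mul (hc : 1 ≤ c) (hγ : 0 < γ) (K : ℕ) (y : ℝ) :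
    ramOfOrder (tokunaga c) (tokunagaRate c γ) (K + 2) {t | t.height ≤ c * y} ≤
      ramOfOrder (tokunaga c) (tokunagaRate c γ) (K + 1) {t | t.height ≤ y} := by
  have hc0 : 0 < c := by linarith
  have hlam := tokunagaRate_pos hc hγ
  have hprob (j : ℕ) := isProbabilityMeasure_ramOfOrder (T := tokunaga c) hlam j
  -- A main stream is c times as long in law as one of the preceding order; this drives the
  -- rescaling below.
  have hrate (j : ℕ) : tokunagaRate c γ (j + 2) = tokunagaRate c γ (j + 1) / c := by
    rw [tokunagaRate_succ, tokunagaRate_succ, pow_succ, div_div]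
  have hm (j : ℕ) (z : ℝ) : Measurable fun ℓ : ℝ =>
      ramOfOrder (tokunaga c) (tokunagaRate c γ) (j + 1) {t | t.height ≤ z - ℓ} := by
    have hS : MeasurableSet {q : ℝ × StreamTree | q.2.height ≤ z - q.1} :=
      measurableSet_le (measurable_height.comp measurable_snd) (by fun_prop)
    exact measurable_measure_prodMk_left hS
  have hmν (j : ℕ) (z : ℝ) : Measurable fun ℓ : ℝ => ENNReal.ofReal (Real.exp
      (-(sideIntensity (tokunaga c) (tokunagaRate c γ) j ℓ).real
        {x | x.1 + x.2.height ≤ z}ᶜ)) := by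
    have := isFiniteMeasure_sideMeasure (T := tokunaga c) hlam j
    refine ENNReal.measurable_ofReal.comp (Real.measurable_exp.comp (Measurable.neg ?_))
    refine ENNReal.measurable_toReal.comp ?_
    have hS : MeasurableSet {q : ℝ × ℝ × StreamTree | q.2 ∈ Icc 0 q.1 ×ˢ univ ∩
        {x : ℝ × StreamTree | x.1 + x.2.height ≤ z}ᶜ} := by
      have h1 : MeasurableSet {q : ℝ × ℝ × StreamTree | 0 ≤ q.2.1 ∧ q.2.1 ≤ q.1} := by
        rw [ofPred_and]
        exact (measurableSet_le (by fun_prop) (by fun_prop)).inter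
          (measurableSet_le (by fun_prop) (by fun_prop))
      convert h1.inter (measurable_snd (measurableSet_add_height_le z).compl) using 1
      ext q
      simp
    have h := measurable_measure_prodMk_left (ν := (volume : Measure ℝ).prod
      (sideMeasure (tokunaga c) (tokunagaRate c γ) j)) hS
    convert h using 2 with ℓ
    have h3 : sideIntensity (tokunaga c) (tokunagaRate c γ) j ℓ =
        ((volume : Measure ℝ).prod (sideMeasure (tokunaga c) (tokunagaRate c γ) j)).restrict
          (Icc 0 ℓ ×ˢ univ) := by
      rw [← Measure.prod_restrict, Measure.restrict_univ, sideIntensity]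
    rw [h3, Measure.restrict_apply (measurableSet_add_height_le z).compl, inter_comm]
    rfl
  induction K using Nat.strong_induction_on generalizing y with
  | _ K ih =>
  have hmF (j : ℕ) (z : ℝ) : Measurable fun ℓ : ℝ =>
      ramOfOrder (tokunaga c) (tokunagaRate c γ) (j + 1) {t | t.height ≤ z - ℓ} ^ 2 *
        ENNReal.ofReal (Real.exp (-(sideIntensity (tokunaga c) (tokunagaRate c γ) j ℓ).real
          {x | x.1 + x.2.height ≤ z}ᶜ)) := ((hm j z).pow_const 2).mul (hmν j z)
  have hexp1 (a : ℝ≥0∞) {b : ℝ} (hb : 0 ≤ b) : a * ENNReal.ofReal (Real.exp (-b)) ≤ a :=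
    mul_le_of_le_one_right' (by simpa using hb)
  rw [ramOfOrder_height_le hlam, hrate, lintegral_expMeasure_div (hlam _) hc0 (hmF K _)]
  cases K with
  | zero =>
    have h1 (z : ℝ) : ramOfOrder (tokunaga c) (tokunagaRate c γ) (0 + 1) {t | t.height ≤ z} =
        expMeasure (tokunagaRate c γ (0 + 1)) (Iic z) := by
      rw [zero_add, ramOfOrder, Measure.map_apply measurable_leaf (measurableSet_height_le z)]
      rfl
    -- At the first step the side trees are ignored: the rescaled main stream cannot exceed `y`,
    -- because the top trees have positive height.
    rw [h1, ← lintegral_indicator_one measurableSet_Iic]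
    refine lintegral_mono fun ℓ => (hexp1 _ measureReal_nonneg).trans ?_
    by_cases hℓ : ℓ ≤ y
    · rw [indicator_of_mem (mem_Iic.2 hℓ)]
      exact pow_le_one₀ zero_le prob_le_one
    · have h0 : expMeasure (tokunagaRate c γ (0 + 1)) (Iic (c * y - c * ℓ)) = 0 := by
        refine measure_mono_null (fun x hx => ?_) ae_expMeasure_pos
        have : c * y < c * ℓ := by
          have := not_le.1 hℓ
          gcongr
        simp only [mem_compl_iff, mem_ofPred_eq, mem_Iic] at hx ⊢
        change ¬ 0 < x
        linarith
      rw [h1, h0]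
      simp
  | succ K =>
    rw [ramOfOrder_height_le hlam K y]
    have hpos : ∀ᵐ ℓ ∂expMeasure (tokunagaRate c γ (K + 2)), 0 < ℓ := ae_expMeasure_pos
    refine lintegral_mono_ae ?_
    filter_upwards [hpos] with ℓ hℓ
    -- The inductive hypothesis, passed to complements: a tree of the next order is more likely to
    -- exceed the rescaled level.
    have htail (i : ℕ) (hi : i ≤ K) (z : ℝ) :
        ramOfOrder (tokunaga c) (tokunagaRate c γ) (i + 1) {t | z < t.height} ≤
          ramOfOrder (tokunaga c) (tokunagaRate c γ) (i + 2) {t | c * z < t.height} := by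
      have h1 (w : ℝ) : {t : StreamTree | w < t.height} = {t : StreamTree | t.height ≤ w}ᶜ := by
        ext t; simp
      have := hprob i
      have := hprob (i + 1)
      rw [h1, h1, prob_compl_eq_one_sub (measurableSet_height_le _),
        prob_compl_eq_one_sub (measurableSet_height_le _)]
      exact tsub_le_tsub_left (ih i (by omega) z) 1
    -- Side trees of order i + 1 are matched with those of order i + 2 on a stream of the next
    -- order. The two Tokunaga indices agree, the rates differ by c, and the unmatched trees of
    -- order 1 are dropped.
    have hside (z : ℝ) : sideMeasure (tokunaga c) (tokunagaRate c γ) K {t | z < t.height} ≤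
        ENNReal.ofReal c *
          sideMeasure (tokunaga c) (tokunagaRate c γ) (K + 1) {t | c * z < t.height} := by
      rw [← lintegral_indicator_one (measurableSet_lt_height _),
        ← lintegral_indicator_one (measurableSet_lt_height _), lintegral_sideMeasure,
        lintegral_sideMeasure, Fin.sum_univ_succ (n := K + 1), mul_add, Finset.mul_sum]
      refine le_add_left (Finset.sum_le_sum fun i _ => ?_)
      rw [lintegral_indicator_one (measurableSet_lt_height _),
        lintegral_indicator_one (measurableSet_lt_height _), ← mul_assoc,
        ← ENNReal.ofReal_mul hc0.le]
      refine mul_le_mul' (le_of_eq ?_) (htail i (by omega) z)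
      congr 1
      rw [hrate (K + 1), Fin.val_succ, show K + 1 + 2 - ((i : ℕ) + 1 + 1) = K + 2 - (i + 1) by omega]
      field_simp
    refine mul_le_mul' ?_ (ENNReal.ofReal_le_ofReal (Real.exp_le_exp.2 (neg_le_neg ?_)))
    · rw [← mul_sub]
      exact pow_le_pow_left₀ zero_le (ih K (by omega) _) 2
    · have := isFiniteMeasure_sideIntensity (T := tokunaga c) hlam (K + 1) (c * ℓ)
      refine ENNReal.toReal_mono (measure_ne_top _ _) ?_
      rw [sideIntensity_height hlam, sideIntensity_height hlam,
        ← lintegral_indicator measurableSet_Icc, ← lintegral_indicator measurableSet_Icc,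
        lintegral_comp_mul_left hc0 ((measurable_sideMeasure_height hlam (K + 1) (c * y)).indicator
          measurableSet_Icc), ← lintegral_const_mul' _ _ ENNReal.ofReal_ne_top]
      refine lintegral_mono fun x => ?_
      by_cases hx : x ∈ Icc 0 ℓ
      · rw [indicator_of_mem hx, indicator_of_mem, ← mul_sub]
        · exact hside (y - x)
        · exact ⟨mul_nonneg hc0.le hx.1, mul_le_mul_of_nonneg_left hx.2 hc0.le⟩
      · rw [indicator_of_notMem hx]
        exact zero_le

/-- The layer-cake formula turns stochastic domination into an inequality of means. -/
theorem mul_lintegral_height_le (hc : 1 ≤ c) (hγ : 0 < γ) (K : ℕ) :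
    ENNReal.ofReal c *
        ∫⁻ t, ENNReal.ofReal t.height ∂ramOfOrder (tokunaga c) (tokunagaRate c γ) (K + 1) ≤
      ∫⁻ t, ENNReal.ofReal t.height ∂ramOfOrder (tokunaga c) (tokunagaRate c γ) (K + 2) := by
  have hc0 : 0 < c := by linarith
  have hlam := tokunagaRate_pos hc hγ
  have := isProbabilityMeasure_ramOfOrder (T := tokunaga c) hlam K
  have := isProbabilityMeasure_ramOfOrder (T := tokunaga c) hlam (K + 1)
  have h1 : ∫⁻ t, ENNReal.ofReal t.height
      ∂ramOfOrder (tokunaga c) (tokunagaRate c γ) (K + 2) = ENNReal.ofReal c *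
        ∫⁻ t, ENNReal.ofReal (t.height / c)
          ∂ramOfOrder (tokunaga c) (tokunagaRate c γ) (K + 2) := by
    rw [← lintegral_const_mul' _ _ ENNReal.ofReal_ne_top]
    refine lintegral_congr fun t => ?_
    rw [← ENNReal.ofReal_mul hc0.le, mul_div_cancel₀ _ hc0.ne']
  have h2 : 0 ≤ᵐ[ramOfOrder (tokunaga c) (tokunagaRate c γ) (K + 2)]
      fun t : StreamTree => t.height / c := by
    filter_upwards [ae_height_nonneg hlam (K + 1)] with t ht
    exact div_nonneg ht hc0.le
  rw [h1, lintegral_eq_lintegral_meas_lt _ (ae_height_nonneg hlam K)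
    measurable_height.aemeasurable, lintegral_eq_lintegral_meas_lt _ h2
    (measurable_height.div_const c).aemeasurable]
  refine mul_le_mul_right (lintegral_mono fun y => ?_) _
  have h3 : {t : StreamTree | y < t.height / c} = {t : StreamTree | t.height ≤ c * y}ᶜ := by
    ext t
    simp [lt_div_iff₀ hc0, mul_comm]
  have h4 : {t : StreamTree | y < t.height} = {t : StreamTree | t.height ≤ y}ᶜ := by
    ext t; simp
  rw [h3, h4, prob_compl_eq_one_sub (measurableSet_height_le _),
    prob_compl_eq_one_sub (measurableSet_height_le _)]
  exact tsub_le_tsub_left (ramOfOrder_height_le_mul hc hγ K y) 1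

end HeightLaw

/-! ### Conditioning on the order, and means over streams. -/

section OrderMean

open StreamTree

variable {c γ : ℝ}

theorem criticalTokunaga_apply_inter (hc : 1 ≤ c) (hγ : 0 < γ) (K : ℕ) {s : Set StreamTree}
    (hs : MeasurableSet s) :
    criticalTokunaga c γ ({t | t.ord = K + 1} ∩ s) = ENNReal.ofReal ((2 : ℝ)⁻¹ ^ (K + 1)) *
      ramOfOrder (tokunaga c) (tokunagaRate c γ) (K + 1) s := by
  have hlam := tokunagaRate_pos hc hγ
  change ram (tokunaga c) (tokunagaRate c γ) (fun K => (2 : ℝ)⁻¹ ^ K) _ = _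
  rw [ram, Measure.sum_apply _ ((measurableSet_ord_eq _).inter hs), tsum_eq_single (K + 1)]
  · rw [Measure.smul_apply, smul_eq_mul]
    congr 1
    refine measure_congr ?_
    filter_upwards [ae_ord_ramOfOrder hlam K] with t ht
    exact propext ⟨fun h => h.2, fun h => ⟨ht, h⟩⟩
  · intro j hj
    rw [Measure.smul_apply, smul_eq_mul]
    cases j with
    | zero => simp [ramOfOrder]
    | succ j =>
      have : ramOfOrder (tokunaga c) (tokunagaRate c γ) (j + 1) ({t | t.ord = K + 1} ∩ s) = 0 := by
        refine measure_mono_null (fun t ht => ?_) (ae_ord_ramOfOrder hlam j)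
        have h1 : t.ord = K + 1 := ht.1
        change ¬ t.ord = j + 1
        omega
      rw [this, mul_zero]

/-- The components of the mixture live on disjoint sets of orders, so conditioning selects one of
them and its weight cancels. -/
theorem criticalTokunaga_cond (hc : 1 ≤ c) (hγ : 0 < γ) (K : ℕ) :
    (criticalTokunaga c γ)[|{t | t.ord = K + 1}] =
      ramOfOrder (tokunaga c) (tokunagaRate c γ) (K + 1) := by
  have := isProbabilityMeasure_ramOfOrder (T := tokunaga c) (tokunagaRate_pos hc hγ) K
  have h0 : ENNReal.ofReal ((2 : ℝ)⁻¹ ^ (K + 1)) ≠ 0 := by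
    simp only [ne_eq, ENNReal.ofReal_eq_zero, not_le]
    positivity
  ext s hs
  have h1 := criticalTokunaga_apply_inter hc hγ K MeasurableSet.univ
  rw [inter_univ, measure_univ, mul_one] at h1
  rw [cond_apply (measurableSet_ord_eq _), criticalTokunaga_apply_inter hc hγ K hs, h1, ← mul_assoc,
    ENNReal.inv_mul_cancel h0 ENNReal.ofReal_ne_top, one_mul]

theorem hasOrderMean_iff (hc : 1 ≤ c) (hγ : 0 < γ) (K : ℕ) (X : StreamTree → ℝ) (m : ℝ) :
    HasOrderMean (criticalTokunaga c γ) (K + 1) X m ↔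
      Integrable X (ramOfOrder (tokunaga c) (tokunagaRate c γ) (K + 1)) ∧
        ∫ t, X t ∂ramOfOrder (tokunaga c) (tokunagaRate c γ) (K + 1) = m := by
  rw [HasOrderMean, criticalTokunaga_cond hc hγ]

theorem integrable_toReal_and_integral_eq {X : Type*} [MeasurableSpace X] {μ : Measure X}
    {f : X → ℝ≥0∞} (hf : Measurable f) {m : ℝ} (hm : 0 ≤ m) (h : ∫⁻ x, f x ∂μ = ENNReal.ofReal m) :
    Integrable (fun x => (f x).toReal) μ ∧ ∫ x, (f x).toReal ∂μ = m := by
  have hne : ∫⁻ x, f x ∂μ ≠ ∞ := h ▸ ENNReal.ofReal_ne_top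
  refine ⟨integrable_toReal_of_lintegral_ne_top hf.aemeasurable hne, ?_⟩
  rw [integral_toReal hf.aemeasurable (ae_lt_top hf hne), h, ENNReal.toReal_ofReal hm]

theorem sum_map_ofReal_ne_top {X : Type*} (Z : X → ℝ) (l : List X) :
    (l.map fun x => ENNReal.ofReal (Z x)).sum ≠ ∞ := by
  induction l with
  | nil => simp
  | cons x l ih => simp [ih]

theorem sum_map_eq_toReal {X : Type*} {Z : X → ℝ} (l : List X) (hZ : ∀ x ∈ l, 0 ≤ Z x) :
    (l.map Z).sum = ((l.map fun x => ENNReal.ofReal (Z x)).sum).toReal := by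
  induction l with
  | nil => simp
  | cons x l ih =>
    rw [List.forall_mem_cons] at hZ
    rw [List.map_cons, List.sum_cons, List.map_cons, List.sum_cons,
      ENNReal.toReal_add ENNReal.ofReal_ne_top (sum_map_ofReal_ne_top Z l),
      ENNReal.toReal_ofReal hZ.1, ih hZ.2]

theorem numStreams_eq_toReal (i : ℕ) (t : StreamTree) :
    (t.numStreams i : ℝ) = (t.streamSum i fun _ => 1).toReal := by
  simp [numStreams, streamSum]

theorem hasOrderMean_numStreams (hc : 1 ≤ c) (hγ : 0 < γ) {a b : ℕ} (hab : a ≤ b) :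
    HasOrderMean (criticalTokunaga c γ) (b + 1) (fun t => (t.numStreams (a + 1) : ℝ))
      (branchMean c (b - a)) := by
  have := isProbabilityMeasure_ramOfOrder (T := tokunaga c) (tokunagaRate_pos hc hγ) a
  have hb := one_le_branchMean hc (b - a)
  rw [hasOrderMean_iff hc hγ]
  simp only [numStreams_eq_toReal]
  refine integrable_toReal_and_integral_eq (measurable_streamSum _ measurable_const)
    (by linarith) ?_
  rw [lintegral_streamSum_tokunaga hc hγ a b measurable_const, if_pos hab]
  simp

/-- The formula for stream sums, applied to the indicator of the exceptional set: its sum over the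
streams has mean zero. -/
theorem ae_forall_streams (hc : 1 ≤ c) (hγ : 0 < γ) (a b : ℕ) {P : StreamTree → Prop}
    (hPm : MeasurableSet {t | P t})
    (hP : ∀ᵐ t ∂ramOfOrder (tokunaga c) (tokunagaRate c γ) (a + 1), P t) :
    ∀ᵐ t ∂ramOfOrder (tokunaga c) (tokunagaRate c γ) (b + 1), ∀ s ∈ t.streams (a + 1), P s := by
  have hi : Measurable ({t | P t}ᶜ.indicator (1 : StreamTree → ℝ≥0∞)) :=
    measurable_one.indicator hPm.compl
  have h0 : ∫⁻ t, {t | P t}ᶜ.indicator 1 t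
      ∂ramOfOrder (tokunaga c) (tokunagaRate c γ) (a + 1) = 0 := by
    rw [lintegral_indicator_one hPm.compl]
    exact hP
  have h1 := lintegral_streamSum_tokunaga hc hγ a b hi
  rw [h0, mul_zero, lintegral_eq_zero_iff (measurable_streamSum _ hi)] at h1
  filter_upwards [h1] with t ht s hs
  have h2 := List.sum_eq_zero_iff.1 ht _ (List.mem_map_of_mem hs)
  by_contra hPs
  rw [indicator_of_mem (by exact hPs)] at h2
  simp at h2

/-- An attribute whose mean over the trees of order `i` is `z i` has the stream mean `z`. -/
theorem isStreamMean_of_lintegral (hc : 1 ≤ c) (hγ : 0 < γ) {Z : StreamTree → ℝ} {z : ℕ → ℝ}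
    (hZm : Measurable Z) (hz : ∀ n, 0 ≤ z (n + 1))
    (hZ0 : ∀ n, ∀ᵐ t ∂ramOfOrder (tokunaga c) (tokunagaRate c γ) (n + 1), 0 ≤ Z t)
    (hZ : ∀ n, ∫⁻ t, ENNReal.ofReal (Z t) ∂ramOfOrder (tokunaga c) (tokunagaRate c γ) (n + 1) =
      ENNReal.ofReal (z (n + 1))) :
    IsStreamMean (criticalTokunaga c γ) Z z := by
  intro i K hi hiK
  obtain ⟨a, rfl⟩ := Nat.exists_eq_add_of_le' hi
  obtain ⟨b, rfl⟩ := Nat.exists_eq_add_of_le' (hi.trans hiK)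
  have hab : a ≤ b := by omega
  have hb := one_le_branchMean hc (b - a)
  have hZm' : Measurable fun t => ENNReal.ofReal (Z t) := hZm.ennreal_ofReal
  refine ⟨branchMean c (b - a), branchMean c (b - a) * z (a + 1), by linarith,
    hasOrderMean_numStreams hc hγ hab, ?_, by field_simp⟩
  have h1 := integrable_toReal_and_integral_eq (measurable_streamSum (a + 1) hZm')
    (mul_nonneg (zero_le_one.trans hb) (hz a))
    (μ := ramOfOrder (tokunaga c) (tokunagaRate c γ) (b + 1)) (by
      rw [lintegral_streamSum_tokunaga hc hγ a b hZm', if_pos hab, hZ,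
        ENNReal.ofReal_mul (by linarith)])
  have h2 : (fun t : StreamTree => ((t.streams (a + 1)).map Z).sum)
      =ᵐ[ramOfOrder (tokunaga c) (tokunagaRate c γ) (b + 1)]
      fun t => (t.streamSum (a + 1) fun s => ENNReal.ofReal (Z s)).toReal := by
    filter_upwards [ae_forall_streams hc hγ a b (P := fun t => 0 ≤ Z t)
      (measurableSet_le measurable_const hZm) (hZ0 a)] with t ht
    exact sum_map_eq_toReal _ ht
  rw [hasOrderMean_iff hc hγ]
  exact ⟨h1.1.congr h2.symm, (integral_congr_ae h2).trans h1.2⟩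

/-- The hypothesis says that no link has negative local area. In this form it holds almost surely,
again by the formula for link sums. -/
theorem ofReal_area_eq_linkSum {a : ℝ → ℝ} (t : StreamTree)
    (h : t.linkSum (fun x => ENNReal.ofReal (-a x)) = 0) :
    0 ≤ t.area a ∧ ENNReal.ofReal (t.area a) = t.linkSum fun x => ENNReal.ofReal (a x) := by
  induction t with
  | leaf ℓ =>
    simp only [linkSum, ENNReal.ofReal_eq_zero, Left.neg_nonpos_iff] at h
    exact ⟨h, rfl⟩
  | node ℓ l r hl hr =>
    simp only [linkSum, add_eq_zero, ENNReal.ofReal_eq_zero, Left.neg_nonpos_iff] at h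
    obtain ⟨h1, h2⟩ := hl h.1.2
    obtain ⟨h3, h4⟩ := hr h.2
    refine ⟨add_nonneg (add_nonneg h.1.1 h1) h3, ?_⟩
    rw [area, linkSum, ENNReal.ofReal_add (add_nonneg h.1.1 h1) h3,
      ENNReal.ofReal_add h.1.1 h1, h2, h4]

theorem ae_linkSum_neg_eq_zero (hc : 1 ≤ c) (hγ : 0 < γ) {a : ℝ → ℝ} (ha : Measurable a)
    (ha0 : ∀ x, 0 < x → 0 ≤ a x) (n : ℕ) :
    ∀ᵐ t ∂ramOfOrder (tokunaga c) (tokunagaRate c γ) (n + 1),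
      t.linkSum (fun x => ENNReal.ofReal (-a x)) = 0 := by
  have hm : Measurable fun x => ENNReal.ofReal (-a x) := by fun_prop
  have h1 := lintegral_linkSum_tokunaga hc hγ n hm
  have h2 : ∫⁻ x, ENNReal.ofReal (-a x) ∂expMeasure γ = 0 := by
    rw [lintegral_eq_zero_iff hm]
    filter_upwards [ae_expMeasure_pos] with x hx
    simpa using ha0 x hx
  rw [h2, mul_zero, lintegral_eq_zero_iff (measurable_linkSum hm)] at h1
  exact h1

end OrderMean

/-! ### Horton exponents, limits of the explicit means, and the root of the generating function. -/

section Horton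

/-- Two exponents would make the powers of R/R₀ converge to a nonzero limit. A shift of the index
multiplies this limit by R/R₀, which is therefore 1. -/
theorem isHortonExponent_iff {z : ℕ → ℝ} {R₀ C : ℝ} (hR₀ : 0 < R₀) (hC : 0 < C)
    (hz : Tendsto (fun k : ℕ => z k / R₀ ^ k) atTop (𝓝 C)) (R : ℝ) :
    IsHortonExponent z R ↔ R = R₀ := by
  constructor
  · rintro ⟨hR, C', hC', hz'⟩
    have h1 : Tendsto (fun k : ℕ => (R / R₀) ^ k) atTop (𝓝 (C / C')) := by
      refine (hz.div hz' hC'.ne').congr' ?_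
      filter_upwards [hz.eventually_const_lt hC] with k hk
      have hzk : z k ≠ 0 := by
        rintro h
        simp [h] at hk
      rw [Pi.div_apply, div_pow]
      field_simp
    have h2 := (tendsto_add_atTop_iff_nat 1).2 h1
    simp only [pow_succ] at h2
    have h3 := tendsto_nhds_unique h2 (h1.mul_const (R / R₀))
    have h4 : C / C' ≠ 0 := (div_pos hC hC').ne'
    have h5 : R / R₀ = 1 := by
      have : C / C' * (R / R₀) = C / C' * 1 := by rw [← h3, mul_one]
      exact mul_left_cancel₀ h4 this
    rwa [div_eq_one_iff_eq hR₀.ne'] at h5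
  · rintro rfl
    exact ⟨hR₀, C, hC, hz⟩

variable {c : ℝ}

theorem tendsto_geom_sum_div_pow {r : ℝ} (hr : 1 < r) :
    Tendsto (fun n : ℕ => (∑ i ∈ Finset.range n, r ^ i) / r ^ n) atTop (𝓝 (1 / (r - 1))) := by
  have h1 : Tendsto (fun n : ℕ => (1 - r⁻¹ ^ n) / (r - 1)) atTop (𝓝 ((1 - 0) / (r - 1))) :=
    ((tendsto_pow_atTop_nhds_zero_of_lt_one (by positivity) (inv_lt_one_of_one_lt₀ hr)).const_sub
      1).div_const _
  rw [sub_zero] at h1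
  refine h1.congr fun n => ?_
  have h2 : r - 1 ≠ 0 := by linarith
  have h3 : r ^ n ≠ 0 := by positivity
  rw [geom_sum_eq hr.ne', inv_pow]
  field_simp

theorem tendsto_branchMean (hc : 1 ≤ c) :
    Tendsto (fun n : ℕ => branchMean c n / (2 * c) ^ n) atTop (𝓝 (c / (2 * c - 1))) := by
  have hr : 1 < 2 * c := by linarith
  have h1 := (tendsto_pow_atTop_nhds_zero_of_lt_one (by positivity)
    (inv_lt_one_of_one_lt₀ hr)).add ((tendsto_geom_sum_div_pow hr).const_mul c)
  rw [zero_add, mul_one_div] at h1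
  refine h1.congr fun n => ?_
  have h3 : (2 * c) ^ n ≠ 0 := by positivity
  rw [branchMean, inv_pow]
  field_simp

theorem tendsto_branchMean_ratio (hc : 1 ≤ c) :
    Tendsto (fun n : ℕ => branchMean c (n + 1) / branchMean c n) atTop (𝓝 (2 * c)) := by
  have hc0 : 0 < c := by linarith
  have h1 := tendsto_branchMean hc
  have hC : c / (2 * c - 1) ≠ 0 := (div_pos hc0 (by linarith)).ne'
  have h2 := (((tendsto_add_atTop_iff_nat 1).2 h1).div h1 hC).const_mul (2 * c)
  rw [div_self hC, mul_one] at h2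
  refine h2.congr fun n => ?_
  have h3 := one_le_branchMean hc n
  rw [Pi.div_apply, pow_succ]
  field_simp

theorem one_add_sum_Icc_tokunaga (c : ℝ) (n : ℕ) :
    1 + ∑ i ∈ Finset.Icc 1 n, tokunaga c i = c ^ n := by
  induction n with
  | zero => simp
  | succ n ih =>
    rw [Finset.sum_Icc_succ_top (by omega), ← add_assoc, ih, tokunaga, Nat.add_sub_cancel]
    ring

theorem isTokunagaRoot_iff (hc : 1 ≤ c) (w : ℝ) :
    (w ∈ Ioc (0 : ℝ) (1 / 2) ∧ IsTokunagaRoot (tokunaga c) w) ↔ w = 1 / (2 * c) := by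
  have hc0 : 0 < c := by linarith
  have hterm (k : ℕ) : tokunaga c (k + 1) * w ^ (k + 1) = (c - 1) * w * (c * w) ^ k := by
    rw [tokunaga, Nat.add_sub_cancel, mul_pow]
    ring
  have hsum (hw0 : 0 ≤ w) (hw : c * w < 1) :
      HasSum (fun k : ℕ => tokunaga c (k + 1) * w ^ (k + 1)) ((c - 1) * w * (1 - c * w)⁻¹) := by
    simp only [hterm]
    exact (hasSum_geometric_of_lt_one (by positivity) hw).mul_left _
  constructor
  · rintro ⟨⟨hw0, hw1⟩, hs, h⟩
    rcases hc.eq_or_lt with rfl | hc1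
    · simp only [hterm, sub_self, zero_mul, tsum_zero] at h
      linarith
    -- For c > 1 the factor (c - 1) w is nonzero, so summability is that of a geometric series.
    · have hcw : c * w < 1 := by
        simp only [hterm] at hs
        have h2 := (summable_mul_left_iff
          (mul_ne_zero (sub_ne_zero.2 hc1.ne') hw0.ne')).1 hs
        rw [summable_geometric_iff_norm_lt_one, Real.norm_of_nonneg (by positivity)] at h2
        exact h2
      rw [(hsum hw0.le hcw).tsum_eq] at h
      have h1 : 1 - c * w ≠ 0 := by linarith
      -- The equation after clearing the denominator; the root w = 1 lies outside the interval.
      have h2 : (2 * c * w - 1) * (1 - w) = 0 := by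
        linear_combination (1 - c * w) * h - (c - 1) * w * mul_inv_cancel₀ h1
      rcases mul_eq_zero.1 h2 with h3 | h3
      · rw [eq_div_iff (by positivity)]
        linarith
      · linarith
  · rintro rfl
    have hw0 : (0 : ℝ) ≤ 1 / (2 * c) := by positivity
    have hcw : c * (1 / (2 * c)) = 1 / 2 := by field_simp
    have h := hsum hw0 (by rw [hcw]; norm_num)
    refine ⟨⟨by positivity, ?_⟩, h.summable, ?_⟩
    · rw [div_le_div_iff₀ (by positivity) two_pos]
      linarith
    · rw [h.tsum_eq, hcw]
      field_simp
      ring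

end Horton

/-! ### Convergence of the normalized mean height. -/

section MeanHeight

variable {c γ : ℝ}

/-- The mean height of a tree of order `K` in the critical Tokunaga model. -/
noncomputable def meanHeight (c γ : ℝ) (K : ℕ) : ℝ :=
  (∫⁻ t, ENNReal.ofReal t.height ∂ramOfOrder (tokunaga c) (tokunagaRate c γ) K).toReal

theorem ofReal_meanHeight (hc : 1 ≤ c) (hγ : 0 < γ) (n : ℕ) :
    ENNReal.ofReal (meanHeight c γ (n + 1)) =
      ∫⁻ t, ENNReal.ofReal t.height ∂ramOfOrder (tokunaga c) (tokunagaRate c γ) (n + 1) :=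
  ENNReal.ofReal_toReal (lintegral_height_lt_top (tokunagaRate_pos hc hγ) n).ne

/-- The normalized means are nondecreasing by stochastic growth and bounded by the moment estimate.
The limit is their supremum, positive because the first term is. -/
theorem tendsto_meanHeight (hc : 1 < c) (hγ : 0 < γ) :
    ∃ C : ℝ, 0 < C ∧ Tendsto (fun k : ℕ => meanHeight c γ k / c ^ k) atTop (𝓝 C) := by
  have hc0 : 0 < c := by linarith
  have hfin (n : ℕ) := (lintegral_height_lt_top (T := tokunaga c) (tokunagaRate_pos hc.le hγ) n).ne
  have hmono : Monotone fun k : ℕ => meanHeight c γ (k + 1) / c ^ (k + 1) := by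
    refine monotone_nat_of_le_succ fun n => ?_
    have h1 := ENNReal.toReal_mono (hfin (n + 1)) (mul_lintegral_height_le hc.le hγ n)
    rw [ENNReal.toReal_mul, ENNReal.toReal_ofReal hc0.le] at h1
    change c * meanHeight c γ (n + 1) ≤ meanHeight c γ (n + 1 + 1) at h1
    rw [div_le_div_iff₀ (by positivity) (by positivity), pow_succ c (n + 1)]
    have := mul_le_mul_of_nonneg_left h1 (pow_nonneg hc0.le (n + 1))
    linarith
  obtain ⟨D, hD0, hD⟩ := exists_lintegral_height_le hc hγ
  have hbdd : BddAbove (range fun k : ℕ => meanHeight c γ (k + 1) / c ^ (k + 1)) := by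
    refine ⟨D, ?_⟩
    rintro _ ⟨n, rfl⟩
    have h1 := ENNReal.toReal_mono ENNReal.ofReal_ne_top (hD n)
    rw [ENNReal.toReal_ofReal (by positivity)] at h1
    change meanHeight c γ (n + 1) ≤ _ at h1
    rw [div_le_iff₀ (by positivity)]
    have : c ^ n ≤ c ^ (n + 1) := pow_le_pow_right₀ hc.le (by omega)
    nlinarith
  have h1 : meanHeight c γ 1 = 1 / γ := by
    have := lintegral_height_pow_one (T := tokunaga c) 1 (tokunagaRate_pos hc.le hγ)
    simp only [pow_one] at this
    rw [meanHeight, this, ENNReal.toReal_ofReal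
      (div_nonneg (by positivity) (tokunagaRate_pos hc.le hγ 1).le)]
    simp [tokunagaRate]
  have h2 := tendsto_atTop_ciSup hmono hbdd
  refine ⟨_, ?_, (tendsto_add_atTop_iff_nat 1).1 h2⟩
  refine lt_of_lt_of_le ?_ (le_ciSup hbdd 0)
  rw [zero_add, h1]
  positivity

end MeanHeight

/-! ### The theorem. -/

theorem corollary3 (c γ : ℝ) (hc : 1 ≤ c) (hγ : 0 < γ)
    (a : ℝ → ℝ) (ha_meas : Measurable a) (ha_nonneg : ∀ x : ℝ, 0 < x → 0 ≤ a x)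
    (ha_int : Integrable a (expMeasure γ)) (ha_pos : 0 < ∫ x, a x ∂(expMeasure γ)) :
    (∀ w : ℝ, (w ∈ Ioc (0 : ℝ) (1 / 2) ∧ IsTokunagaRoot (tokunaga c) w) ↔ w = 1 / (2 * c)) ∧
    ∃ (N : ℕ → ℕ → ℝ) (M A S L Λ : ℕ → ℝ),
      (∀ i K : ℕ, 1 ≤ i → i ≤ K →
        HasOrderMean (criticalTokunaga c γ) K (fun t => (t.numStreams i : ℝ)) (N i K)) ∧
      IsStreamMean (criticalTokunaga c γ) (fun t => (t.magnitude : ℝ)) M ∧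
      IsStreamMean (criticalTokunaga c γ) (fun t => t.area a) A ∧
      IsStreamMean (criticalTokunaga c γ) (fun t => (t.streamLinks : ℝ)) S ∧
      IsStreamMean (criticalTokunaga c γ) (fun t => t.streamLength) L ∧
      IsStreamMean (criticalTokunaga c γ) (fun t => t.height) Λ ∧
      (∀ R : ℝ, IsHortonExponent (fun K => N 1 K) R ↔ R = 2 * c) ∧
      (∀ i : ℕ, 1 ≤ i → Tendsto (fun K => N i K / N (i + 1) K) atTop (𝓝 (2 * c))) ∧
      (∀ R : ℝ, IsHortonExponent M R ↔ R = 2 * c) ∧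
      (∀ R : ℝ, IsHortonExponent A R ↔ R = 2 * c) ∧
      (∀ R : ℝ, IsHortonExponent S R ↔ R = c) ∧
      (∀ R : ℝ, IsHortonExponent L R ↔ R = c) ∧
      (1 < c → ∀ R : ℝ, IsHortonExponent Λ R ↔ R = c) ∧
      c < 2 * c ∧
      (∀ K : ℕ, 1 ≤ K →
        S K = 1 + ∑ i ∈ Finset.Icc 1 (K - 1), tokunaga c i ∧ S K = c ^ (K - 1)) := by
  have hc0 : 0 < c := by linarith
  have hlam := tokunagaRate_pos hc hγ
  have hlink (n : ℕ) : 0 ≤ linkMean c n := Finset.sum_nonneg fun i _ => by positivity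
  have hbranch (n : ℕ) : 0 ≤ branchMean c n := zero_le_one.trans (one_le_branchMean hc n)
  set α := ∫ x, a x ∂expMeasure γ with hα
  -- Serves both the number of sources and the magnitude, which have the same mean; the shift by one
  -- divides the limit by 2c.
  have hbranchExp : ∀ R : ℝ, IsHortonExponent (fun K => branchMean c (K - 1)) R ↔ R = 2 * c := by
    refine isHortonExponent_iff (by positivity)
      (div_pos (div_pos hc0 (by linarith)) (by positivity) : 0 < c / (2 * c - 1) / (2 * c)) ?_
    refine (tendsto_add_atTop_iff_nat 1).1 (((tendsto_branchMean hc).div_const (2 * c)).congr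
      fun n => ?_)
    rw [Nat.add_sub_cancel, pow_succ, div_div]
  refine ⟨isTokunagaRoot_iff hc, fun i K => branchMean c (K - i), fun K => branchMean c (K - 1),
    fun K => linkMean c (K - 1) * α, fun K => c ^ (K - 1), fun K => c ^ (K - 1) / γ,
    meanHeight c γ, ?_, ?_, ?_, ?_, ?_, ?_, hbranchExp, ?_, hbranchExp, ?_, ?_, ?_, ?_,
    by linarith, ?_⟩
  · intro i K hi hiK
    obtain ⟨i, rfl⟩ := Nat.exists_eq_add_of_le' hi
    obtain ⟨K, rfl⟩ := Nat.exists_eq_add_of_le' (hi.trans hiK)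
    dsimp only
    rw [Nat.add_sub_add_right]
    exact hasOrderMean_numStreams hc hγ (by omega)
  · refine isStreamMean_of_lintegral hc hγ
      ((measurable_from_top (f := fun n : ℕ => (n : ℝ))).comp StreamTree.measurable_magnitude)
      (fun n => hbranch _) (fun n => Eventually.of_forall fun t => Nat.cast_nonneg _) fun n => ?_
    simp only [ENNReal.ofReal_natCast]
    exact lintegral_magnitude_tokunaga hc hγ n
  · have hae (n : ℕ) := ae_linkSum_neg_eq_zero hc hγ ha_meas ha_nonneg n
    refine isStreamMean_of_lintegral hc hγ (StreamTree.measurable_area ha_meas)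
      (fun n => mul_nonneg (hlink _) ha_pos.le) (fun n => ?_) fun n => ?_
    · filter_upwards [hae n] with t ht
      exact (ofReal_area_eq_linkSum t ht).1
    · have h1 : ∀ᵐ t ∂ramOfOrder (tokunaga c) (tokunagaRate c γ) (n + 1),
          ENNReal.ofReal (t.area a) = t.linkSum fun x => ENNReal.ofReal (a x) := by
        filter_upwards [hae n] with t ht
        exact (ofReal_area_eq_linkSum t ht).2
      have h2 : 0 ≤ᵐ[expMeasure γ] a := by
        filter_upwards [ae_expMeasure_pos] with x hx
        exact ha_nonneg x hx
      rw [lintegral_congr_ae h1, lintegral_linkSum_tokunaga hc hγ n ha_meas.ennreal_ofReal,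
        ← ofReal_integral_eq_lintegral_ofReal ha_int h2, ← ENNReal.ofReal_mul (hlink n),
        Nat.add_sub_cancel]
  · refine isStreamMean_of_lintegral hc hγ
      ((measurable_from_top (f := fun n : ℕ => (n : ℝ))).comp StreamTree.measurable_streamLinks)
      (fun n => by positivity) (fun n => Eventually.of_forall fun t => Nat.cast_nonneg _)
      fun n => ?_
    simp only [ENNReal.ofReal_natCast]
    exact lintegral_streamLinks_tokunaga hc hγ n
  · refine isStreamMean_of_lintegral hc hγ StreamTree.measurable_streamLength
      (fun n => by positivity) (fun n => ?_) fun n => ?_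
    -- The law of the length, tested on the negative half-line, gives almost sure nonnegativity.
    · have h1 := lintegral_streamLength_tokunaga hc hγ n
        (f := fun x => (Ici (0 : ℝ))ᶜ.indicator 1 x)
        (measurable_one.indicator measurableSet_Ici.compl)
      rw [lintegral_indicator_one measurableSet_Ici.compl] at h1
      have h2 : expMeasure (tokunagaRate c γ (n + 1)) (Ici 0)ᶜ = 0 := by
        have : ∀ᵐ x ∂expMeasure (tokunagaRate c γ (n + 1)), x ∈ Ici (0 : ℝ) := by
          filter_upwards [ae_expMeasure_pos] with x hx
          exact hx.le
        exact this
      have hm : Measurable fun t : StreamTree =>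
          (Ici (0 : ℝ))ᶜ.indicator (1 : ℝ → ℝ≥0∞) t.streamLength :=
        (measurable_one.indicator measurableSet_Ici.compl).comp StreamTree.measurable_streamLength
      rw [h2, lintegral_eq_zero_iff hm] at h1
      filter_upwards [h1] with t ht
      by_contra h
      simp [indicator, h] at ht
    · rw [lintegral_streamLength_tokunaga hc hγ n ENNReal.measurable_ofReal,
        lintegral_ofReal_expMeasure (hlam _), tokunagaRate_succ, one_div_div, Nat.add_sub_cancel]
  · exact isStreamMean_of_lintegral hc hγ StreamTree.measurable_height
      (fun n => ENNReal.toReal_nonneg) (ae_height_nonneg hlam)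
      fun n => (ofReal_meanHeight hc hγ n).symm
  · intro i _
    refine (tendsto_add_atTop_iff_nat (i + 1)).1 ((tendsto_branchMean_ratio hc).congr fun n => ?_)
    dsimp only
    rw [show n + (i + 1) - i = n + 1 by omega, Nat.add_sub_cancel]
  · refine isHortonExponent_iff (by positivity)
      (mul_pos (one_div_pos.2 (by linarith)) ha_pos : 0 < 1 / (2 * c - 1) * α) ?_
    have h1 := (tendsto_add_atTop_iff_nat 1).2
      (tendsto_geom_sum_div_pow (by linarith : 1 < 2 * c))
    refine (tendsto_add_atTop_iff_nat 1).1 ((h1.mul_const α).congr fun n => ?_)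
    rw [Nat.add_sub_cancel, linkMean, div_mul_eq_mul_div]
  · refine isHortonExponent_iff hc0 (one_div_pos.2 hc0) ?_
    refine (tendsto_add_atTop_iff_nat 1).1 (tendsto_const_nhds.congr fun n => ?_)
    rw [Nat.add_sub_cancel, pow_succ]
    field_simp
  · refine isHortonExponent_iff hc0 (by positivity : 0 < 1 / (c * γ)) ?_
    refine (tendsto_add_atTop_iff_nat 1).1 (tendsto_const_nhds.congr fun n => ?_)
    rw [Nat.add_sub_cancel, pow_succ]
    field_simp
  · intro hc1
    obtain ⟨C, hC, h⟩ := tendsto_meanHeight hc1 hγ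
    exact isHortonExponent_iff hc0 hC h
  · intro K _
    exact ⟨(one_add_sum_Icc_tokunaga c _).symm, rfl⟩
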